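/- Conventions. Manifolds are finite-dimensional real smooth manifolds, Hausdorff and second countable, without boundary; Lie groups are Lie groups on such manifolds. A right action of a Lie group $G$ on a manifold $P$ is \emph{principal} if it is smooth, free and proper, where proper means that for each compact $K\subset P$ the set $\{g\in G : Kg\cap K\neq\emptyset\}$ is relatively compact in $G$. In this case the orbit spaces $P/G$ and $\mathcal G=(P\times P)/G$ (diagonal action, orbits denoted $\langle p,q\rangle_G$) are manifolds, with the unique structures for which the canonical projections are submersions, and $\mathcal G\rightrightarrows P/G$ is a Lie groupoid, the \emph{gauge groupoid}, with source $\langle p,q\rangle_G\mapsto [q]$, target $\langle p,q\rangle_G\mapsto[p]$ and multiplication $\langle p,q\rangle_G\bullet\langle q,r\rangle_G=\langle p,r\rangle_G$. An action of a Lie group on a Lie groupoid is \emph{compatible} if it is smooth and every group element acts by a Lie groupoid isomorphism; it is \emph{pre-principal} if the induced action of the quotient Lie group by the kernel of the action is principal. Two principal actions of Lie groups $G$ and $G'$ on $P$ make $P$ a \emph{double principal bundle} if $\langle p,q\rangle_G\,g'=\langle pg',qg'\rangle_G$ is a well-defined, compatible, pre-principal action of $G'$ on the Lie groupoid $(P\times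 P)/G$, and likewise with the roles of $G$ and $G'$ exchanged. Theorem. Let $(\widehat G;G,G')$ be a double principal group, that is, let $\widehat G$ be a Lie group and let $G,G'$ be closed normal subgroups of $\widehat G$ such that $G\cup G'$ generates $\widehat G$. Let $r:P\times\widehat G\to P$ be a principal action on a manifold $P$. Then $G$ and $G'$, with structures of embedded Lie subgroups of $\widehat G$, act on $P$ by the restrictions $r|_G$ and $r|_{G'}$ so that $P$ is a double principal bundle. Moreover, if $P\neq\emptyset$, the kernels of the induced actions of $G'$ on $(P\times P)/G$ and of $G$ on $(P\times P)/G'$ are both equal to $G_0=G\cap G'$; thus the quotient groups $G'/G_0$ and $G/G_0$ act on these gauge groupoids by compatible, free and proper actions. -/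

import Mathlib

open scoped Manifold ContDiff

/-! ### Smooth manifolds -/

/-- A structure of a (finite-dimensional, real, Hausdorff, second countable, boundaryless) smooth
manifold on a topological space `X`, modelled on the normed space `E`. -/
structure ManifoldStr (X : Type*) [TopologicalSpace X] where
  E : Type
  [normedAddCommGroup : NormedAddCommGroup E]
  [normedSpace : NormedSpace ℝ E]
  [finiteDimensional : FiniteDimensional ℝ E]
  [chartedSpace : ChartedSpace E X]
  [isManifold : IsManifold 𝓘(ℝ, E) ∞ X]
  t2Space : T2Space X
  secondCountable : SecondCountableTopology X

attribute [instance] ManifoldStr.normedAddCommGroup ManifoldStr.normedSpace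
  ManifoldStr.finiteDimensional ManifoldStr.chartedSpace ManifoldStr.isManifold

/-- The model with corners of a manifold structure. -/
noncomputable abbrev ManifoldStr.I {X : Type*} [TopologicalSpace X] (S : ManifoldStr X) :
    ModelWithCorners ℝ S.E S.E :=
  𝓘(ℝ, S.E)

/-! ### Right actions -/

/-- A right action of a group `G` on a set `X`. -/
structure RightAction (G X : Type*) [Group G] where
  act : X → G → X
  act_one : ∀ x, act x 1 = x
  act_mul : ∀ x g h, act x (g * h) = act (act x g) h

namespace RightAction

section Basic

variable {G X : Type*} [Group G] (ρ : RightAction G X)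

/-- The restriction of an action to a subgroup. -/
def restrict (H : Subgroup G) : RightAction H X where
  act x h := ρ.act x h
  act_one x := by simpa using ρ.act_one x
  act_mul x g h := by simpa using ρ.act_mul x g h

/-- The diagonal action on `X × X`. -/
def diag : RightAction G (X × X) where
  act x g := (ρ.act x.1 g, ρ.act x.2 g)
  act_one x := by simp [ρ.act_one]
  act_mul x g h := by simp [ρ.act_mul]

/-- The equivalence relation "being in the same orbit". -/
def orbitSetoid : Setoid X where
  r x y := ∃ g, ρ.act x g = y
  iseqv :=
    { refl := fun x => ⟨1, ρ.act_one x⟩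
      symm := by
        rintro x y ⟨g, rfl⟩
        exact ⟨g⁻¹, by rw [← ρ.act_mul, mul_inv_cancel, ρ.act_one]⟩
      trans := by
        rintro x y z ⟨g, rfl⟩ ⟨h, rfl⟩
        exact ⟨g * h, ρ.act_mul x g h⟩ }

/-- The orbit space `X/G`; it carries the quotient topology as soon as `X` has a topology. -/
abbrev Orbits : Type _ := Quotient ρ.orbitSetoid

/-- The canonical projection `X → X/G`. -/
def proj (x : X) : ρ.Orbits := Quotient.mk ρ.orbitSetoid x

theorem proj_eq_iff {x y : X} : ρ.proj x = ρ.proj y ↔ ∃ g, ρ.act x g = y :=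
  ⟨fun h => Quotient.exact h, fun h => Quotient.sound h⟩

/-- The kernel of an action. -/
def ker : Subgroup G where
  carrier := {g | ∀ x, ρ.act x g = x}
  one_mem' := ρ.act_one
  mul_mem' {g h} hg hh x := by rw [ρ.act_mul, hg, hh]
  inv_mem' {g} hg x := by
    conv_lhs => rw [← hg x]
    rw [← ρ.act_mul, mul_inv_cancel, ρ.act_one]

theorem mem_ker {g : G} : g ∈ ρ.ker ↔ ∀ x, ρ.act x g = x := Iff.rfl

instance ker_normal : ρ.ker.Normal where
  conj_mem n hn g x := by
    rw [ρ.act_mul, ρ.act_mul, hn, ← ρ.act_mul, mul_inv_cancel, ρ.act_one]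

/-- The action of `G / ker ρ` induced by `ρ`. -/
def quotientKer : RightAction (G ⧸ ρ.ker) X where
  act x c := Quotient.liftOn' c (ρ.act x) fun g h hgh => by
    have h1 : g⁻¹ * h ∈ ρ.ker := QuotientGroup.leftRel_apply.mp hgh
    have h2 := h1 (ρ.act x g)
    rw [← ρ.act_mul, mul_inv_cancel_left] at h2
    exact h2.symm
  act_one x := ρ.act_one x
  act_mul x c d := by
    induction c using QuotientGroup.induction_on
    induction d using QuotientGroup.induction_on
    exact ρ.act_mul x _ _

/-- Freeness: only the neutral element has fixed points. -/
def IsFree : Prop := ∀ x g, ρ.act x g = x → g = 1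

/-- Properness: for each compact `K ⊆ X`, the set `{g | Kg ∩ K ≠ ∅}` is relatively compact. -/
def IsProper [TopologicalSpace G] [TopologicalSpace X] : Prop :=
  ∀ K : Set X, IsCompact K → IsCompact (closure {g : G | ∃ x ∈ K, ρ.act x g ∈ K})

end Basic

section Smooth

variable {G X : Type*} [Group G] [TopologicalSpace G] [TopologicalSpace X]

/-- Smoothness of an action, as a map `X × G → X`. -/
def IsSmooth (SX : ManifoldStr X) (SG : ManifoldStr G) (ρ : RightAction G X) : Prop :=
  ContMDiff (SX.I.prod SG.I) SX.I ∞ fun x : X × G => ρ.act x.1 x.2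

/-- A principal action: a smooth, free and proper action of a Lie group. -/
structure IsPrincipal (SX : ManifoldStr X) (SG : ManifoldStr G) (ρ : RightAction G X) : Prop where
  lieGroup : LieGroup SG.I ∞ G
  smooth : ρ.IsSmooth SX SG
  free : ρ.IsFree
  proper : ρ.IsProper

/-- A pre-principal action: the induced action of the quotient Lie group `G / ker ρ` is
principal. The smooth structure on `G / ker ρ` is the one for which the canonical
projection is a submersion. -/
def IsPrePrincipal (SX : ManifoldStr X) (SG : ManifoldStr G) (ρ : RightAction G X) : Prop :=
  ∃ SQ : ManifoldStr (G ⧸ ρ.ker),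
    Manifold.IsSubmersion SG.I SQ.I ∞ (QuotientGroup.mk : G → G ⧸ ρ.ker) ∧
    ρ.quotientKer.IsPrincipal SX SQ

end Smooth

end RightAction

/-! ### Lie groupoids -/

/-- A groupoid with set of arrows `Γ` and set of units `M`; the product `mul a b` is
defined if `src a = tgt b`. -/
structure GroupoidStr (Γ M : Type*) where
  src : Γ → M
  tgt : Γ → M
  one : M → Γ
  inv : Γ → Γ
  mul : (a b : Γ) → src a = tgt b → Γ
  src_one : ∀ x, src (one x) = x
  tgt_one : ∀ x, tgt (one x) = x
  src_inv : ∀ a, src (inv a) = tgt a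
  tgt_inv : ∀ a, tgt (inv a) = src a
  src_mul : ∀ a b h, src (mul a b h) = src b
  tgt_mul : ∀ a b h, tgt (mul a b h) = tgt a
  mul_assoc : ∀ a b c (hab : src a = tgt b) (hbc : src b = tgt c),
    mul (mul a b hab) c ((src_mul a b hab).trans hbc) =
      mul a (mul b c hbc) (hab.trans (tgt_mul b c hbc).symm)
  mul_one : ∀ a, mul a (one (src a)) (tgt_one _).symm = a
  one_mul : ∀ a, mul (one (tgt a)) a (src_one _) = a
  mul_inv : ∀ a, mul a (inv a) (tgt_inv a).symm = one (tgt a)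
  inv_mul : ∀ a, mul (inv a) a (src_inv a) = one (src a)

section LieGroupoid

variable {Γ M Γ₂ M₂ : Type*} [TopologicalSpace Γ] [TopologicalSpace M]
  [TopologicalSpace Γ₂] [TopologicalSpace M₂]

/-- A Lie groupoid: a groupoid on manifolds of arrows and of units, with source and target
submersions and smooth structure maps. Smoothness of the partial multiplication on the embedded
submanifold `{(a, b) | src a = tgt b}` of `Γ × Γ` is smoothness on this subset. -/
structure IsLieGroupoid (SΓ : ManifoldStr Γ) (SM : ManifoldStr M) (𝒢 : GroupoidStr Γ M) :
    Prop where
  src_submersion : Manifold.IsSubmersion SΓ.I SM.I ∞ 𝒢.src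
  tgt_submersion : Manifold.IsSubmersion SΓ.I SM.I ∞ 𝒢.tgt
  one_smooth : ContMDiff SM.I SΓ.I ∞ 𝒢.one
  inv_smooth : ContMDiff SΓ.I SΓ.I ∞ 𝒢.inv
  mul_smooth : ∃ m : Γ × Γ → Γ, (∀ a b h, m (a, b) = 𝒢.mul a b h) ∧
    ContMDiffOn (SΓ.I.prod SΓ.I) SΓ.I ∞ m {x | 𝒢.src x.1 = 𝒢.tgt x.2}

/-- A morphism `(Φ, φ)` of Lie groupoids. -/
structure IsLieGroupoidHom (SΓ : ManifoldStr Γ) (SM : ManifoldStr M) (𝒢 : GroupoidStr Γ M)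
    (SΓ₂ : ManifoldStr Γ₂) (SM₂ : ManifoldStr M₂) (𝒢₂ : GroupoidStr Γ₂ M₂)
    (Φ : Γ → Γ₂) (φ : M → M₂) : Prop where
  smooth : ContMDiff SΓ.I SΓ₂.I ∞ Φ
  smooth_base : ContMDiff SM.I SM₂.I ∞ φ
  src_map : ∀ a, 𝒢₂.src (Φ a) = φ (𝒢.src a)
  tgt_map : ∀ a, 𝒢₂.tgt (Φ a) = φ (𝒢.tgt a)
  mul_map : ∀ a b (h : 𝒢.src a = 𝒢.tgt b),
    Φ (𝒢.mul a b h) =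
      𝒢₂.mul (Φ a) (Φ b) ((src_map a).trans ((congrArg φ h).trans (tgt_map b).symm))

/-- `Φ : Γ → Γ` is an isomorphism of the Lie groupoid `𝒢` onto itself. -/
def IsLieGroupoidAut (SΓ : ManifoldStr Γ) (SM : ManifoldStr M) (𝒢 : GroupoidStr Γ M)
    (Φ : Γ → Γ) : Prop :=
  ∃ (φ : M → M) (Ψ : Γ → Γ) (ψ : M → M),
    IsLieGroupoidHom SΓ SM 𝒢 SΓ SM 𝒢 Φ φ ∧ IsLieGroupoidHom SΓ SM 𝒢 SΓ SM 𝒢 Ψ ψ ∧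
    Function.LeftInverse Ψ Φ ∧ Function.RightInverse Ψ Φ ∧
    Function.LeftInverse ψ φ ∧ Function.RightInverse ψ φ

/-- An action of a Lie group on a Lie groupoid is compatible with the groupoid structure if it is
smooth and each group element acts by a Lie groupoid isomorphism. -/
def IsCompatibleAction {G : Type*} [Group G] [TopologicalSpace G] (SG : ManifoldStr G)
    (SΓ : ManifoldStr Γ) (SM : ManifoldStr M) (𝒢 : GroupoidStr Γ M) (σ : RightAction G Γ) : Prop :=
  σ.IsSmooth SΓ SG ∧ ∀ g, IsLieGroupoidAut SΓ SM 𝒢 fun a => σ.act a g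

end LieGroupoid

/-! ### The gauge groupoid of a free action -/

namespace RightAction

variable {G P : Type*} [Group G] (ρ : RightAction G P)

/-- The orbit `⟨p, q⟩` of `(p, q)` under the diagonal action. -/
def pair (p q : P) : ρ.diag.Orbits := ρ.diag.proj (p, q)

theorem pair_eq_iff {p q p' q' : P} :
    ρ.pair p q = ρ.pair p' q' ↔ ∃ g, ρ.act p g = p' ∧ ρ.act q g = q' := by
  unfold pair
  rw [proj_eq_iff]
  simp [diag]

theorem exists_pair (a : ρ.diag.Orbits) : ∃ p q, ρ.pair p q = a := by
  induction a using Quotient.inductionOn with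
  | h x => exact ⟨x.1, x.2, rfl⟩

/-- `⟨p, q⟩ ↦ π(q)`. -/
def gaugeSrc (a : ρ.diag.Orbits) : ρ.Orbits :=
  Quotient.liftOn a (fun x => ρ.proj x.2) fun _ _ h =>
    ρ.proj_eq_iff.2 (h.imp fun _ hg => congrArg Prod.snd hg)

/-- `⟨p, q⟩ ↦ π(p)`. -/
def gaugeTgt (a : ρ.diag.Orbits) : ρ.Orbits :=
  Quotient.liftOn a (fun x => ρ.proj x.1) fun _ _ h =>
    ρ.proj_eq_iff.2 (h.imp fun _ hg => congrArg Prod.fst hg)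

/-- `π(p) ↦ ⟨p, p⟩`. -/
def gaugeOne (x : ρ.Orbits) : ρ.diag.Orbits :=
  Quotient.liftOn x (fun p => ρ.pair p p) fun _ _ h =>
    ρ.pair_eq_iff.2 (h.imp fun _ hg => ⟨hg, hg⟩)

/-- `⟨p, q⟩ ↦ ⟨q, p⟩`. -/
def gaugeInv (a : ρ.diag.Orbits) : ρ.diag.Orbits :=
  Quotient.liftOn a (fun x => ρ.pair x.2 x.1) fun _ _ h =>
    ρ.pair_eq_iff.2 (h.imp fun _ hg => ⟨congrArg Prod.snd hg, congrArg Prod.fst hg⟩)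

@[simp] theorem gaugeSrc_pair (p q : P) : ρ.gaugeSrc (ρ.pair p q) = ρ.proj q := rfl
@[simp] theorem gaugeTgt_pair (p q : P) : ρ.gaugeTgt (ρ.pair p q) = ρ.proj p := rfl
@[simp] theorem gaugeOne_proj (p : P) : ρ.gaugeOne (ρ.proj p) = ρ.pair p p := rfl
@[simp] theorem gaugeInv_pair (p q : P) : ρ.gaugeInv (ρ.pair p q) = ρ.pair q p := rfl

theorem exists_gaugeMul (a b : ρ.diag.Orbits) (h : ρ.gaugeSrc a = ρ.gaugeTgt b) :
    ∃ c, ∃ p q r, ρ.pair p q = a ∧ ρ.pair q r = b ∧ ρ.pair p r = c := by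
  obtain ⟨p, q, rfl⟩ := ρ.exists_pair a
  obtain ⟨q', r, rfl⟩ := ρ.exists_pair b
  obtain ⟨g, hg⟩ := ρ.proj_eq_iff.1 h
  exact ⟨_, ρ.act p g, q', r, (ρ.pair_eq_iff.2 ⟨g, rfl, hg⟩).symm, rfl, rfl⟩

/-- The partial multiplication `⟨p, q⟩ • ⟨q, r⟩ = ⟨p, r⟩`. -/
noncomputable def gaugeMul (a b : ρ.diag.Orbits) (h : ρ.gaugeSrc a = ρ.gaugeTgt b) :
    ρ.diag.Orbits :=
  (ρ.exists_gaugeMul a b h).choose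

variable {ρ}

theorem gaugeMul_pair (hρ : ρ.IsFree) (p q r : P)
    (h : ρ.gaugeSrc (ρ.pair p q) = ρ.gaugeTgt (ρ.pair q r)) :
    ρ.gaugeMul (ρ.pair p q) (ρ.pair q r) h = ρ.pair p r := by
  obtain ⟨p', q', r', h1, h2, h3⟩ := (ρ.exists_gaugeMul _ _ h).choose_spec
  unfold gaugeMul
  rw [← h3]
  obtain ⟨g, hp, hq⟩ := ρ.pair_eq_iff.1 h1
  obtain ⟨k, hq', hr⟩ := ρ.pair_eq_iff.1 h2
  have hk : g * k⁻¹ = 1 := hρ q' _ (by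
    rw [ρ.act_mul, hq, ← hq', ← ρ.act_mul, mul_inv_cancel, ρ.act_one])
  obtain rfl : g = k := mul_inv_eq_one.1 hk
  exact ρ.pair_eq_iff.2 ⟨g, hp, hr⟩

theorem exists_pair_pair (a b : ρ.diag.Orbits) (h : ρ.gaugeSrc a = ρ.gaugeTgt b) :
    ∃ p q r, ρ.pair p q = a ∧ ρ.pair q r = b := by
  obtain ⟨_, p, q, r, h1, h2, _⟩ := ρ.exists_gaugeMul a b h
  exact ⟨p, q, r, h1, h2⟩

/-- The gauge groupoid `(P × P)/G` over `P/G` of a free action. -/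
noncomputable def gaugeGroupoid (ρ : RightAction G P) (hρ : ρ.IsFree) :
    GroupoidStr ρ.diag.Orbits ρ.Orbits where
  src := ρ.gaugeSrc
  tgt := ρ.gaugeTgt
  one := ρ.gaugeOne
  inv := ρ.gaugeInv
  mul := ρ.gaugeMul
  src_one x := by induction x using Quotient.inductionOn; rfl
  tgt_one x := by induction x using Quotient.inductionOn; rfl
  src_inv a := by obtain ⟨p, q, rfl⟩ := ρ.exists_pair a; rfl
  tgt_inv a := by obtain ⟨p, q, rfl⟩ := ρ.exists_pair a; rfl
  src_mul a b h := by
    obtain ⟨p, q, r, rfl, rfl⟩ := exists_pair_pair a b h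
    rw [gaugeMul_pair hρ]; rfl
  tgt_mul a b h := by
    obtain ⟨p, q, r, rfl, rfl⟩ := exists_pair_pair a b h
    rw [gaugeMul_pair hρ]; rfl
  mul_assoc a b c hab hbc := by
    obtain ⟨p, q, r, rfl, rfl⟩ := exists_pair_pair a b hab
    obtain ⟨r', s, rfl⟩ := ρ.exists_pair c
    obtain ⟨g, hg⟩ := ρ.proj_eq_iff.1 hbc
    obtain rfl : ρ.act r g = r' := hg
    have hc : ρ.pair (ρ.act r g) s = ρ.pair r (ρ.act s g⁻¹) :=
      (ρ.pair_eq_iff.2 ⟨g, rfl, by rw [← ρ.act_mul, inv_mul_cancel, ρ.act_one]⟩).symm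
    simp only [hc, gaugeMul_pair hρ]
  mul_one a := by
    obtain ⟨p, q, rfl⟩ := ρ.exists_pair a
    exact gaugeMul_pair hρ p q q rfl
  one_mul a := by
    obtain ⟨p, q, rfl⟩ := ρ.exists_pair a
    exact gaugeMul_pair hρ p p q rfl
  mul_inv a := by
    obtain ⟨p, q, rfl⟩ := ρ.exists_pair a
    exact gaugeMul_pair hρ p q p rfl
  inv_mul a := by
    obtain ⟨p, q, rfl⟩ := ρ.exists_pair a
    exact gaugeMul_pair hρ q p q rfl

end RightAction

/-! ### Double principal bundles and double principal groups -/

section DoublePrincipal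

variable {G G' P : Type*} [Group G] [Group G']

/-- `σ` is the action `⟨p, q⟩ g' = ⟨p g', q g'⟩` of `G'` on the gauge groupoid `(P × P)/G`
of `ρ` which is induced by the action `ρ'` of `G'` on `P`. -/
def IsInducedOnGauge (ρ : RightAction G P) (ρ' : RightAction G' P)
    (σ : RightAction G' ρ.diag.Orbits) : Prop :=
  ∀ p q g', σ.act (ρ.pair p q) g' = ρ.pair (ρ'.act p g') (ρ'.act q g')

variable [TopologicalSpace G] [TopologicalSpace G'] [TopologicalSpace P]

/-- The action `ρ'` is `(P, G)`-principal, where `G` acts on `P` by `ρ`: it induces a compatible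
pre-principal action on the gauge groupoid `(P × P)/G` of `ρ`. The latter is a Lie groupoid with
the manifold structures on `P/G` and `(P × P)/G` for which the canonical projections from
`P` and `P × P` are submersions. -/
def IsRelPrincipal (SP : ManifoldStr P) (SG' : ManifoldStr G')
    (ρ : RightAction G P) (hρ : ρ.IsFree) (ρ' : RightAction G' P) : Prop :=
  ∃ (SM : ManifoldStr ρ.Orbits) (SΓ : ManifoldStr ρ.diag.Orbits),
    Manifold.IsSubmersion SP.I SM.I ∞ ρ.proj ∧
    Manifold.IsSubmersion (SP.I.prod SP.I) SΓ.I ∞ ρ.diag.proj ∧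
    IsLieGroupoid SΓ SM (ρ.gaugeGroupoid hρ) ∧
    ∃ σ : RightAction G' ρ.diag.Orbits, IsInducedOnGauge ρ ρ' σ ∧
      IsCompatibleAction SG' SΓ SM (ρ.gaugeGroupoid hρ) σ ∧ σ.IsPrePrincipal SΓ SG'

/-- A double principal bundle: a manifold with two compatible principal actions. -/
structure IsDoublePrincipalBundle (SP : ManifoldStr P) (SG : ManifoldStr G) (SG' : ManifoldStr G')
    (ρ : RightAction G P) (ρ' : RightAction G' P) : Prop where
  principal : ρ.IsPrincipal SP SG
  principal' : ρ'.IsPrincipal SP SG'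
  relPrincipal' : IsRelPrincipal SP SG' ρ principal.free ρ'
  relPrincipal : IsRelPrincipal SP SG ρ' principal'.free ρ

/-- A double principal group: a Lie group with two closed normal subgroups whose union
generates it. -/
structure IsDoublePrincipalGroup (SG : ManifoldStr G) (G₁ G₂ : Subgroup G) : Prop where
  lieGroup : LieGroup SG.I ∞ G
  isClosed₁ : IsClosed (G₁ : Set G)
  isClosed₂ : IsClosed (G₂ : Set G)
  normal₁ : G₁.Normal
  normal₂ : G₂.Normal
  generates : Subgroup.closure ((G₁ : Set G) ∪ (G₂ : Set G)) = ⊤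

end DoublePrincipal

/-! Let `N` be one of the two subgroups and `H` the other. Normality of `N` makes the action of `H`
descend to `P/N` and to `(P × P)/N`. It is smooth there because smoothness descends along surjective
submersions, and it respects the groupoid structure because it is diagonal.

If `k ∈ H` fixes a single arrow `⟨p, q⟩`, then `p k g = p` for some `g ∈ N`, so `k = g⁻¹ ∈ N` by
freeness of the whole action. Conversely, elements of `N ∩ H` fix every arrow. Hence all stabilizers
coincide with `N ∩ H`, which is the kernel if there is an arrow at all, and the quotient by the
kernel acts freely.

For properness, lift a compact set of arrows to a compact `C' ⊆ P × P`. If `k` returns an arrow of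
the set to the set, some `k g` with `g ∈ N` carries a point of `C'` into `C'`, so `k g` lies in a
compact `L` of the big group. Since `N H` is everything, `H → Ĝ/N` is a surjective homomorphism from
a σ-compact group to a Baire group, hence open. So `L ⊆ D N` with `D ⊆ H` compact
(`exists_isCompact_cover_of_sup_eq_top`), and the class of `k` lies in the image of `D`
(`isProper_quotientKer`).

This rests on three classical theorems. The closed subgroup theorem
(`exists_isSmoothEmbedding_subgroup`) shows that a closed local subgroup is a smooth graph over its
space of tangent directions. The quotient theorem for principal actions
(`IsPrincipal.exists_isSubmersion`) takes its charts from slices transverse to the orbits. Quotients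
by closed normal subgroups are Lie groups (`exists_lieGroup_quotient`), as an instance of the
quotient theorem. -/

open Set Filter Topology

/-! ### The inverse function theorem for smooth maps -/

section InverseFunction

variable {E E' : Type*} [NormedAddCommGroup E] [NormedSpace ℝ E] [NormedAddCommGroup E']
  [NormedSpace ℝ E'] [CompleteSpace E]

/-- A smooth map with invertible derivative at `x` is a local diffeomorphism at `x`. -/
theorem ContDiffOn.exists_openPartialHomeomorph {f : E → E'} {U : Set E} (hU : IsOpen U)
    (hf : ContDiffOn ℝ ∞ f U) {x : E} (hx : x ∈ U) (f' : E ≃L[ℝ] E')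
    (hf' : HasFDerivAt f (f' : E →L[ℝ] E') x) :
    ∃ e : OpenPartialHomeomorph E E', x ∈ e.source ∧ e.source ⊆ U ∧ (∀ y, e y = f y) ∧
      ContDiffOn ℝ ∞ e.symm e.target := by
  have hfx : ContDiffAt ℝ ∞ f x := hf.contDiffAt (hU.mem_nhds hx)
  set e₀ := hfx.toOpenPartialHomeomorph f hf' (by simp) with he₀
  -- Invertible operators form an open set, so the derivative is still invertible on a neighbourhood
  -- of `x`. Restricting to it makes the inverse smooth on the whole target and not only at the
  -- image of `x`.
  set V : Set E := U ∩ fderiv ℝ f ⁻¹' range ((↑) : (E ≃L[ℝ] E') → E →L[ℝ] E') with hV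
  have hVo : IsOpen V :=
    (hf.continuousOn_fderiv_of_isOpen hU (by simp)).isOpen_inter_preimage hU
      ContinuousLinearEquiv.isOpen
  refine ⟨e₀.restrOpen V hVo, ?_, ?_, fun y => rfl, ?_⟩
  · exact ⟨hfx.mem_toOpenPartialHomeomorph_source hf' (by simp), hx, f', hf'.fderiv.symm⟩
  · exact fun y hy => hy.2.1
  · intro y hy
    have hys := (e₀.restrOpen V hVo).map_target hy
    obtain ⟨-, hyU, g, hg⟩ := hys
    have hd := hf.contDiffAt (hU.mem_nhds hyU)
    refine ContDiffAt.contDiffWithinAt ?_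
    refine (e₀.restrOpen V hVo).contDiffAt_symm (f₀' := g) hy ?_ hd
    rw [hg]
    exact (hd.differentiableAt (by simp)).hasFDerivAt

end InverseFunction

/-! ### Submersions -/

section Submersion

open Manifold

/-- A submersion has smooth local sections. -/
theorem Manifold.IsSubmersionAt.exists_section {E E' H H' M N : Type*}
    [NormedAddCommGroup E] [NormedSpace ℝ E] [NormedAddCommGroup E'] [NormedSpace ℝ E']
    [TopologicalSpace H] [TopologicalSpace H'] [TopologicalSpace M] [TopologicalSpace N]
    [ChartedSpace H M] [ChartedSpace H' N] {I : ModelWithCorners ℝ E H}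
    {J : ModelWithCorners ℝ E' H'} [I.Boundaryless] [J.Boundaryless]
    {n : ℕ∞ω} {f : M → N} {x : M} (hf : IsSubmersionAt I J n f x) :
    ∃ s : N → M, ContMDiffAt J I n s (f x) ∧ s (f x) = x ∧ ∀ᶠ y in 𝓝 (f x), f (s y) = y := by
  set φ := hf.domChart.extend I with hφ
  set ψ := hf.codChart.extend J with hψ
  have hx : x ∈ φ.source := by
    rw [hφ, OpenPartialHomeomorph.extend_source]; exact hf.mem_domChart_source
  have hfx : f x ∈ ψ.source := by
    rw [hψ, OpenPartialHomeomorph.extend_source]; exact hf.mem_codChart_source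
  have hφo : IsOpen φ.target := hf.domChart.isOpen_extend_target
  -- In the adapted charts `f` is a projection; the section keeps the complementary coordinate of
  -- `x` fixed.
  set j : E' → E := fun u => hf.equiv.symm (u, (hf.equiv (φ x)).2) with hj
  have hjx : j (ψ (f x)) = φ x := by
    have h := hf.writtenInCharts (φ.map_source hx)
    simp only [Function.comp_apply] at h
    rw [← hφ, ← hψ, φ.left_inv hx] at h
    rw [hj]
    simp [h]
  have hjs : ContDiff ℝ n j := by fun_prop
  have hψc : ContMDiffAt J 𝓘(ℝ, E') n ψ (f x) :=
    (OpenPartialHomeomorph.contMDiffAt_extend hf.codChart_mem_maximalAtlas hf.mem_codChart_source)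
  have hjψ : ContMDiffAt J 𝓘(ℝ, E) n (fun y => j (ψ y)) (f x) :=
    hjs.contMDiff.contMDiffAt.comp (f x) hψc
  have hmem : ∀ᶠ y in 𝓝 (f x), j (ψ y) ∈ φ.target :=
    hjψ.continuousAt.preimage_mem_nhds (hφo.mem_nhds (by
      rw [hjx]; exact φ.map_source hx))
  refine ⟨fun y => φ.symm (j (ψ y)), ?_, ?_, ?_⟩
  · have h1 : ContMDiffAt 𝓘(ℝ, E) I n φ.symm (j (ψ (f x))) :=
      (contMDiffOn_extend_symm hf.domChart_mem_maximalAtlas).contMDiffAt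
        (by
          have : I '' hf.domChart.target = φ.target := by
            rw [hφ, OpenPartialHomeomorph.extend_target']
          rw [this, hjx]
          exact hφo.mem_nhds (φ.map_source hx))
    exact h1.comp (f x) hjψ
  · simp only [hjx, φ.left_inv hx]
  · have h2 : ∀ᶠ y in 𝓝 (f x), y ∈ ψ.source := by
      rw [hψ, OpenPartialHomeomorph.extend_source]
      exact hf.codChart.open_source.mem_nhds hf.mem_codChart_source
    filter_upwards [hmem, h2] with y hy hy2
    have h3 := hf.writtenInCharts hy
    simp only [Function.comp_apply] at h3
    have h4 : f (φ.symm (j (ψ y))) ∈ ψ.source := by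
      rw [hψ, OpenPartialHomeomorph.extend_source]
      apply hf.source_subset_preimage_source
      have := φ.map_target hy
      rwa [hφ, OpenPartialHomeomorph.extend_source] at this
    refine ψ.injOn h4 hy2 ?_
    rw [← hφ, ← hψ] at h3
    rw [h3, hj]
    simp

/-- Smoothness descends along surjective submersions. -/
theorem Manifold.IsSubmersion.contMDiff_of_comp {E E' E₃ H H' H₃ M N X : Type*}
    [NormedAddCommGroup E] [NormedSpace ℝ E] [NormedAddCommGroup E'] [NormedSpace ℝ E']
    [NormedAddCommGroup E₃] [NormedSpace ℝ E₃] [TopologicalSpace H₃]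
    [TopologicalSpace X] [ChartedSpace H₃ X]
    [TopologicalSpace H] [TopologicalSpace H'] [TopologicalSpace M] [TopologicalSpace N]
    [ChartedSpace H M] [ChartedSpace H' N] {I : ModelWithCorners ℝ E H}
    {J : ModelWithCorners ℝ E' H'} {K : ModelWithCorners ℝ E₃ H₃} [I.Boundaryless] [J.Boundaryless]
    {n : ℕ∞ω} {π : M → N} (hπ : IsSubmersion I J n π) (hs : Function.Surjective π)
    {f : N → X} (hf : ContMDiff I K n fun x => f (π x)) : ContMDiff J K n f := by
  intro y
  obtain ⟨x, rfl⟩ := hs y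
  obtain ⟨s, hs, hsx, hev⟩ := (hπ.isSubmersionAt x).exists_section
  have h1 : ContMDiffAt J K n (fun y => f (π (s y))) (π x) := (hf (s (π x))).comp (π x) hs
  exact h1.congr_of_eventuallyEq (hev.mono fun y hy => by simp only [hy])

/-- A surjective linear map is the first component of a linear isomorphism onto a product. -/
theorem ContinuousLinearMap.exists_equiv_prod_of_surjective {E E' F : Type*}
    [NormedAddCommGroup E] [NormedSpace ℝ E] [FiniteDimensional ℝ E] [NormedAddCommGroup E']
    [NormedSpace ℝ E'] [FiniteDimensional ℝ E'] [NormedAddCommGroup F] [NormedSpace ℝ F]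
    [FiniteDimensional ℝ F] (D : E →L[ℝ] E') (hD : Function.Surjective D)
    (hF : Module.finrank ℝ E' + Module.finrank ℝ F = Module.finrank ℝ E) :
    ∃ e : E ≃L[ℝ] E' × F, ∀ v, (e v).1 = D v := by
  have hr := LinearMap.finrank_range_add_finrank_ker (D : E →ₗ[ℝ] E')
  rw [LinearMap.range_eq_top.2 hD, finrank_top] at hr
  have hk : Module.finrank ℝ (LinearMap.ker (D : E →ₗ[ℝ] E')) = Module.finrank ℝ F := by omega
  obtain ⟨ι⟩ := FiniteDimensional.nonempty_linearEquiv_of_finrank_eq hk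
  obtain ⟨p, hp⟩ := LinearMap.exists_leftInverse_of_injective
    (LinearMap.ker (D : E →ₗ[ℝ] E')).subtype (Submodule.ker_subtype _)
  let L : E →ₗ[ℝ] E' × F := (D : E →ₗ[ℝ] E').prod (ι.toLinearMap ∘ₗ p)
  have hL : Function.Injective L := by
    rw [← LinearMap.ker_eq_bot, LinearMap.ker_eq_bot']
    intro v hv
    have h1 : D v = 0 := congrArg Prod.fst hv
    have h2 : ι (p v) = 0 := congrArg Prod.snd hv
    have h3 : p v = 0 := by simpa using h2
    have h4 := LinearMap.congr_fun hp ⟨v, h1⟩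
    simp only [LinearMap.comp_apply, Submodule.subtype_apply, LinearMap.id_apply] at h4
    rw [h3] at h4
    exact (congrArg Subtype.val h4).symm
  have hdim : Module.finrank ℝ E = Module.finrank ℝ (E' × F) := by
    rw [Module.finrank_prod, hF]
  refine ⟨(L.linearEquivOfInjective hL hdim).toContinuousLinearEquiv, fun v => rfl⟩

/-- A smooth map with surjective differentials between finite-dimensional manifolds is a
submersion. -/
theorem isSubmersion_of_surjective_mfderiv {E E' : Type} {M N : Type*}
    [NormedAddCommGroup E] [NormedSpace ℝ E] [FiniteDimensional ℝ E] [NormedAddCommGroup E']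
    [NormedSpace ℝ E'] [FiniteDimensional ℝ E'] [TopologicalSpace M] [TopologicalSpace N]
    [ChartedSpace E M] [ChartedSpace E' N] [IsManifold 𝓘(ℝ, E) ∞ M] [IsManifold 𝓘(ℝ, E') ∞ N]
    {f : M → N} (hf : ContMDiff 𝓘(ℝ, E) 𝓘(ℝ, E') ∞ f)
    (hsurj : ∀ x, Function.Surjective (mfderiv 𝓘(ℝ, E) 𝓘(ℝ, E') f x)) :
    IsSubmersion 𝓘(ℝ, E) 𝓘(ℝ, E') ∞ f := by
  have hc : CompleteSpace E := FiniteDimensional.complete ℝ E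
  -- One complement has to serve all points. The truncated subtraction is harmless, as a surjective
  -- differential forces `dim E' ≤ dim E`.
  let F := Fin (Module.finrank ℝ E - Module.finrank ℝ E') → ℝ
  refine ⟨F, inferInstance, inferInstance, fun x => ?_⟩
  set ψ := chartAt E x with hψ
  set φ := chartAt E' (f x) with hφ
  have hψx : x ∈ ψ.source := mem_chart_source E x
  have hφx : f x ∈ φ.source := mem_chart_source E' (f x)
  set f₁ : E → E' := fun z => φ (f (ψ.symm z)) with hf₁
  have hcont := hf.continuous
  set U : Set E := ψ.target ∩ ψ.symm ⁻¹' (f ⁻¹' φ.source) with hU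
  have hUo : IsOpen U := ψ.isOpen_inter_preimage_symm (φ.open_source.preimage hcont)
  have hxU : ψ x ∈ U := ⟨ψ.map_source hψx, by simpa [ψ.left_inv hψx] using hφx⟩
  have hf₁s : ContDiffOn ℝ ∞ f₁ U := by
    rw [← contMDiffOn_iff_contDiffOn]
    exact (contMDiffOn_of_mem_maximalAtlas (IsManifold.chart_mem_maximalAtlas (f x))).comp
      (hf.comp_contMDiffOn ((contMDiffOn_symm_of_mem_maximalAtlas
        (IsManifold.chart_mem_maximalAtlas x)).mono inter_subset_left)) (fun z hz => hz.2)
  have hd : HasFDerivAt f₁ (fderiv ℝ f₁ (ψ x)) (ψ x) :=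
    ((hf₁s.contDiffAt (hUo.mem_nhds hxU)).differentiableAt (by simp)).hasFDerivAt
  set D := fderiv ℝ f₁ (ψ x) with hDdef
  have hD : Function.Surjective D := by
    have h := hsurj x
    rw [((hf x).mdifferentiableAt (by simp)).mfderiv] at h
    simp only [mfld_simps, fderivWithin_univ] at h
    exact h
  have hdim : Module.finrank ℝ E' + Module.finrank ℝ F = Module.finrank ℝ E := by
    have : Module.finrank ℝ E' ≤ Module.finrank ℝ E :=
      LinearMap.finrank_le_finrank_of_surjective (f := (D : E →ₗ[ℝ] E')) hD
    simp only [F, Module.finrank_fin_fun]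
    omega
  obtain ⟨e, he⟩ := D.exists_equiv_prod_of_surjective hD hdim
  -- `Ψ` replaces the first component of `e z` by `f₁ z`. Its derivative at `ψ x` is the identity
  -- because `(e v).1 = D v`, and in the chart corrected by `Ψ` the map becomes the projection.
  set Ψ : E → E := fun z => e.symm (f₁ z, (e z).2) with hΨ
  have hΨs : ContDiffOn ℝ ∞ Ψ U :=
    e.symm.contDiff.comp_contDiffOn (hf₁s.prodMk (e.contDiff.snd.contDiffOn))
  have hΨd : HasFDerivAt Ψ ((ContinuousLinearEquiv.refl ℝ E : E ≃L[ℝ] E) : E →L[ℝ] E) (ψ x) := by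
    have h1 : HasFDerivAt (fun z => (f₁ z, (e z).2))
        (D.prod ((ContinuousLinearMap.snd ℝ E' F).comp (e : E →L[ℝ] E' × F))) (ψ x) :=
      hd.prodMk ((ContinuousLinearMap.snd ℝ E' F).comp (e : E →L[ℝ] E' × F)).hasFDerivAt
    have h2 := e.symm.hasFDerivAt.comp (ψ x) h1
    have h3 : ((ContinuousLinearEquiv.refl ℝ E : E ≃L[ℝ] E) : E →L[ℝ] E) =
        (e.symm : E' × F →L[ℝ] E).comp
          (D.prod ((ContinuousLinearMap.snd ℝ E' F).comp (e : E →L[ℝ] E' × F))) := by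
      ext v
      have : (D v, (e v).2) = e v := Prod.ext (he v).symm rfl
      simp [this]
    rw [h3]
    exact h2
  obtain ⟨ε, hεx, hεU, hεf, hεs⟩ := hΨs.exists_openPartialHomeomorph hUo hxU _ hΨd
  have hψε : ψ.trans ε ∈ IsManifold.maximalAtlas 𝓘(ℝ, E) ∞ M := by
    refine OpenPartialHomeomorph.mem_maximalAtlas_of_contMDiffOn _ ?_ ?_
    · have h1 : ContMDiffOn 𝓘(ℝ, E) 𝓘(ℝ, E) ∞ ε ε.source := by
        rw [contMDiffOn_iff_contDiffOn]
        exact (hΨs.mono hεU).congr fun y _ => hεf y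
      rw [ψ.trans_source]
      exact h1.comp ((contMDiffOn_of_mem_maximalAtlas
        (IsManifold.chart_mem_maximalAtlas x)).mono inter_subset_left) fun y hy => hy.2
    · have h1 : ContMDiffOn 𝓘(ℝ, E) 𝓘(ℝ, E) ∞ ε.symm ε.target := by
        rwa [contMDiffOn_iff_contDiffOn]
      rw [ψ.trans_target]
      exact (contMDiffOn_symm_of_mem_maximalAtlas (IsManifold.chart_mem_maximalAtlas x)).comp
        (h1.mono inter_subset_left) fun y hy => hy.2
  refine IsSubmersionAtOfComplement.mk_of_continuousAt hcont.continuousAt e (ψ.trans ε) φ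
    ?_ hφx hψε (IsManifold.chart_mem_maximalAtlas _) ?_
  · rw [ψ.trans_source]; exact ⟨hψx, hεx⟩
  · intro z hz
    have hz' : z ∈ ε.target := by
      simp only [mfld_simps] at hz
      exact hz.1
    have h3 : f₁ (ε.symm z) = (e (Ψ (ε.symm z))).1 := by simp [hΨ]
    rw [← hεf, ε.right_inv hz'] at h3
    simpa [hf₁] using h3

/-- A smooth map admitting smooth local sections through every point is a submersion. -/
theorem isSubmersion_of_sections {E E' : Type} {M N : Type*}
    [NormedAddCommGroup E] [NormedSpace ℝ E] [FiniteDimensional ℝ E] [NormedAddCommGroup E']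
    [NormedSpace ℝ E'] [FiniteDimensional ℝ E'] [TopologicalSpace M] [TopologicalSpace N]
    [ChartedSpace E M] [ChartedSpace E' N] [IsManifold 𝓘(ℝ, E) ∞ M] [IsManifold 𝓘(ℝ, E') ∞ N]
    {f : M → N} (hf : ContMDiff 𝓘(ℝ, E) 𝓘(ℝ, E') ∞ f)
    (hsec : ∀ x, ∃ s : N → M, ContMDiffAt 𝓘(ℝ, E') 𝓘(ℝ, E) ∞ s (f x) ∧ s (f x) = x ∧
      ∀ᶠ y in 𝓝 (f x), f (s y) = y) :
    IsSubmersion 𝓘(ℝ, E) 𝓘(ℝ, E') ∞ f := by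
  refine isSubmersion_of_surjective_mfderiv hf fun x => ?_
  obtain ⟨s, hs, hsx, hev⟩ := hsec x
  -- By the chain rule for `f ∘ s = id`, the differential of `s` is a right inverse of that of `f`.
  have h1 : HasMFDerivAt 𝓘(ℝ, E') 𝓘(ℝ, E') (f ∘ s) (f x)
      ((mfderiv 𝓘(ℝ, E) 𝓘(ℝ, E') f (s (f x))).comp (mfderiv 𝓘(ℝ, E') 𝓘(ℝ, E) s (f x))) :=
    HasMFDerivAt.comp _ ((hf _).mdifferentiableAt (by simp)).hasMFDerivAt
      (hs.mdifferentiableAt (by simp)).hasMFDerivAt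
  have h2 := (hasMFDerivAt_id (I := 𝓘(ℝ, E')) (f x)).congr_of_eventuallyEq
    (f₁ := f ∘ s) hev
  have h3 := hasMFDerivAt_unique h1 h2
  rw [hsx] at h3
  intro v
  exact ⟨mfderiv 𝓘(ℝ, E') 𝓘(ℝ, E) s (f x) v, DFunLike.congr_fun h3 v⟩

end Submersion

/-! ### Constructions of manifold structures -/

namespace ManifoldStr

/-- The manifold structure defined by a family of charts with smooth transition maps. -/
noncomputable def ofCharts {X : Type*} [TopologicalSpace X] (F : Type) [NormedAddCommGroup F]
    [NormedSpace ℝ F] [FiniteDimensional ℝ F] (e : X → OpenPartialHomeomorph X F)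
    (he : ∀ x, x ∈ (e x).source)
    (hs : ∀ x y, ContDiffOn ℝ ∞ (fun z => e y ((e x).symm z))
      ((e x).target ∩ (e x).symm ⁻¹' (e y).source))
    (h2 : T2Space X) (hc : SecondCountableTopology X) : ManifoldStr X :=
  letI : ChartedSpace F X :=
    { atlas := range e
      chartAt := e
      mem_chart_source := he
      chart_mem_atlas := mem_range_self }
  { E := F
    isManifold := isManifold_of_contDiffOn _ _ _ (by
      rintro _ _ ⟨x, rfl⟩ ⟨y, rfl⟩
      simp only [mfld_simps]
      exact hs x y)
    t2Space := h2
    secondCountable := hc }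

/-- The product of two manifold structures. -/
noncomputable def prod {X Y : Type*} [TopologicalSpace X] [TopologicalSpace Y] (S : ManifoldStr X)
    (T : ManifoldStr Y) : ManifoldStr (X × Y) where
  E := S.E × T.E
  chartedSpace := inferInstanceAs (ChartedSpace (ModelProd S.E T.E) (X × Y))
  isManifold := by
    rw [modelWithCornersSelf_prod]
    exact IsManifold.prod X Y
  t2Space := by
    have := S.t2Space
    have := T.t2Space
    infer_instance
  secondCountable := by
    have := S.secondCountable
    have := T.secondCountable
    infer_instance

theorem prod_I {X Y : Type*} [TopologicalSpace X] [TopologicalSpace Y] (S : ManifoldStr X)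
    (T : ManifoldStr Y) : (S.prod T).I = S.I.prod T.I :=
  modelWithCornersSelf_prod

theorem locallyCompactSpace {X : Type*} [TopologicalSpace X] (S : ManifoldStr X) :
    LocallyCompactSpace X :=
  ChartedSpace.locallyCompactSpace S.E X

end ManifoldStr

/-! ### Closed subgroups of local Lie groups -/

section LocalSubgroup

open Metric

variable {E : Type*} [NormedAddCommGroup E] [NormedSpace ℝ E]

/-- `S` is a closed subgroup of a local Lie group on the ball of radius `r` in `E`, with neutral
element `0`, multiplication `m` and left division `d x y = x⁻¹ y`. -/
structure IsLocalSubgroup (m d : E → E → E) (r : ℝ) (S : Set E) : Prop where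
  pos : 0 < r
  smooth : ContDiffOn ℝ ∞ (fun z : E × E => m z.1 z.2) (ball 0 r ×ˢ ball 0 r)
  mul_zero : ∀ x ∈ ball (0 : E) r, m x 0 = x
  zero_mul : ∀ x ∈ ball (0 : E) r, m 0 x = x
  mul_div : ∀ x ∈ ball (0 : E) r, ∀ y ∈ ball (0 : E) r, m x (d x y) = y
  tendsto_div : Tendsto (fun z : E × E => d z.1 z.2) (𝓝 (0, 0)) (𝓝 0)
  zero_mem : (0 : E) ∈ S
  mul_mem : ∀ x ∈ S ∩ ball (0 : E) r, ∀ y ∈ S ∩ ball (0 : E) r, m x y ∈ S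
  div_mem : ∀ x ∈ S ∩ ball (0 : E) r, ∀ y ∈ S ∩ ball (0 : E) r, d x y ∈ S
  closed : ∀ x ∈ ball (0 : E) r, x ∈ closure S → x ∈ S

/-- The vectors `v` tangent to the set `S` at `0`: up to a negligible error, `δ • v` belongs
to `S` for all small `δ > 0`. -/
def TangentAtZero (S : Set E) (v : E) : Prop :=
  ∀ ε > 0, ∀ᶠ δ in 𝓝[>] (0 : ℝ), ∃ s ∈ S, ‖s - δ • v‖ ≤ ε * δ

namespace IsLocalSubgroup

variable {m d : E → E → E} {r : ℝ} {S : Set E}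

/-- On each axis the multiplication is the identity, which determines both partial derivatives.
Strict differentiability is what makes the later estimates uniform in both arguments. -/
theorem hasStrictFDerivAt (h : IsLocalSubgroup m d r S) :
    HasStrictFDerivAt (fun z : E × E => m z.1 z.2)
      (ContinuousLinearMap.fst ℝ E E + ContinuousLinearMap.snd ℝ E E) (0, 0) := by
  have hmem : ball (0 : E) r ×ˢ ball (0 : E) r ∈ 𝓝 ((0 : E), (0 : E)) :=
    prod_mem_nhds (ball_mem_nhds _ h.pos) (ball_mem_nhds _ h.pos)
  have hs := (h.smooth.contDiffAt hmem).hasStrictFDerivAt (by simp)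
  set D := fderiv ℝ (fun z : E × E => m z.1 z.2) (0, 0) with hD
  have h1 : D.comp (ContinuousLinearMap.inl ℝ E E) = ContinuousLinearMap.id ℝ E := by
    have h2 : HasFDerivAt (fun x : E => m x 0) (D.comp (ContinuousLinearMap.inl ℝ E E)) 0 :=
      HasFDerivAt.comp (g := fun z : E × E => m z.1 z.2) (f := fun x : E => (x, (0 : E))) 0
        hs.hasFDerivAt (ContinuousLinearMap.inl ℝ E E).hasFDerivAt
    refine h2.unique ((hasFDerivAt_id (0 : E)).congr_of_eventuallyEq ?_)
    filter_upwards [ball_mem_nhds (0 : E) h.pos] with x hx using h.mul_zero x hx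
  have h1' : D.comp (ContinuousLinearMap.inr ℝ E E) = ContinuousLinearMap.id ℝ E := by
    have h2 : HasFDerivAt (fun x : E => m 0 x) (D.comp (ContinuousLinearMap.inr ℝ E E)) 0 :=
      HasFDerivAt.comp (g := fun z : E × E => m z.1 z.2) (f := fun x : E => ((0 : E), x)) 0
        hs.hasFDerivAt (ContinuousLinearMap.inr ℝ E E).hasFDerivAt
    refine h2.unique ((hasFDerivAt_id (0 : E)).congr_of_eventuallyEq ?_)
    filter_upwards [ball_mem_nhds (0 : E) h.pos] with x hx using h.zero_mul x hx
  have : D = ContinuousLinearMap.fst ℝ E E + ContinuousLinearMap.snd ℝ E E := by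
    ext v
    · simpa using DFunLike.congr_fun h1 v
    · simpa using DFunLike.congr_fun h1' v
  rwa [this] at hs

/-- Near `0`, the multiplication is close to the addition. -/
theorem exists_norm_mul_sub_le (h : IsLocalSubgroup m d r S) {ε : ℝ} (hε : 0 < ε) :
    ∃ ρ > 0, ρ ≤ r ∧ ∀ x y y', ‖x‖ < ρ → ‖y‖ < ρ → ‖y'‖ < ρ →
      ‖m x y - m x y' - (y - y')‖ ≤ ε * ‖y - y'‖ := by
  have h1 := h.hasStrictFDerivAt.isLittleO.def hε
  obtain ⟨ρ, hρ, h2⟩ := Metric.eventually_nhds_iff.1 h1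
  refine ⟨min ρ r, lt_min hρ h.pos, min_le_right _ _, fun x y y' hx hy hy' => ?_⟩
  have h3 := @h2 ((x, y), (x, y')) (by
    simp only [Prod.dist_eq, dist_zero_right]
    have := min_le_left ρ r
    simp only [max_lt_iff]
    refine ⟨⟨?_, ?_⟩, ?_, ?_⟩ <;> linarith)
  simpa [Prod.norm_def] using h3

theorem exists_norm_mul_sub_add_le (h : IsLocalSubgroup m d r S) {ε : ℝ} (hε : 0 < ε) :
    ∃ ρ > 0, ρ ≤ r ∧ ∀ x y, ‖x‖ < ρ → ‖y‖ < ρ → ‖m x y - x - y‖ ≤ ε * ‖y‖ := by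
  obtain ⟨ρ, hρ, hρr, h1⟩ := h.exists_norm_mul_sub_le hε
  refine ⟨ρ, hρ, hρr, fun x y hx hy => ?_⟩
  have h2 := h1 x y 0 hx hy (by simpa using hρ)
  rwa [h.mul_zero x (by simpa using hx.trans_le hρr), sub_zero] at h2

/-- Near `0`, the left division is close to the subtraction. -/
theorem exists_norm_sub_div_le (h : IsLocalSubgroup m d r S) {ε : ℝ} (hε : 0 < ε) :
    ∃ ρ > 0, ρ ≤ r ∧ ∀ x y, ‖x‖ < ρ → ‖y‖ < ρ →
      ‖y - x - d x y‖ ≤ ε * ‖d x y‖ ∧ ‖d x y‖ ≤ 2 * ‖y - x‖ := by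
  -- The estimate is applied to `m x (d x y) = y`. The bound `1/2` allows `‖d x y‖` to be absorbed
  -- on the left, whence the factor `2`.
  obtain ⟨ρ, hρ, hρr, h1⟩ := h.exists_norm_mul_sub_add_le (lt_min hε one_half_pos)
  have h2 := h.tendsto_div.eventually (ball_mem_nhds (0 : E) hρ)
  obtain ⟨ρ', hρ', h3⟩ := Metric.eventually_nhds_iff.1 h2
  refine ⟨min ρ ρ', lt_min hρ hρ', (min_le_left _ _).trans hρr, fun x y hx hy => ?_⟩
  have hd : ‖d x y‖ < ρ := by
    have := @h3 (x, y) (by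
      simp only [Prod.dist_eq, dist_zero_right]
      exact max_lt (hx.trans_le (min_le_right _ _)) (hy.trans_le (min_le_right _ _)))
    simpa using this
  have hx' := hx.trans_le (min_le_left _ _)
  have hy' := hy.trans_le (min_le_left _ _)
  have h4 := h1 x (d x y) hx' hd
  rw [h.mul_div x (by simpa using hx'.trans_le hρr) y (by simpa using hy'.trans_le hρr)] at h4
  have h0 := norm_nonneg (d x y)
  refine ⟨h4.trans (mul_le_mul_of_nonneg_right (min_le_left _ _) h0), ?_⟩
  have h5 := h4.trans (mul_le_mul_of_nonneg_right (min_le_right _ _) h0)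
  have h6 : ‖d x y‖ ≤ ‖y - x‖ + ‖y - x - d x y‖ := by
    have := norm_sub_le (y - x) (y - x - d x y)
    simpa using this
  linarith

end IsLocalSubgroup

namespace TangentAtZero

variable {S : Set E} {v w : E}

theorem smul (hv : TangentAtZero S v) {c : ℝ} (hc : 0 < c) : TangentAtZero S (c • v) := by
  intro ε hε
  have h1 := hv (ε / c) (by positivity)
  have h2 : Tendsto (fun δ : ℝ => δ * c) (𝓝[>] 0) (𝓝[>] 0) := by
    refine tendsto_nhdsWithin_iff.2 ⟨?_, ?_⟩
    · have : Tendsto (fun δ : ℝ => δ * c) (𝓝 0) (𝓝 (0 * c)) :=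
        (continuous_id.mul continuous_const).tendsto 0
      rw [zero_mul] at this
      exact this.mono_left nhdsWithin_le_nhds
    · filter_upwards [self_mem_nhdsWithin] with δ hδ using mul_pos hδ hc
  filter_upwards [h2.eventually h1] with δ ⟨s, hs, h3⟩
  refine ⟨s, hs, ?_⟩
  rw [smul_smul]
  refine h3.trans (le_of_eq ?_)
  field_simp

end TangentAtZero

namespace IsLocalSubgroup

variable {m d : E → E → E} {r : ℝ} {S : Set E}

/-- An approximate element of the set, together with a smallness bound. -/
theorem exists_mem_near (hv : TangentAtZero S v) {ε ρ : ℝ} (hε : 0 < ε) (hρ : 0 < ρ) :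
    ∀ᶠ δ in 𝓝[>] (0 : ℝ), 0 < δ ∧ ∃ s ∈ S, ‖s - δ • v‖ ≤ ε * δ ∧ ‖s‖ < ρ ∧
      ‖s‖ ≤ (‖v‖ + ε) * δ := by
  have h1 : ∀ᶠ δ in 𝓝[>] (0 : ℝ), (‖v‖ + ε) * δ < ρ := by
    have : Tendsto (fun δ : ℝ => (‖v‖ + ε) * δ) (𝓝 0) (𝓝 ((‖v‖ + ε) * 0)) :=
      (continuous_const.mul continuous_id).tendsto 0
    rw [MulZeroClass.mul_zero] at this
    exact (this.mono_left nhdsWithin_le_nhds).eventually (gt_mem_nhds hρ)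
  filter_upwards [hv ε hε, h1, self_mem_nhdsWithin] with δ ⟨s, hs, h2⟩ h3 (h4 : 0 < δ)
  have h5 : ‖s‖ ≤ (‖v‖ + ε) * δ := by
    have h6 := norm_add_le (s - δ • v) (δ • v)
    rw [sub_add_cancel, norm_smul, Real.norm_of_nonneg h4.le] at h6
    nlinarith
  exact ⟨h4, s, hs, h2, h5.trans_lt h3, h5⟩

/-- If `s ≈ δ • v` and `t ≈ δ • w`, then `m s t` belongs to `S` and agrees with `s + t` to first
order. -/
theorem tangent_add (h : IsLocalSubgroup m d r S) {v w : E} (hv : TangentAtZero S v)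
    (hw : TangentAtZero S w) : TangentAtZero S (v + w) := by
  intro ε hε
  have hc : 0 < ‖w‖ + ε / 4 := by positivity
  -- As `‖t‖ ≤ (‖w‖ + ε/4) δ`, the group law contributes an error of `ε δ/2`; the approximations of
  -- `v` and `w` contribute `ε δ/4` each.
  obtain ⟨ρ, hρ, hρr, h1⟩ := h.exists_norm_mul_sub_add_le (div_pos (half_pos hε) hc)
  filter_upwards [exists_mem_near hv (ε := ε / 4) (by positivity) hρ,
    exists_mem_near hw (ε := ε / 4) (by positivity) hρ] with δ ⟨hδ, s, hs, hs1, hs2, hs3⟩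
    ⟨_, t, ht, ht1, ht2, ht3⟩
  refine ⟨m s t, h.mul_mem s ⟨hs, by simpa using hs2.trans_le hρr⟩ t
    ⟨ht, by simpa using ht2.trans_le hρr⟩, ?_⟩
  have h2 := h1 s t hs2 ht2
  have h3 : ε / 2 / (‖w‖ + ε / 4) * ‖t‖ ≤ ε / 2 * δ := by
    calc ε / 2 / (‖w‖ + ε / 4) * ‖t‖ ≤ ε / 2 / (‖w‖ + ε / 4) * ((‖w‖ + ε / 4) * δ) := by gcongr
      _ = ε / 2 * δ := by field_simp
  have h4 : m s t - δ • (v + w) = (m s t - s - t) + (s - δ • v) + (t - δ • w) := by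
    rw [smul_add]; abel
  rw [h4]
  have h5 := norm_add₃_le (a := m s t - s - t) (b := s - δ • v) (c := t - δ • w)
  linarith

/-- The inverse `d s 0` of `s` equals `-s` to first order. -/
theorem tangent_neg (h : IsLocalSubgroup m d r S) {v : E} (hv : TangentAtZero S v) :
    TangentAtZero S (-v) := by
  intro ε hε
  have hc : 0 < ‖v‖ + ε / 4 := by positivity
  obtain ⟨ρ, hρ, hρr, h1⟩ := h.exists_norm_sub_div_le (ε := ε / 4 / (‖v‖ + ε / 4))
    (by positivity)
  filter_upwards [exists_mem_near hv (ε := ε / 4) (by positivity) hρ] with δ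
    ⟨hδ, s, hs, hs1, hs2, hs3⟩
  refine ⟨d s 0, h.div_mem s ⟨hs, by simpa using hs2.trans_le hρr⟩ 0
    ⟨h.zero_mem, by simpa using h.pos⟩, ?_⟩
  obtain ⟨h2, h3⟩ := h1 s 0 hs2 (by simpa using hρ)
  rw [zero_sub, norm_neg] at h3
  have h4 : ε / 4 / (‖v‖ + ε / 4) * ‖d s 0‖ ≤ ε / 2 * δ := by
    calc ε / 4 / (‖v‖ + ε / 4) * ‖d s 0‖
        ≤ ε / 4 / (‖v‖ + ε / 4) * (2 * ((‖v‖ + ε / 4) * δ)) := by gcongr; linarith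
      _ = ε / 2 * δ := by field_simp; ring
  have h5 : d s 0 - δ • (-v) = -((0 - s - d s 0) + (s - δ • v)) := by
    rw [smul_neg]; abel
  rw [h5, norm_neg]
  have h6 := norm_add_le (0 - s - d s 0) (s - δ • v)
  have : 0 < ε * δ := by positivity
  linarith

/-- The tangent space of a local subgroup. -/
def tangentSpace (h : IsLocalSubgroup m d r S) : Submodule ℝ E where
  carrier := {v | TangentAtZero S v}
  add_mem' hv hw := h.tangent_add hv hw
  zero_mem' ε hε := by
    filter_upwards [self_mem_nhdsWithin] with δ (hδ : 0 < δ)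
    exact ⟨0, h.zero_mem, by simpa using by positivity⟩
  smul_mem' c v hv := by
    rcases lt_trichotomy c 0 with hc | rfl | hc
    · have := h.tangent_neg (TangentAtZero.smul hv (c := -c) (by linarith))
      simpa using this
    · intro ε hε
      filter_upwards [self_mem_nhdsWithin] with δ (hδ : 0 < δ)
      exact ⟨0, h.zero_mem, by simpa using by positivity⟩
    · exact TangentAtZero.smul hv hc

/-- Iterated products `x ^ k` in a local group. -/
def localPow (m : E → E → E) (x : E) : ℕ → E
  | 0 => 0
  | k + 1 => m (localPow m x k) x

/-- Each new factor adds an error of at most `ε * ‖x‖`. The condition `2 * (k * ‖x‖) < ρ`, with `ε ≤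
1`, keeps all partial products in the ball where this estimate is valid. -/
theorem localPow_mem_and_norm_sub_le (h : IsLocalSubgroup m d r S) {ε ρ : ℝ} (hε1 : ε ≤ 1)
    (hρr : ρ ≤ r) (h1 : ∀ x y, ‖x‖ < ρ → ‖y‖ < ρ → ‖m x y - x - y‖ ≤ ε * ‖y‖) {x : E}
    (hx : x ∈ S) (k : ℕ) (hk : 2 * (k * ‖x‖) < ρ) (hxρ : ‖x‖ < ρ) :
    localPow m x k ∈ S ∧ ‖localPow m x k - (k : ℝ) • x‖ ≤ k * (ε * ‖x‖) := by
  induction k with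
  | zero => exact ⟨h.zero_mem, by simp [localPow]⟩
  | succ k ih =>
    have h0 := norm_nonneg x
    push_cast at hk
    obtain ⟨h2, h3⟩ := ih (by nlinarith)
    have hk0 : (0 : ℝ) ≤ k := k.cast_nonneg
    have h4 : ‖localPow m x k‖ < ρ := by
      have h5 := norm_add_le (localPow m x k - (k : ℝ) • x) ((k : ℝ) • x)
      rw [sub_add_cancel, norm_smul, Real.norm_of_nonneg hk0] at h5
      have : (k : ℝ) * (ε * ‖x‖) ≤ k * (1 * ‖x‖) := by gcongr
      nlinarith
    refine ⟨h.mul_mem _ ⟨h2, by simpa using h4.trans_le hρr⟩ x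
      ⟨hx, by simpa using hxρ.trans_le hρr⟩, ?_⟩
    have h5 := h1 _ x h4 hxρ
    have h6 : localPow m x (k + 1) - ((k + 1 : ℕ) : ℝ) • x =
        (m (localPow m x k) x - localPow m x k - x) + (localPow m x k - (k : ℝ) • x) := by
      push_cast
      rw [add_smul, one_smul]
      change m (localPow m x k) x - _ = _
      abel
    rw [h6]
    refine (norm_add_le _ _).trans ?_
    push_cast
    linarith

/-- Limits of directions of elements of a local subgroup tending to `0` are tangent. -/
theorem tangent_of_tendsto (h : IsLocalSubgroup m d r S) {x : ℕ → E} (hxS : ∀ n, x n ∈ S)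
    (hx0 : ∀ n, x n ≠ 0) (hx : Tendsto x atTop (𝓝 0)) {v : E}
    (hv : Tendsto (fun n => ‖x n‖⁻¹ • x n) atTop (𝓝 v)) : TangentAtZero S v := by
  intro ε' hε'
  set ε := min (ε' / 3) 1 with hεdef
  have hε : 0 < ε := lt_min (by positivity) one_pos
  obtain ⟨ρ, hρ, hρr, h1⟩ := h.exists_norm_mul_sub_add_le hε
  have hδρ : ∀ᶠ δ in 𝓝[>] (0 : ℝ), δ < ρ / 2 :=
    nhdsWithin_le_nhds (gt_mem_nhds (by positivity))
  filter_upwards [hδρ, self_mem_nhdsWithin] with δ h2 (hδ : 0 < δ)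
  have h3 : ∀ᶠ n in atTop, ‖x n‖ < min (ε * δ) ρ := by
    have := hx.norm
    rw [norm_zero] at this
    exact this.eventually (gt_mem_nhds (by positivity))
  have h4 : ∀ᶠ n in atTop, ‖‖x n‖⁻¹ • x n - v‖ < ε := by
    have := (hv.sub_const v).norm
    rw [sub_self, norm_zero] at this
    exact this.eventually (gt_mem_nhds hε)
  obtain ⟨n, h5, h6⟩ := (h3.and h4).exists
  have hpos : 0 < ‖x n‖ := norm_pos_iff.2 (hx0 n)
  -- With this exponent `k • x n` has length `δ` up to `‖x n‖`, so the `k`-th power of `x n` is an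
  -- element of `S` close to `δ • v`.
  set k := ⌊δ / ‖x n‖⌋₊ with hk
  have hk1 : k * ‖x n‖ ≤ δ := by
    have := Nat.floor_le (a := δ / ‖x n‖) (by positivity)
    rwa [le_div_iff₀ hpos] at this
  have hk2 : δ - ‖x n‖ ≤ k * ‖x n‖ := by
    have := Nat.lt_floor_add_one (δ / ‖x n‖)
    rw [div_lt_iff₀ hpos, ← hk] at this
    linarith
  obtain ⟨h7, h8⟩ := h.localPow_mem_and_norm_sub_le (min_le_right _ _) hρr h1 (hxS n) k
    (by linarith) (h5.trans_le (min_le_right _ _))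
  refine ⟨_, h7, ?_⟩
  -- The three errors come from replacing products by sums, from rounding `k`, and from the
  -- direction of `x n`. Each is at most `ε δ ≤ ε' δ / 3`.
  have h9 : localPow m (x n) k - δ • v = (localPow m (x n) k - (k : ℝ) • x n) +
      (k * ‖x n‖ - δ) • (‖x n‖⁻¹ • x n) + δ • (‖x n‖⁻¹ • x n - v) := by
    have : (k * ‖x n‖ - δ) • (‖x n‖⁻¹ • x n) = (k : ℝ) • x n - δ • (‖x n‖⁻¹ • x n) := by
      rw [sub_smul, smul_smul (k * ‖x n‖), mul_assoc, mul_inv_cancel₀ hpos.ne', mul_one]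
    rw [this, smul_sub]
    abel
  rw [h9]
  refine (norm_add₃_le).trans ?_
  rw [norm_smul, norm_smul δ, norm_smul (‖x n‖⁻¹), norm_inv, norm_norm,
    inv_mul_cancel₀ hpos.ne', mul_one, Real.norm_of_nonneg hδ.le]
  have h10 : ‖k * ‖x n‖ - δ‖ ≤ ‖x n‖ := by
    rw [Real.norm_eq_abs, abs_le]
    constructor <;> linarith
  have h11 : ‖x n‖ ≤ ε * δ := (h5.trans_le (min_le_left _ _)).le
  have h12 : δ * ‖‖x n‖⁻¹ • x n - v‖ ≤ δ * ε := by gcongr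
  have h13 : (k : ℝ) * (ε * ‖x n‖) ≤ ε * δ := by nlinarith
  have h14 : ε * δ ≤ ε' / 3 * δ := by
    gcongr
    exact min_le_left _ _
  linarith

end IsLocalSubgroup

end LocalSubgroup

/-! ### Local subgroups as smooth graphs over their tangent spaces -/

section LocalSubgroup

open Metric

variable {E : Type*} [NormedAddCommGroup E] [NormedSpace ℝ E]

namespace IsLocalSubgroup

variable {m d : E → E → E} {r : ℝ} {S : Set E}

/-- The differential at `0` of the left translation by `s`. -/
noncomputable def leftDeriv (m : E → E → E) (s : E) : E →L[ℝ] E :=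
  (fderiv ℝ (fun z : E × E => m z.1 z.2) (s, 0)).comp (ContinuousLinearMap.inr ℝ E E)

theorem hasFDerivAt_leftDeriv (h : IsLocalSubgroup m d r S) {s : E} (hs : s ∈ ball (0 : E) r) :
    HasFDerivAt (m s) (leftDeriv m s) 0 := by
  have hmem : ball (0 : E) r ×ˢ ball (0 : E) r ∈ 𝓝 (s, (0 : E)) :=
    prod_mem_nhds (isOpen_ball.mem_nhds hs) (ball_mem_nhds _ h.pos)
  have h1 : HasFDerivAt (fun z : E × E => m z.1 z.2)
      (fderiv ℝ (fun z : E × E => m z.1 z.2) (s, 0)) (s, 0) :=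
    ((h.smooth.contDiffAt hmem).differentiableAt (by simp)).hasFDerivAt
  exact HasFDerivAt.comp (g := fun z : E × E => m z.1 z.2) (f := fun x : E => (s, x)) 0
    h1 (hasFDerivAt_prodMk_right s (0 : E))

theorem contDiffOn_leftDeriv (h : IsLocalSubgroup m d r S) :
    ContDiffOn ℝ ∞ (leftDeriv m) (ball 0 r) := by
  have h1 : ContDiffOn ℝ ∞ (fderiv ℝ (fun z : E × E => m z.1 z.2)) (ball 0 r ×ˢ ball 0 r) :=
    h.smooth.fderiv_of_isOpen (isOpen_ball.prod isOpen_ball) (by simp)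
  have h2 : ContDiffOn ℝ ∞ (fun s : E => fderiv ℝ (fun z : E × E => m z.1 z.2) (s, 0))
      (ball 0 r) :=
    h1.comp (contDiff_id.prodMk contDiff_const).contDiffOn
      fun s hs => ⟨hs, by simpa using h.pos⟩
  exact h2.clm_comp contDiffOn_const

theorem exists_norm_leftDeriv_sub_le (h : IsLocalSubgroup m d r S) {ε : ℝ} (hε : 0 < ε) :
    ∃ ρ > 0, ρ ≤ r ∧ ∀ s, ‖s‖ < ρ → ‖leftDeriv m s - ContinuousLinearMap.id ℝ E‖ ≤ ε := by
  obtain ⟨ρ, hρ, hρr, h1⟩ := h.exists_norm_mul_sub_le hε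
  refine ⟨ρ, hρ, hρr, fun s hs => ?_⟩
  have h2 : HasFDerivAt (fun y => m s y - y) (leftDeriv m s - ContinuousLinearMap.id ℝ E) 0 :=
    (h.hasFDerivAt_leftDeriv (by simpa using hs.trans_le hρr)).sub (hasFDerivAt_id 0)
  refine h2.le_of_lip' hε.le ?_
  filter_upwards [ball_mem_nhds (0 : E) hρ] with y hy
  have := h1 s y 0 hs (by simpa using hy) (by simpa using hρ)
  convert this using 2
  abel

variable [FiniteDimensional ℝ E]

/-- Elements of a local subgroup close to `0` are close to its tangent space. -/
theorem exists_norm_sub_proj_le (h : IsLocalSubgroup m d r S) (π : E →L[ℝ] h.tangentSpace)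
    (hπ : ∀ v : h.tangentSpace, π v = v) {ε : ℝ} (hε : 0 < ε) :
    ∃ ρ > 0, ρ ≤ r ∧ ∀ s ∈ S, ‖s‖ < ρ → ‖s - π s‖ ≤ ε * ‖s‖ := by
  -- Otherwise there are elements of `S` tending to `0` whose normalized errors stay above `ε`. By
  -- compactness of the sphere their directions subconverge to some `v`, which is tangent and hence
  -- fixed by `π`: a contradiction.
  by_contra! hcon
  have hpos := h.pos
  have h1 : ∀ n : ℕ, ∃ s ∈ S, ‖s‖ < r / (n + 1) ∧ ε * ‖s‖ < ‖s - π s‖ := fun n =>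
    hcon (r / (n + 1)) (by positivity) (div_le_self hpos.le (by linarith [n.cast_nonneg (α := ℝ)]))
  choose x hxS hxr hxε using h1
  have hx0 : ∀ n, x n ≠ 0 := fun n h0 => by simpa [h0] using hxε n
  have hx : Tendsto x atTop (𝓝 0) := by
    rw [tendsto_zero_iff_norm_tendsto_zero]
    refine squeeze_zero (fun n => norm_nonneg _) (fun n => (hxr n).le) ?_
    have := tendsto_one_div_add_atTop_nhds_zero_nat (𝕜 := ℝ)
    simpa [div_eq_mul_inv] using this.const_mul r
  have hu : ∀ n, ‖x n‖⁻¹ • x n ∈ sphere (0 : E) 1 := fun n => by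
    have : ‖x n‖ ≠ 0 := norm_ne_zero_iff.2 (hx0 n)
    simp [norm_smul, this]
  obtain ⟨v, -, φ, hφ, hv⟩ := (isCompact_sphere (0 : E) 1).tendsto_subseq hu
  have hvt : v ∈ h.tangentSpace :=
    h.tangent_of_tendsto (x := x ∘ φ) (fun n => hxS _) (fun n => hx0 _)
      (hx.comp hφ.tendsto_atTop) hv
  have hvπ : (π v : E) = v := congrArg Subtype.val (hπ ⟨v, hvt⟩)
  have hc : Continuous fun y : E => ‖y - π y‖ := by fun_prop
  have h2 : Tendsto (fun n => ‖‖x (φ n)‖⁻¹ • x (φ n) - π (‖x (φ n)‖⁻¹ • x (φ n))‖) atTop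
      (𝓝 ‖v - π v‖) := (hc.tendsto v).comp hv
  rw [hvπ, sub_self, norm_zero] at h2
  obtain ⟨n, hn⟩ := (h2.eventually (gt_mem_nhds hε)).exists
  rw [map_smul, Submodule.coe_smul, ← smul_sub, norm_smul, norm_inv, norm_norm,
    inv_mul_lt_iff₀ (norm_pos_iff.2 (hx0 _)), mul_comm] at hn
  exact lt_asymm hn (hxε _)

/-- A local subgroup is a Lipschitz graph over its tangent space: injectivity of the projection. -/
theorem exists_norm_sub_le_two_mul (h : IsLocalSubgroup m d r S) (π : E →L[ℝ] h.tangentSpace)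
    (hπ : ∀ v : h.tangentSpace, π v = v) :
    ∃ ρ > 0, ρ ≤ r ∧ ∀ s ∈ S, ∀ t ∈ S, ‖s‖ < ρ → ‖t‖ < ρ →
      ‖t - s‖ ≤ 2 * ‖π (t - s)‖ := by
  -- The difference `t - s` need not be near an element of `S` to the required precision, but the
  -- quotient `d s t` lies in `S` and approximates it. With this `c` the errors add up to `‖d s t‖ /
  -- 4 ≤ ‖t - s‖ / 2`.
  set c := 2 * (2 + ‖π‖) with hc
  have hcpos : 0 < c := by positivity
  obtain ⟨ρ₁, hρ₁, hρ₁r, h1⟩ := h.exists_norm_sub_div_le (ε := 1 / (2 * c)) (by positivity)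
  obtain ⟨ρ₂, hρ₂, hρ₂r, h2⟩ := h.exists_norm_sub_proj_le π hπ (ε := 1 / (2 * c)) (by positivity)
  refine ⟨min ρ₁ (ρ₂ / 4), by positivity, (min_le_left _ _).trans hρ₁r,
    fun s hs t ht hsρ htρ => ?_⟩
  have hs1 := hsρ.trans_le (min_le_left _ _)
  have ht1 := htρ.trans_le (min_le_left _ _)
  have hs2 := hsρ.trans_le (min_le_right _ _)
  have ht2 := htρ.trans_le (min_le_right _ _)
  obtain ⟨h3, h4⟩ := h1 s t hs1 ht1
  have hdS : d s t ∈ S := h.div_mem s ⟨hs, by simpa using hs1.trans_le hρ₁r⟩ t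
    ⟨ht, by simpa using ht1.trans_le hρ₁r⟩
  have h5 := h2 _ hdS (by linarith [norm_sub_le t s])
  set u := t - s - d s t with hu
  have h6 : t - s - π (t - s) = (d s t - π (d s t)) + (u - π u) := by
    have : t - s = d s t + u := by rw [hu]; abel
    rw [this, map_add, Submodule.coe_add]
    abel
  have h7 : ‖u - π u‖ ≤ (1 + ‖π‖) * ‖u‖ := by
    refine (norm_sub_le _ _).trans ?_
    have : ‖(π u : E)‖ ≤ ‖π‖ * ‖u‖ := π.le_opNorm u
    linarith
  have h8 : ‖t - s - π (t - s)‖ ≤ 1 / 2 * ‖t - s‖ := by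
    rw [h6]
    refine (norm_add_le _ _).trans ?_
    have h9 : (1 + ‖π‖) * ‖u‖ ≤ (1 + ‖π‖) * (1 / (2 * c) * ‖d s t‖) := by gcongr
    have h10 : 1 / (2 * c) * ‖d s t‖ + (1 + ‖π‖) * (1 / (2 * c) * ‖d s t‖) = 1 / 4 * ‖d s t‖ := by
      rw [hc]; field_simp; ring
    linarith
  have h9 : ‖t - s‖ ≤ ‖t - s - π (t - s)‖ + ‖π (t - s)‖ := by
    have := norm_add_le (t - s - π (t - s)) (π (t - s) : E)
    rwa [sub_add_cancel] at this
  linarith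

/-- The projection of a local subgroup to its tangent space is surjective near `0`. -/
theorem exists_mem_proj_eq (h : IsLocalSubgroup m d r S) (π : E →L[ℝ] h.tangentSpace)
    (hπ : ∀ v : h.tangentSpace, π v = v) {ρ : ℝ} (hρ : 0 < ρ)
    (hlip : ∀ s ∈ S, ∀ t ∈ S, ‖s‖ < ρ → ‖t‖ < ρ → ‖t - s‖ ≤ 2 * ‖π (t - s)‖) :
    ∃ ρ' > 0, ∀ x : h.tangentSpace, ‖x‖ < ρ' → ∃ s ∈ S, ‖s‖ < ρ ∧ π s = x := by
  set ε := 1 / (8 * (1 + ‖π‖)) with hεdef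
  have hε : 0 < ε := by positivity
  have hε1 : ‖π‖ * ε ≤ 1 / 8 := by
    rw [hεdef, mul_one_div, div_le_div_iff₀ (by positivity) (by positivity)]
    linarith
  have hε2 : ε ≤ 1 := by
    rw [hεdef, div_le_one (by positivity)]
    linarith [norm_nonneg π]
  obtain ⟨ρ₁, hρ₁, hρ₁r, h1⟩ := h.exists_norm_mul_sub_add_le hε
  set R := min (ρ / 2) (ρ₁ / 2) with hR
  have hRpos : 0 < R := by positivity
  have hRρ : R < ρ := (min_le_left _ _).trans_lt (by linarith)
  have hRρ₁ : R < ρ₁ := (min_le_right _ _).trans_lt (by linarith)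
  have hK : IsCompact (S ∩ closedBall 0 R) := by
    have h2 : S ∩ closedBall 0 R = closure S ∩ closedBall 0 R := by
      refine subset_antisymm (inter_subset_inter_left _ subset_closure) fun y hy => ⟨?_, hy.2⟩
      refine h.closed y ?_ hy.1
      have := hy.2
      rw [mem_closedBall_zero_iff] at this
      simpa using this.trans_lt (hRρ₁.trans_le hρ₁r)
    rw [h2]
    exact (isCompact_closedBall _ _).inter_left isClosed_closure
  refine ⟨R / 8, by positivity, fun x hx => ?_⟩
  have h0K : (0 : E) ∈ S ∩ closedBall 0 R := ⟨h.zero_mem, by simpa using hRpos.le⟩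
  -- Take `s` whose projection is nearest to `x`. If `w = x - π s ≠ 0`, multiplying `s` by some `t ∈
  -- S` close to `δ • w` brings the projection closer to `x`, against minimality.
  obtain ⟨s, ⟨hsS, hsR⟩, hmin⟩ := hK.exists_isMinOn ⟨0, h0K⟩
    (f := fun s => ‖π s - x‖) (by fun_prop)
  rw [mem_closedBall_zero_iff] at hsR
  refine ⟨s, hsS, hsR.trans_lt hRρ, ?_⟩
  by_contra hne
  set w := x - π s with hw
  have hw0 : 0 < ‖w‖ := norm_pos_iff.2 (sub_ne_zero.2 (Ne.symm hne))
  have h2 : ‖w‖ ≤ ‖x‖ := by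
    have := hmin h0K
    simp only [mem_ofPred_eq, map_zero, zero_sub, norm_neg] at this
    rwa [norm_sub_rev] at this
  -- The Lipschitz bound gives `‖s‖ ≤ 2 ‖π s‖ ≤ 4 ‖x‖`. This is the reason for the radius `R / 8`:
  -- the minimizer stays well inside the ball, and `m s t` does not leave it.
  have h3 : ‖s‖ ≤ R / 2 := by
    have h4 := hlip 0 h.zero_mem s hsS (by simpa using hρ) (hsR.trans_lt hRρ)
    rw [sub_zero] at h4
    have h5 : ‖π s‖ ≤ ‖x‖ + ‖w‖ := by
      have := norm_sub_le x w
      rwa [hw, sub_sub_cancel, ← hw] at this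
    linarith
  have hwT : TangentAtZero S (w : E) := w.2
  have hev : ∀ᶠ δ in 𝓝[>] (0 : ℝ), δ < 1 := nhdsWithin_le_nhds (gt_mem_nhds one_pos)
  obtain ⟨δ, ⟨hδ, t, htS, ht1, ht2, ht3⟩, hδ1⟩ :=
    ((exists_mem_near hwT (ε := ε * ‖w‖) (by positivity) (ρ := R / 4) (by positivity)).and
      hev).exists
  rw [← Submodule.coe_norm] at ht3
  have hst := h1 s t (by linarith) (by linarith)
  have hmS : m s t ∈ S := h.mul_mem s ⟨hsS, by simpa using by linarith⟩ t
    ⟨htS, by simpa using by linarith⟩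
  have hmR : ‖m s t‖ ≤ R := by
    have h4 := norm_add₃_le (a := m s t - s - t) (b := s) (c := t)
    rw [show m s t - s - t + s + t = m s t by abel] at h4
    have : ε * ‖t‖ ≤ 1 * ‖t‖ := by gcongr
    linarith
  have h4 : ‖w‖ ≤ ‖π (m s t) - x‖ := by
    have := hmin (show m s t ∈ S ∩ closedBall 0 R from ⟨hmS, by simpa using hmR⟩)
    simp only [mem_ofPred_eq] at this
    rwa [norm_sub_rev] at this
  -- The main term has norm `(1 - δ) ‖w‖`, and the two errors together are at most `3/8 δ ‖w‖`, so
  -- the distance drops below `‖w‖`.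
  have h5 : π (m s t) - x = (δ - 1) • w + π (t - δ • (w : E)) + π (m s t - s - t) := by
    simp only [map_sub, map_smul, hπ, sub_smul, one_smul, hw]
    abel
  rw [h5] at h4
  have h6 := h4.trans norm_add₃_le
  have h7 : ‖π (t - δ • (w : E))‖ ≤ 1 / 8 * (‖w‖ * δ) := by
    refine (π.le_opNorm _).trans ?_
    calc ‖π‖ * ‖t - δ • (w : E)‖ ≤ ‖π‖ * (ε * ‖w‖ * δ) := by gcongr
      _ = (‖π‖ * ε) * (‖w‖ * δ) := by ring
      _ ≤ _ := by gcongr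
  have h8 : ‖π (m s t - s - t)‖ ≤ 1 / 8 * (2 * ‖w‖ * δ) := by
    refine (π.le_opNorm _).trans ?_
    have h9 : ‖t‖ ≤ 2 * ‖w‖ * δ := by
      refine ht3.trans ?_
      have : ε * ‖w‖ ≤ 1 * ‖w‖ := by gcongr
      gcongr
      linarith
    calc ‖π‖ * ‖m s t - s - t‖ ≤ ‖π‖ * (ε * (2 * ‖w‖ * δ)) := by
          gcongr
          exact hst.trans (by gcongr)
      _ = (‖π‖ * ε) * (2 * ‖w‖ * δ) := by ring
      _ ≤ _ := by gcongr
  rw [norm_smul, Real.norm_eq_abs, abs_of_neg (by linarith : δ - 1 < 0)] at h6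
  nlinarith [mul_pos hw0 hδ]

/-- The projection of the tangent space, translated by `s`, to the tangent space at `0`. -/
noncomputable def projLeftDeriv (h : IsLocalSubgroup m d r S) (π : E →L[ℝ] h.tangentSpace)
    (s : E) : h.tangentSpace →L[ℝ] h.tangentSpace :=
  (π.comp (leftDeriv m s)).comp h.tangentSpace.subtypeL

/-- Near `0` the left translation has derivative close to the identity, so this operator has
distance less than `1` from the identity and is inverted by a Neumann series. -/
theorem exists_isUnit_projLeftDeriv (h : IsLocalSubgroup m d r S) (π : E →L[ℝ] h.tangentSpace)
    (hπ : ∀ v : h.tangentSpace, π v = v) :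
    ∃ ρ > 0, ρ ≤ r ∧ ∀ s, ‖s‖ < ρ → IsUnit (h.projLeftDeriv π s) := by
  obtain ⟨ρ, hρ, hρr, h1⟩ := h.exists_norm_leftDeriv_sub_le (ε := 1 / (2 * (1 + ‖π‖)))
    (by positivity)
  refine ⟨ρ, hρ, hρr, fun s hs => ?_⟩
  have h2 : 1 - h.projLeftDeriv π s =
      (π.comp (ContinuousLinearMap.id ℝ E - leftDeriv m s)).comp h.tangentSpace.subtypeL := by
    ext v
    simp [projLeftDeriv, hπ]
  have h3 : ‖1 - h.projLeftDeriv π s‖ < 1 := by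
    rw [h2]
    refine (ContinuousLinearMap.opNorm_comp_le _ _).trans_lt ?_
    have h4 := h1 s hs
    rw [norm_sub_rev] at h4
    have h5 : ‖h.tangentSpace.subtypeL‖ ≤ 1 := Submodule.norm_subtypeL_le _
    have h6 := (π.opNorm_comp_le (ContinuousLinearMap.id ℝ E - leftDeriv m s)).trans
      (mul_le_mul_of_nonneg_left h4 (norm_nonneg π))
    have h7 : ‖π‖ * (1 / (2 * (1 + ‖π‖))) < 1 := by
      rw [mul_one_div, div_lt_one (by positivity)]
      linarith [norm_nonneg π]
    calc _ ≤ ‖π.comp (ContinuousLinearMap.id ℝ E - leftDeriv m s)‖ * 1 := by gcongr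
      _ < 1 := by linarith
  have : CompleteSpace h.tangentSpace := FiniteDimensional.complete ℝ _
  have h8 := isUnit_one_sub_of_norm_lt_one
    (R := h.tangentSpace →L[ℝ] h.tangentSpace) h3
  rwa [sub_sub_cancel] at h8

/-- The differential of the graph function of a local subgroup, at the point lying
over `s`. -/
noncomputable def graphDeriv (h : IsLocalSubgroup m d r S) (π : E →L[ℝ] h.tangentSpace)
    (s : E) : h.tangentSpace →L[ℝ] E :=
  ((leftDeriv m s).comp h.tangentSpace.subtypeL).comp (Ring.inverse (h.projLeftDeriv π s))

/-- Inversion of operators is smooth at units. This feeds the bootstrap in `exists_straightening`: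
the derivative of the graph function is a smooth function of its value. -/
theorem contDiffAt_graphDeriv (h : IsLocalSubgroup m d r S) (π : E →L[ℝ] h.tangentSpace)
    {s : E} (hs : s ∈ ball (0 : E) r) (hu : IsUnit (h.projLeftDeriv π s)) :
    ContDiffAt ℝ ∞ (h.graphDeriv π) s := by
  have h1 : ContDiffAt ℝ ∞ (leftDeriv m) s :=
    h.contDiffOn_leftDeriv.contDiffAt (isOpen_ball.mem_nhds hs)
  have h2 : ContDiffAt ℝ ∞ (h.projLeftDeriv π) s :=
    (contDiffAt_const.clm_comp h1).clm_comp contDiffAt_const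
  obtain ⟨u, hu⟩ := hu
  have : CompleteSpace h.tangentSpace := FiniteDimensional.complete ℝ _
  have h3 : ContDiffAt ℝ ∞ (fun s => Ring.inverse (h.projLeftDeriv π s)) s :=
    ContDiffAt.comp (g := Ring.inverse) s (by rw [← hu]; exact contDiffAt_ringInverse (R := h.tangentSpace →L[ℝ] h.tangentSpace) ℝ u) h2
  exact (h1.clm_comp contDiffAt_const).clm_comp h3

/-- The graph function of a local subgroup over its tangent space is differentiable. -/
theorem hasFDerivAt_graph (h : IsLocalSubgroup m d r S) (π : E →L[ℝ] h.tangentSpace)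
    (hπ : ∀ v : h.tangentSpace, π v = v) {ρ : ℝ} (hρr : ρ ≤ r)
    (hdiv : ∀ x y, ‖x‖ < ρ → ‖y‖ < ρ → ‖d x y‖ ≤ 2 * ‖y - x‖)
    {σ : h.tangentSpace → E} {x : h.tangentSpace}
    (hσ : ∀ᶠ y in 𝓝 x, σ y ∈ S ∧ ‖σ y‖ < ρ ∧ π (σ y) = y ∧ ‖σ y - σ x‖ ≤ 2 * ‖y - x‖)
    (hu : IsUnit (h.projLeftDeriv π (σ x))) :
    HasFDerivAt σ (h.graphDeriv π (σ x)) x := by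
  obtain ⟨hxS, hxρ, hπx, -⟩ := hσ.self_of_nhds
  have hxr : σ x ∈ ball (0 : E) r := by simpa using hxρ.trans_le hρr
  -- Left division by `σ x` moves the problem to the origin, where elements of `S` are tangent to
  -- first order.
  set T : h.tangentSpace → E := fun y => d (σ x) (σ y) with hT
  set L := leftDeriv m (σ x) with hL
  set A := h.projLeftDeriv π (σ x) with hA
  have hTle : ∀ᶠ y in 𝓝 x, ‖T y‖ ≤ 4 * ‖y - x‖ := by
    filter_upwards [hσ] with y ⟨_, hyρ, _, hy⟩
    linarith [hdiv _ _ hxρ hyρ]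
  have hTO : T =O[𝓝 x] fun y => y - x := Asymptotics.IsBigO.of_bound 4 hTle
  have hT0 : Tendsto T (𝓝 x) (𝓝 0) := by
    refine hTO.trans_tendsto ?_
    have : Tendsto (fun y : h.tangentSpace => y - x) (𝓝 x) (𝓝 (x - x)) :=
      (continuous_id.sub continuous_const).tendsto x
    rwa [sub_self] at this
  have hTS : ∀ᶠ y in 𝓝 x, T y ∈ S := by
    filter_upwards [hσ] with y ⟨hyS, hyρ, _, _⟩
    exact h.div_mem _ ⟨hxS, hxr⟩ _ ⟨hyS, by simpa using hyρ.trans_le hρr⟩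
  have hproj : (fun y => T y - (π (T y) : E)) =o[𝓝 x] fun y => y - x := by
    refine Asymptotics.IsLittleO.trans_isBigO ?_ hTO
    refine Asymptotics.IsLittleO.of_bound fun c hc => ?_
    obtain ⟨ρ', hρ', -, h1⟩ := h.exists_norm_sub_proj_le π hπ hc
    filter_upwards [hTS, hT0.eventually (ball_mem_nhds (0 : E) hρ')] with y hy hy'
    exact h1 _ hy (by simpa using hy')
  have hmT : (fun y => σ y - σ x - L (T y)) =o[𝓝 x] fun y => y - x := by
    refine Asymptotics.IsLittleO.trans_isBigO ?_ hTO
    have h1 := (h.hasFDerivAt_leftDeriv hxr).isLittleO.comp_tendsto hT0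
    have h2 : ∀ᶠ y in 𝓝 x, m (σ x) (T y) - m (σ x) 0 - L (T y - 0) = σ y - σ x - L (T y) := by
      filter_upwards [hσ] with y ⟨_, hyρ, _, _⟩
      rw [h.mul_div _ hxr _ (by simpa using hyρ.trans_le hρr), h.mul_zero _ hxr, sub_zero]
    exact h1.congr' h2 (Eventually.of_forall fun y => by simp)
  set e : h.tangentSpace → E := fun y => σ y - σ x - L (π (T y) : E) with he
  have hee : e =o[𝓝 x] fun y => y - x := by
    have h1 := hmT.add ((L.isBigO_comp _ _).trans_isLittleO hproj)
    refine h1.congr (fun y => ?_) fun y => rfl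
    simp only [he, map_sub]
    abel
  have hAinv : ∀ w, Ring.inverse A (A w) = w := fun w => by
    have := Ring.inverse_mul_cancel A hu
    exact DFunLike.congr_fun this w
  rw [hasFDerivAt_iff_isLittleO]
  have h1 : (fun y => e y - h.graphDeriv π (σ x) (π (e y))) =o[𝓝 x] fun y => y - x :=
    hee.sub ((ContinuousLinearMap.isBigO_comp
      ((h.graphDeriv π (σ x)).comp π) e _).trans_isLittleO hee)
  refine h1.congr' ?_ EventuallyEq.rfl
  filter_upwards [hσ] with y ⟨_, _, hy, _⟩
  -- Projecting `σ y - σ x = e y + L (π (T y))` and inverting `A` expresses `π (T y)` through `y -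
  -- x` up to `o(y - x)`.
  have h2 : y - x = π (e y) + A (π (T y)) := by
    simp only [he, map_sub, hy, hπx, hA, projLeftDeriv, ContinuousLinearMap.comp_apply]
    simp [hL]
  have h3 : h.graphDeriv π (σ x) (A (π (T y))) = L (π (T y) : E) := by
    simp only [graphDeriv, ContinuousLinearMap.comp_apply]
    rw [← hA, hAinv]
    rfl
  rw [h2, map_add, h3]
  simp only [he]
  abel

/-- A local subgroup is straightened to its tangent space by a local diffeomorphism. -/
theorem exists_straightening (h : IsLocalSubgroup m d r S) :
    ∃ e : OpenPartialHomeomorph E E, 0 ∈ e.source ∧ e.source ⊆ ball 0 r ∧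
      ContDiffOn ℝ ∞ e e.source ∧ ContDiffOn ℝ ∞ e.symm e.target ∧
      ∀ y ∈ e.source, y ∈ S ↔ e y ∈ h.tangentSpace := by
  obtain ⟨π, hπ⟩ := Submodule.ClosedComplemented.of_finiteDimensional h.tangentSpace
  obtain ⟨ρ₁, hρ₁, hρ₁r, hlip₁⟩ := h.exists_norm_sub_le_two_mul π hπ
  obtain ⟨ρ₂, hρ₂, hρ₂r, hdiv₂⟩ := h.exists_norm_sub_div_le one_pos
  obtain ⟨ρ₃, hρ₃, hρ₃r, hunit₃⟩ := h.exists_isUnit_projLeftDeriv π hπ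
  set ρ := min ρ₁ (min ρ₂ ρ₃) with hρdef
  have hρ : 0 < ρ := by positivity
  have hle₁ : ρ ≤ ρ₁ := min_le_left _ _
  have hle₂ : ρ ≤ ρ₂ := (min_le_right _ _).trans (min_le_left _ _)
  have hle₃ : ρ ≤ ρ₃ := (min_le_right _ _).trans (min_le_right _ _)
  have hρr : ρ ≤ r := hle₁.trans hρ₁r
  have hlip : ∀ s ∈ S, ∀ t ∈ S, ‖s‖ < ρ → ‖t‖ < ρ → ‖t - s‖ ≤ 2 * ‖π (t - s)‖ :=
    fun s hs t ht h1 h2 => hlip₁ s hs t ht (h1.trans_le hle₁) (h2.trans_le hle₁)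
  obtain ⟨ρ', hρ', hex⟩ := h.exists_mem_proj_eq π hπ hρ hlip
  choose! σ hσS hσρ hσπ using hex
  have huniq : ∀ s ∈ S, ‖s‖ < ρ → ‖π s‖ < ρ' → s = σ (π s) := fun s hs h1 h2 => by
    have h3 := hlip _ (hσS _ h2) s hs (hσρ _ h2) h1
    rw [map_sub, hσπ _ h2, sub_self, norm_zero, MulZeroClass.mul_zero] at h3
    exact sub_eq_zero.1 (norm_le_zero_iff.1 h3)
  have hσev : ∀ x ∈ ball (0 : h.tangentSpace) ρ', ∀ᶠ y in 𝓝 x,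
      σ y ∈ S ∧ ‖σ y‖ < ρ ∧ π (σ y) = y ∧ ‖σ y - σ x‖ ≤ 2 * ‖y - x‖ := fun x hx => by
    filter_upwards [isOpen_ball.mem_nhds hx] with y hy
    rw [mem_ball_zero_iff] at hx hy
    refine ⟨hσS y hy, hσρ y hy, hσπ y hy, ?_⟩
    have := hlip _ (hσS x hx) _ (hσS y hy) (hσρ x hx) (hσρ y hy)
    rwa [map_sub, hσπ x hx, hσπ y hy] at this
  have hunit : ∀ x ∈ ball (0 : h.tangentSpace) ρ', IsUnit (h.projLeftDeriv π (σ x)) :=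
    fun x hx => hunit₃ _ ((hσρ x (by simpa using hx)).trans_le hle₃)
  have hder : ∀ x ∈ ball (0 : h.tangentSpace) ρ', HasFDerivAt σ (h.graphDeriv π (σ x)) x :=
    fun x hx => h.hasFDerivAt_graph π hπ hρr
      (fun a b ha hb => (hdiv₂ a b (ha.trans_le hle₂) (hb.trans_le hle₂)).2) (hσev x hx) (hunit x hx)
  -- Bootstrap: the derivative of `σ` is `graphDeriv` composed with `σ`, so `σ` of class `C^n` is of
  -- class `C^(n+1)`.
  have hsmooth : ContDiffOn ℝ ∞ σ (ball 0 ρ') := by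
    rw [contDiffOn_infty]
    intro n
    induction n with
    | zero =>
      exact contDiffOn_zero.2 fun x hx => (hder x hx).continuousAt.continuousWithinAt
    | succ n ih =>
      push_cast
      rw [contDiffOn_succ_iff_fderiv_of_isOpen isOpen_ball]
      refine ⟨fun x hx => (hder x hx).differentiableAt.differentiableWithinAt, by simp, ?_⟩
      have h1 : ContDiffOn ℝ n (fun x => h.graphDeriv π (σ x)) (ball 0 ρ') := fun x hx =>
        ((h.contDiffAt_graphDeriv π (by simpa using (hσρ x (by simpa using hx)).trans_le hρr)
          (hunit x hx)).of_le (by exact_mod_cast le_top)).comp_contDiffWithinAt x (ih x hx)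
      exact h1.congr fun x hx => (hder x hx).fderiv
  set U : Set E := {y | ‖π y‖ < ρ'} with hU
  have hUo : IsOpen U := isOpen_lt (by fun_prop) continuous_const
  have hmU : MapsTo π U (ball 0 ρ') := fun y hy => mem_ball_zero_iff.2 hy
  have hσU : ContDiffOn ℝ ∞ (fun y => σ (π y) - (π y : E)) U :=
    (hsmooth.comp π.contDiff.contDiffOn hmU).sub
      (h.tangentSpace.subtypeL.contDiff.comp π.contDiff).contDiffOn
  have hπ0 : ∀ y ∈ U, π (σ (π y) - (π y : E)) = 0 := fun y hy => by
    rw [map_sub, hσπ _ hy, hπ, sub_self]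
  have hsub : ∀ y ∈ U, π (y - (σ (π y) - (π y : E))) = π y := fun y hy => by
    rw [map_sub, hπ0 y hy, sub_zero]
  have hadd : ∀ y ∈ U, π (y + (σ (π y) - (π y : E))) = π y := fun y hy => by
    rw [map_add, hπ0 y hy, add_zero]
  have hcsub : ContDiffOn ℝ ∞ (fun y => y - (σ (π y) - (π y : E))) U := contDiffOn_id.sub hσU
  have hcadd : ContDiffOn ℝ ∞ (fun y => y + (σ (π y) - (π y : E))) U := contDiffOn_id.add hσU
  -- A shear along the kernel of `π`, carrying the graph of `S` to the tangent space. It does not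
  -- change `π y`, so adding the same displacement back inverts it.
  let e₀ : OpenPartialHomeomorph E E :=
    { toFun := fun y => y - (σ (π y) - (π y : E))
      invFun := fun y => y + (σ (π y) - (π y : E))
      source := U
      target := U
      map_source' := fun y hy => by
        change ‖π _‖ < ρ'
        rw [hsub y hy]; exact hy
      map_target' := fun y hy => by
        change ‖π _‖ < ρ'
        rw [hadd y hy]; exact hy
      left_inv' := fun y hy => by
        simp only [hsub y hy, sub_add_cancel]
      right_inv' := fun y hy => by
        simp only [hadd y hy, add_sub_cancel_right]
      open_source := hUo
      open_target := hUo
      continuousOn_toFun := hcsub.continuousOn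
      continuousOn_invFun := hcadd.continuousOn }
  refine ⟨e₀.restrOpen (ball 0 ρ) isOpen_ball, ?_, ?_, ?_, ?_, ?_⟩
  · exact ⟨by simpa [e₀, hU] using hρ', by simpa using hρ⟩
  · exact fun y hy => ball_subset_ball hρr hy.2
  · exact hcsub.mono fun y hy => hy.1
  · exact hcadd.mono fun y hy => hy.1
  · rintro y ⟨hyU, hyρ⟩
    rw [mem_ball_zero_iff] at hyρ
    change y ∈ S ↔ y - (σ (π y) - (π y : E)) ∈ h.tangentSpace
    constructor
    · intro hy
      rw [← huniq y hy hyρ hyU, sub_sub_cancel]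
      exact (π y).2
    · intro hy
      have h1 : π y = y - (σ (π y) - (π y : E)) := by
        have := congrArg Subtype.val (hπ ⟨_, hy⟩)
        rwa [hsub y hyU] at this
      have h2 : y = σ (π y) := by
        rw [sub_sub_eq_add_sub, eq_sub_iff_add_eq, add_comm y] at h1
        exact (add_left_cancel h1).symm
      rw [h2]
      exact hσS _ hyU

end IsLocalSubgroup

end LocalSubgroup

/-! ### Embedded submanifolds and closed subgroups of Lie groups -/

section Charts

variable {E X : Type*} [NormedAddCommGroup E] [NormedSpace ℝ E] [TopologicalSpace X]
  [ChartedSpace E X] [IsManifold 𝓘(ℝ, E) ∞ X]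

/-- Composing a chart of the maximal atlas with a local diffeomorphism of the model space. -/
theorem IsManifold.trans_mem_maximalAtlas {ψ : OpenPartialHomeomorph X E}
    (hψ : ψ ∈ IsManifold.maximalAtlas 𝓘(ℝ, E) ∞ X) {e : OpenPartialHomeomorph E E}
    (he : ContDiffOn ℝ ∞ e e.source) (he' : ContDiffOn ℝ ∞ e.symm e.target) :
    ψ.trans e ∈ IsManifold.maximalAtlas 𝓘(ℝ, E) ∞ X := by
  refine OpenPartialHomeomorph.mem_maximalAtlas_of_contMDiffOn _ ?_ ?_
  · rw [ψ.trans_source]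
    exact (contMDiffOn_iff_contDiffOn.2 he).comp
      ((contMDiffOn_of_mem_maximalAtlas hψ).mono inter_subset_left) fun y hy => hy.2
  · rw [ψ.trans_target]
    exact (contMDiffOn_symm_of_mem_maximalAtlas hψ).comp
      ((contMDiffOn_iff_contDiffOn.2 he').mono inter_subset_left) fun y hy => hy.2

/-- Composing a diffeomorphism with a chart of the maximal atlas. -/
theorem IsManifold.homeomorph_trans_mem_maximalAtlas {ψ : OpenPartialHomeomorph X E}
    (hψ : ψ ∈ IsManifold.maximalAtlas 𝓘(ℝ, E) ∞ X) (Φ : X ≃ₜ X)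
    (hΦ : ContMDiff 𝓘(ℝ, E) 𝓘(ℝ, E) ∞ Φ) (hΦ' : ContMDiff 𝓘(ℝ, E) 𝓘(ℝ, E) ∞ Φ.symm) :
    Φ.toOpenPartialHomeomorph.trans ψ ∈ IsManifold.maximalAtlas 𝓘(ℝ, E) ∞ X := by
  refine OpenPartialHomeomorph.mem_maximalAtlas_of_contMDiffOn _ ?_ ?_
  · exact (contMDiffOn_of_mem_maximalAtlas hψ).comp hΦ.contMDiffOn fun y hy => hy.2
  · exact hΦ'.comp_contMDiffOn
      ((contMDiffOn_symm_of_mem_maximalAtlas hψ).mono fun y hy => hy.1)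

/-- Every point is the origin of some chart. -/
theorem IsManifold.exists_centered_chart (E : Type*) [NormedAddCommGroup E] [NormedSpace ℝ E]
    {X : Type*} [TopologicalSpace X] [ChartedSpace E X] [IsManifold 𝓘(ℝ, E) ∞ X] (x : X) :
    ∃ ψ ∈ IsManifold.maximalAtlas 𝓘(ℝ, E) ∞ X, x ∈ ψ.source ∧ ψ x = 0 := by
  let t := Homeomorph.addRight (-(chartAt E x x))
  refine ⟨(chartAt E x).trans t.toOpenPartialHomeomorph,
    IsManifold.trans_mem_maximalAtlas (IsManifold.chart_mem_maximalAtlas x) ?_ ?_, ?_, ?_⟩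
  · exact (contDiff_id.add contDiff_const).contDiffOn
  · exact (contDiff_id.add (contDiff_const (c := -(-(chartAt E x x))))).contDiffOn
  · simp
  · change chartAt E x x + -(chartAt E x x) = 0
    exact add_neg_cancel _

end Charts

section Submanifold

variable {E : Type} {X : Type*} [NormedAddCommGroup E] [NormedSpace ℝ E]
  [TopologicalSpace X] {T : X → Prop}

/-- The chart of a subset induced by a chart of the ambient space which straightens the subset. -/
noncomputable def sliceChart (h : Submodule ℝ E) (π : E →L[ℝ] h) (hπ : ∀ v : h, π v = v)
    (ψ : OpenPartialHomeomorph X E) (hT : ∀ y ∈ ψ.source, T y ↔ ψ y ∈ h) (x : Subtype T) :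
    OpenPartialHomeomorph (Subtype T) h := by
  classical
  exact
  { toFun := fun y => π (ψ y)
    -- The default `x` only occurs outside the target, where its value is irrelevant.
    invFun := fun z => if hz : T (ψ.symm z) then ⟨ψ.symm z, hz⟩ else x
    source := Subtype.val ⁻¹' ψ.source
    target := Subtype.val ⁻¹' ψ.target
    map_source' := fun y hy => by
      have h1 := (hT y hy).1 y.2
      have h2 : (π (ψ y) : E) = ψ y := congrArg Subtype.val (hπ ⟨_, h1⟩)
      simpa only [mem_preimage, h2] using ψ.map_source hy
    map_target' := fun z hz => by
      have h1 : T (ψ.symm z) := (hT _ (ψ.map_target hz)).2 (by rw [ψ.right_inv hz]; exact z.2)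
      simpa only [mem_preimage, dif_pos h1] using ψ.map_target hz
    left_inv' := fun y hy => by
      have h1 := (hT y hy).1 y.2
      have h2 : (π (ψ y) : E) = ψ y := congrArg Subtype.val (hπ ⟨_, h1⟩)
      have h3 : ψ.symm (π (ψ y) : E) = y := by rw [h2, ψ.left_inv hy]
      have h4 : T (ψ.symm (π (ψ y) : E)) := by rw [h3]; exact y.2
      rw [dif_pos h4]
      exact Subtype.ext h3
    right_inv' := fun z hz => by
      have h1 : T (ψ.symm z) := (hT _ (ψ.map_target hz)).2 (by rw [ψ.right_inv hz]; exact z.2)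
      rw [dif_pos h1]
      change π (ψ (ψ.symm z)) = z
      rw [ψ.right_inv hz, hπ]
    open_source := ψ.open_source.preimage continuous_subtype_val
    open_target := ψ.open_target.preimage continuous_subtype_val
    continuousOn_toFun := π.continuous.comp_continuousOn
      (ψ.continuousOn.comp continuous_subtype_val.continuousOn fun y hy => hy)
    continuousOn_invFun := by
      rw [(IsInducing.mk rfl : IsInducing (Subtype.val : Subtype T → X)).continuousOn_iff]
      refine (ψ.continuousOn_symm.comp continuous_subtype_val.continuousOn
        fun z hz => hz).congr fun z hz => ?_
      have h1 : T (ψ.symm z) := (hT _ (ψ.map_target hz)).2 (by rw [ψ.right_inv hz]; exact z.2)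
      simp only [Function.comp_apply, dif_pos h1] }

theorem sliceChart_apply (h : Submodule ℝ E) (π : E →L[ℝ] h) (hπ : ∀ v : h, π v = v)
    (ψ : OpenPartialHomeomorph X E) (hT : ∀ y ∈ ψ.source, T y ↔ ψ y ∈ h) (x y : Subtype T) :
    sliceChart h π hπ ψ hT x y = π (ψ y) := rfl

theorem coe_sliceChart_symm (h : Submodule ℝ E) (π : E →L[ℝ] h) (hπ : ∀ v : h, π v = v)
    (ψ : OpenPartialHomeomorph X E) (hT : ∀ y ∈ ψ.source, T y ↔ ψ y ∈ h) (x : Subtype T) (z : h)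
    (hz : (z : E) ∈ ψ.target) :
    ((sliceChart h π hπ ψ hT x).symm z : X) = ψ.symm z := by
  have h1 : T (ψ.symm z) := (hT _ (ψ.map_target hz)).2 (by rw [ψ.right_inv hz]; exact z.2)
  simp only [sliceChart, OpenPartialHomeomorph.coe_mk_symm, PartialEquiv.coe_symm_mk, dif_pos h1]

/-- A subset which is straightened to a fixed linear subspace by suitable charts is an embedded
submanifold. -/
theorem exists_isSmoothEmbedding_of_slices (S : ManifoldStr X) (T : X → Prop)
    (h : Submodule ℝ S.E)
    (hT : ∀ x, T x → ∃ ψ ∈ IsManifold.maximalAtlas S.I ∞ X, x ∈ ψ.source ∧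
      ∀ y ∈ ψ.source, T y ↔ ψ y ∈ h) :
    ∃ ST : ManifoldStr (Subtype T), Manifold.IsSmoothEmbedding ST.I S.I ∞ (Subtype.val : Subtype T → X) := by
  have hT' := fun x : Subtype T => hT x x.2
  choose ψ hψm hψx hψT using hT'
  obtain ⟨π, hπ⟩ := Submodule.ClosedComplemented.of_finiteDimensional h
  have hind : IsInducing (Subtype.val : Subtype T → X) := ⟨rfl⟩
  have := S.t2Space
  have := S.secondCountable
  let e : Subtype T → OpenPartialHomeomorph (Subtype T) h := fun x => sliceChart h π hπ (ψ x) (hψT x) x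
  have hes : ∀ x : Subtype T, x ∈ (e x).source := fun x => hψx x
  let ST : ManifoldStr (Subtype T) := ManifoldStr.ofCharts h e hes (fun x y => by
    have h1 : ContDiffOn ℝ ∞ (fun z => ψ y ((ψ x).symm z))
        ((ψ x).target ∩ (ψ x).symm ⁻¹' (ψ y).source) := by
      rw [← contMDiffOn_iff_contDiffOn]
      exact (contMDiffOn_of_mem_maximalAtlas (hψm y)).comp
        ((contMDiffOn_symm_of_mem_maximalAtlas (hψm x)).mono inter_subset_left)
        fun z hz => hz.2
    have h2 : ∀ z ∈ (e x).target ∩ (e x).symm ⁻¹' (e y).source,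
        (ψ x).symm (z : S.E) ∈ (ψ y).source := fun z hz => by
      have := hz.2
      change ((e x).symm z : X) ∈ (ψ y).source at this
      rwa [coe_sliceChart_symm _ _ _ _ _ _ _ hz.1] at this
    refine (π.contDiff.comp_contDiffOn (h1.comp h.subtypeL.contDiff.contDiffOn
      fun z hz => ⟨hz.1, h2 z hz⟩)).congr fun z hz => ?_
    simp only [e, sliceChart_apply, coe_sliceChart_symm _ _ _ _ _ _ _ hz.1]
    rfl) inferInstance hind.secondCountableTopology
  -- In the slice charts the inclusion is that of `h` into `h × q`, with the same `q` at all points.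
  obtain ⟨q, hq⟩ := Submodule.exists_isCompl h
  have key : Manifold.IsImmersionOfComplement q ST.I S.I ∞ (Subtype.val : Subtype T → X) := by
    intro x
    have hxc : e x ∈ IsManifold.maximalAtlas ST.I ∞ (Subtype T) :=
      IsManifold.chart_mem_maximalAtlas (H := ST.E) x
    refine Manifold.IsImmersionAtOfComplement.mk_of_continuousAt
      continuous_subtype_val.continuousAt
      (Submodule.prodEquivOfIsCompl h q hq).toContinuousLinearEquiv (e x) (ψ x) (hes x)
      (hψx x) hxc (hψm x) ?_
    intro (z : h) hz
    simp only [mfld_simps] at hz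
    have hz' : (z : S.E) ∈ (ψ x).target := hz
    have h1 : ψ x ((e x).symm z : X) = z := by
      rw [coe_sliceChart_symm _ _ _ _ _ _ _ hz', (ψ x).right_inv hz']
    have h2 : Submodule.prodEquivOfIsCompl h q hq (z, 0) = z := by simp
    exact h1.trans h2.symm
  exact ⟨ST, key.isImmersion, ⟨hind, Subtype.val_injective⟩⟩

end Submanifold

/-! ### The closed subgroup theorem -/

section ClosedSubgroup

open Metric

variable {G : Type*} [Group G] [TopologicalSpace G]

/-- A closed subgroup of a Lie group, read in a chart centered at the neutral element, is a local
subgroup. -/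
theorem exists_isLocalSubgroup (S : ManifoldStr G) [LieGroup S.I ∞ G] (H : Subgroup G)
    (hH : IsClosed (H : Set G)) {ψ : OpenPartialHomeomorph G S.E}
    (hψ : ψ ∈ IsManifold.maximalAtlas S.I ∞ G) (h1 : (1 : G) ∈ ψ.source) (h0 : ψ 1 = 0) :
    ∃ m d r, IsLocalSubgroup m d r (ψ.target ∩ ψ.symm ⁻¹' H) := by
  have : IsTopologicalGroup G := topologicalGroup_of_lieGroup S.I ∞
  have h0t : (0 : S.E) ∈ ψ.target := h0 ▸ ψ.map_source h1
  have hs0 : ψ.symm 0 = 1 := by rw [← h0, ψ.left_inv h1]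
  set m : S.E → S.E → S.E := fun x y => ψ (ψ.symm x * ψ.symm y) with hm
  set d : S.E → S.E → S.E := fun x y => ψ ((ψ.symm x)⁻¹ * ψ.symm y) with hd
  have hc1 : ContinuousAt (fun z : S.E × S.E => ψ.symm z.1) (0, 0) :=
    ContinuousAt.comp (g := ψ.symm) (f := Prod.fst) (ψ.continuousAt_symm h0t) continuousAt_fst
  have hc2 : ContinuousAt (fun z : S.E × S.E => ψ.symm z.2) (0, 0) :=
    ContinuousAt.comp (g := ψ.symm) (f := Prod.snd) (ψ.continuousAt_symm h0t) continuousAt_snd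
  have hev1 : ∀ᶠ z : S.E × S.E in 𝓝 (0, 0), ψ.symm z.1 * ψ.symm z.2 ∈ ψ.source :=
    (hc1.mul hc2).preimage_mem_nhds (ψ.open_source.mem_nhds (by simpa [hs0] using h1))
  have hcd : ContinuousAt (fun z : S.E × S.E => (ψ.symm z.1)⁻¹ * ψ.symm z.2) (0, 0) :=
    hc1.inv.mul hc2
  have hev2 : ∀ᶠ z : S.E × S.E in 𝓝 (0, 0), (ψ.symm z.1)⁻¹ * ψ.symm z.2 ∈ ψ.source :=
    hcd.preimage_mem_nhds (ψ.open_source.mem_nhds (by simpa [hs0] using h1))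
  have hev3 : ∀ᶠ z : S.E × S.E in 𝓝 (0, 0), z.1 ∈ ψ.target :=
    continuousAt_fst.preimage_mem_nhds (ψ.open_target.mem_nhds h0t)
  obtain ⟨r, hr, hev⟩ := Metric.eventually_nhds_iff.1 (hev1.and (hev2.and hev3))
  have hball : ∀ x ∈ ball (0 : S.E) r, ∀ y ∈ ball (0 : S.E) r, ψ.symm x * ψ.symm y ∈ ψ.source ∧
      (ψ.symm x)⁻¹ * ψ.symm y ∈ ψ.source ∧ x ∈ ψ.target := fun x hx y hy =>
    @hev (x, y) (by
      rw [Prod.dist_eq]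
      exact max_lt hx hy)
  have h0b : (0 : S.E) ∈ ball (0 : S.E) r := mem_ball_self hr
  have ht : ∀ x ∈ ball (0 : S.E) r, x ∈ ψ.target := fun x hx => (hball x hx x hx).2.2
  refine ⟨m, d, r, ⟨hr, ?_, ?_, ?_, ?_, ?_, ?_, ?_, ?_, ?_⟩⟩
  · rw [← contMDiffOn_iff_contDiffOn]
    have h2 : ContMDiffOn 𝓘(ℝ, S.E × S.E) S.I ∞ (fun z : S.E × S.E => ψ.symm z.1 * ψ.symm z.2)
        (ball 0 r ×ˢ ball 0 r) := by
      have h3 := contMDiffOn_symm_of_mem_maximalAtlas hψ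
      exact (h3.comp contDiff_fst.contMDiff.contMDiffOn fun z hz => ht _ hz.1).mul
        (h3.comp contDiff_snd.contMDiff.contMDiffOn fun z hz => ht _ hz.2)
    exact (contMDiffOn_of_mem_maximalAtlas hψ).comp h2 fun z hz => (hball _ hz.1 _ hz.2).1
  · intro x hx
    simp only [hm, hs0, mul_one, ψ.right_inv (ht x hx)]
  · intro x hx
    simp only [hm, hs0, one_mul, ψ.right_inv (ht x hx)]
  · intro x hx y hy
    simp only [hm, hd, ψ.left_inv (hball x hx y hy).2.1, mul_inv_cancel_left,
      ψ.right_inv (ht y hy)]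
  · have h2 : ContinuousAt (fun z : S.E × S.E => d z.1 z.2) (0, 0) :=
      ContinuousAt.comp (g := ψ) (ψ.continuousAt (by simpa [hs0] using h1)) hcd
    have h3 : d 0 0 = 0 := by simp only [hd, inv_mul_cancel, h0]
    simpa only [h3] using h2.tendsto
  · exact ⟨h0t, by simp [hs0]⟩
  · intro x hx y hy
    have h2 := (hball x hx.2 y hy.2).1
    refine ⟨ψ.map_source h2, ?_⟩
    simp only [mem_preimage, hm, ψ.left_inv h2]
    exact H.mul_mem hx.1.2 hy.1.2
  · intro x hx y hy
    have h2 := (hball x hx.2 y hy.2).2.1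
    refine ⟨ψ.map_source h2, ?_⟩
    simp only [mem_preimage, hd, ψ.left_inv h2]
    exact H.mul_mem (H.inv_mem hx.1.2) hy.1.2
  · intro x hx hxc
    refine ⟨ht x hx, ?_⟩
    have h2 := (ψ.continuousAt_symm (ht x hx)).continuousWithinAt.mem_closure hxc
      (t := H) (fun y hy => hy.2)
    rwa [hH.closure_eq] at h2

/-- The closed subgroup theorem: a closed subgroup of a Lie group is an embedded submanifold. -/
theorem exists_isSmoothEmbedding_subgroup (S : ManifoldStr G) (hG : LieGroup S.I ∞ G)
    (H : Subgroup G) (hH : IsClosed (H : Set G)) :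
    ∃ SH : ManifoldStr H, Manifold.IsSmoothEmbedding SH.I S.I ∞ (Subtype.val : H → G) := by
  have : IsTopologicalGroup G := topologicalGroup_of_lieGroup S.I ∞
  obtain ⟨ψ, hψ, h1, h0⟩ := IsManifold.exists_centered_chart S.E (1 : G)
  obtain ⟨m, d, r, hloc⟩ := exists_isLocalSubgroup S H hH hψ h1 h0
  obtain ⟨e, he0, -, hes, hes', heS⟩ := hloc.exists_straightening
  refine exists_isSmoothEmbedding_of_slices S (· ∈ H) hloc.tangentSpace fun x hx => ?_
  -- Left translation by `x⁻¹` preserves `H` and takes `x` to `1`, so the straightening chart at `1`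
  -- yields one at every point of `H`, with the same subspace.
  refine ⟨(Homeomorph.mulLeft x⁻¹).toOpenPartialHomeomorph.trans (ψ.trans e),
    IsManifold.homeomorph_trans_mem_maximalAtlas
      (IsManifold.trans_mem_maximalAtlas hψ hes hes') _ contMDiff_mul_left
      (by exact contMDiff_mul_left (a := x⁻¹⁻¹)), ?_, ?_⟩
  · simp [h1, h0, he0]
  · intro y hy
    have hy' : x⁻¹ * y ∈ ψ.source ∧ ψ (x⁻¹ * y) ∈ e.source := by simpa using hy
    have h2 := heS _ hy'.2
    change y ∈ H ↔ e (ψ (x⁻¹ * y)) ∈ _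
    rw [← h2]
    simp only [mem_inter_iff, mem_preimage, ψ.left_inv hy'.1, ψ.map_source hy'.1, true_and,
      SetLike.mem_coe]
    exact (H.mul_mem_cancel_left (H.inv_mem hx)).symm

/-- An embedded subgroup of a Lie group is a Lie group. -/
theorem lieGroup_of_isSmoothEmbedding (S : ManifoldStr G) (hG : LieGroup S.I ∞ G)
    (H : Subgroup G) (SH : ManifoldStr H)
    (hH : Manifold.IsSmoothEmbedding SH.I S.I ∞ (Subtype.val : H → G)) : LieGroup SH.I ∞ H := by
  have : IsTopologicalGroup G := topologicalGroup_of_lieGroup S.I ∞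
  have hval := hH.contMDiff
  exact
    { contMDiff_mul := (ContMDiff.iff_comp_isImmersion hH.isImmersion).2
        ⟨continuous_mul, (hval.comp contMDiff_fst).mul (hval.comp contMDiff_snd)⟩
      contMDiff_inv := (ContMDiff.iff_comp_isImmersion hH.isImmersion).2
        ⟨continuous_inv, hval.inv⟩ }

end ClosedSubgroup

/-! ### Free actions are infinitesimally free -/

namespace RightAction

section Derivative

variable {G P : Type*} [Group G] [TopologicalSpace G] [TopologicalSpace P]
  {SP : ManifoldStr P} {SG : ManifoldStr G} {ρ : RightAction G P}

theorem IsSmooth.act_const (h : ρ.IsSmooth SP SG) (g : G) :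
    ContMDiff SP.I SP.I ∞ fun x => ρ.act x g :=
  ContMDiff.comp (g := fun x : P × G => ρ.act x.1 x.2) h (contMDiff_id.prodMk contMDiff_const)

theorem IsSmooth.const_act (h : ρ.IsSmooth SP SG) (x : P) :
    ContMDiff SG.I SP.I ∞ fun g => ρ.act x g :=
  ContMDiff.comp (g := fun x : P × G => ρ.act x.1 x.2) h (contMDiff_const.prodMk contMDiff_id)

theorem IsSmooth.continuous (h : ρ.IsSmooth SP SG) :
    Continuous fun x : P × G => ρ.act x.1 x.2 :=
  ContMDiff.continuous h

/-- A curve with vanishing derivatives is locally constant. -/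
theorem eventually_eq_of_hasMFDerivAt_zero {E M : Type*} [NormedAddCommGroup E] [NormedSpace ℝ E]
    [TopologicalSpace M] [ChartedSpace E M] [IsManifold 𝓘(ℝ, E) ∞ M] {c : ℝ → M} {t₀ : ℝ}
    (hc : ∀ᶠ t in 𝓝 t₀, HasMFDerivAt 𝓘(ℝ, ℝ) 𝓘(ℝ, E) c t (0 : ℝ →L[ℝ] E)) :
    ∀ᶠ t in 𝓝 t₀, c t = c t₀ := by
  set ψ := chartAt E (c t₀) with hψ
  have hcont : ContinuousAt c t₀ := hc.self_of_nhds.continuousAt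
  have h1 : ∀ᶠ t in 𝓝 t₀, c t ∈ ψ.source :=
    hcont.preimage_mem_nhds (ψ.open_source.mem_nhds (mem_chart_source E (c t₀)))
  obtain ⟨ε, hε, h2⟩ := Metric.eventually_nhds_iff_ball.1 (hc.and h1)
  have hd : ∀ t ∈ Metric.ball t₀ ε, HasFDerivAt (fun t => ψ (c t)) (0 : ℝ →L[ℝ] E) t := by
    intro t ht
    have h3 : ContMDiffAt 𝓘(ℝ, E) 𝓘(ℝ, E) ∞ ψ (c t) :=
      contMDiffAt_of_mem_maximalAtlas (IsManifold.chart_mem_maximalAtlas (c t₀)) (h2 t ht).2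
    have h4 := HasMFDerivAt.comp t (h3.mdifferentiableAt (by simp)).hasMFDerivAt (h2 t ht).1
    have h5 := h4.hasFDerivAt
    refine h5.congr_fderiv ?_
    exact ContinuousLinearMap.comp_zero _
  filter_upwards [Metric.ball_mem_nhds t₀ hε] with t ht
  have h3 : ψ (c t) = ψ (c t₀) :=
    (convex_ball t₀ ε).is_const_of_fderivWithin_eq_zero (𝕜 := ℝ) (f := fun t => ψ (c t))
      (fun s hs => (hd s hs).differentiableAt.differentiableWithinAt)
      (fun s hs => by
        rw [fderivWithin_of_isOpen Metric.isOpen_ball hs]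
        exact (hd s hs).fderiv) ht (Metric.mem_ball_self hε)
  exact ψ.injOn (h2 t ht).2 (h2 t₀ (Metric.mem_ball_self hε)).2 h3

/-- For `k g = p g⁻¹` one has `k (g h) = (k h) g⁻¹`. So if `w` is killed by the differential of `k`
at `1`, the left-invariant field of `w` is killed everywhere. Then `k` is constant along its
integral curve through `1`, the curve is constant by freeness, and `w = 0`. The inverse in `k` makes
left-invariant fields fit a right action. -/
theorem mfderiv_act_inv_injective (hG : LieGroup SG.I ∞ G) (hs : ρ.IsSmooth SP SG)
    (hf : ρ.IsFree) (p : P) (w : SG.E)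
    (hw : (mfderiv SG.I SP.I (fun g => ρ.act p g⁻¹) (1 : G) : SG.E →L[ℝ] SP.E) w = 0) :
    w = 0 := by
  have hlg : LieGroup SG.I (minSmoothness ℝ 3) G := by
    rw [minSmoothness_of_isRCLikeNormedField]
    exact LieGroup.of_le (n := ∞) (WithTop.coe_le_coe.2 le_top : ((3 : ℕ∞) : ℕ∞ω) ≤ ∞)
  have : CompleteSpace SG.E := FiniteDimensional.complete ℝ _
  have : IsManifold SG.I 1 G := IsManifold.of_le (n := ∞) (by exact_mod_cast le_top)
  have := SG.t2Space
  set k : G → P := fun g => ρ.act p g⁻¹ with hk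
  have hks : ContMDiff SG.I SP.I ∞ k := (hs.const_act p).comp (contMDiff_inv SG.I ∞)
  have hkd : ∀ g, HasMFDerivAt SG.I SP.I k g (mfderiv SG.I SP.I k g) := fun g =>
    ((hks g).mdifferentiableAt (by simp)).hasMFDerivAt
  let V : (g : G) → TangentSpace SG.I g := mulInvariantVectorField (I := SG.I) (G := G) w
  have hV : ContMDiffAt SG.I SG.I.tangent 1
      (fun g : G => (⟨g, V g⟩ : TangentBundle SG.I G)) 1 := by
    have := contMDiffAt_mulInvariantVectorField (I := SG.I) (G := G) w (g := 1)
    exact this.of_le (by rw [minSmoothness_of_isRCLikeNormedField]; norm_num)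
  have hmulL : ∀ g : G, HasMFDerivAt SG.I SG.I (fun h : G => g * h) 1
      (mfderiv SG.I SG.I (fun h : G => g * h) 1) := fun g =>
    ((contMDiff_mul_left (I := SG.I) (n := ∞) (a := g) 1).mdifferentiableAt
      (by simp)).hasMFDerivAt
  have hcongr : ∀ a b : G, a = b → ∀ u : SG.E,
      (mfderiv SG.I SP.I k a : SG.E →L[ℝ] SP.E) u = 0 →
      (mfderiv SG.I SP.I k b : SG.E →L[ℝ] SP.E) u = 0 := by
    rintro a _ rfl u h
    exact h
  have hkV : ∀ g, (mfderiv SG.I SP.I k g : SG.E →L[ℝ] SP.E) (V g) = 0 := by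
    intro g
    refine hcongr (g * 1) g (mul_one g) _ ?_
    have h1 := HasMFDerivAt.comp (1 : G) (hkd (g * 1)) (hmulL g)
    have h2 : k ∘ (fun h : G => g * h) = (fun x => ρ.act x g⁻¹) ∘ k := by
      funext h
      simp [hk, ← ρ.act_mul]
    have h3 := HasMFDerivAt.comp (1 : G)
      (((hs.act_const g⁻¹) (k 1)).mdifferentiableAt (by simp)).hasMFDerivAt (hkd 1)
    rw [← h2] at h3
    have h4 := hasMFDerivAt_unique h1 h3
    have h5 := DFunLike.congr_fun h4 w
    refine h5.trans ?_
    have h6 : ∀ (L : SP.E →L[ℝ] SP.E) (u : SP.E), u = 0 → L u = 0 := fun L u hu => by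
      rw [hu, map_zero]
    exact h6 _ _ hw
  obtain ⟨γ, hγ0, hγ⟩ := exists_isMIntegralCurveAt_of_contMDiffAt_boundaryless (I := SG.I) 0 hV
  have hc : ∀ᶠ t in 𝓝 (0 : ℝ), HasMFDerivAt 𝓘(ℝ, ℝ) SP.I (k ∘ γ) t (0 : ℝ →L[ℝ] SP.E) := by
    filter_upwards [hγ] with t ht
    have h1 := HasMFDerivAt.comp t (hkd (γ t)) ht
    have h2 : ((mfderiv SG.I SP.I k (γ t) : SG.E →L[ℝ] SP.E).comp
        ((1 : ℝ →L[ℝ] ℝ).smulRight (V (γ t) : SG.E))) = 0 := by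
      ext
      simp only [ContinuousLinearMap.comp_apply, ContinuousLinearMap.smulRight_apply,
        one_apply_eq_self, one_smul, zero_apply]
      exact hkV (γ t)
    have h3 : ∀ L : ℝ →L[ℝ] SP.E, L = 0 → HasMFDerivAt 𝓘(ℝ, ℝ) SP.I (k ∘ γ) t L →
        HasMFDerivAt 𝓘(ℝ, ℝ) SP.I (k ∘ γ) t (0 : ℝ →L[ℝ] SP.E) := by
      rintro _ rfl h
      exact h
    exact h3 _ h2 h1
  have hγ1 : ∀ᶠ t in 𝓝 (0 : ℝ), γ t = 1 := by
    filter_upwards [eventually_eq_of_hasMFDerivAt_zero hc] with t ht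
    have h1 : ρ.act p (γ t)⁻¹ = p := by
      have : ρ.act p (γ t)⁻¹ = ρ.act p (γ 0)⁻¹ := ht
      rw [this, hγ0, inv_one, ρ.act_one]
    exact inv_eq_one.1 (hf p _ h1)
  have h1 := hγ.hasMFDerivAt
  have h2 : HasMFDerivAt 𝓘(ℝ, ℝ) SG.I γ 0 (0 : ℝ →L[ℝ] SG.E) :=
    (hasMFDerivAt_const (1 : G) (0 : ℝ)).congr_of_eventuallyEq hγ1
  have h3 := DFunLike.congr_fun (hasMFDerivAt_unique h1 h2) (1 : ℝ)
  have h4 : (V (γ 0) : SG.E) = 0 := by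
    have h5 : ∀ u : SG.E, ((1 : ℝ →L[ℝ] ℝ).smulRight u) 1 = u := fun u => by simp
    exact (h5 (V (γ 0))).symm.trans h3
  have h5 : ∀ g : G, g = 1 → (V g : SG.E) = w := by
    rintro _ rfl
    have h6 : HasMFDerivAt SG.I SG.I (fun h : G => 1 * h) 1 (ContinuousLinearMap.id ℝ SG.E) := by
      have : (fun h : G => 1 * h) = id := by funext h; simp
      rw [this]
      exact hasMFDerivAt_id 1
    exact DFunLike.congr_fun (hasMFDerivAt_unique (hmulL 1) h6) w
  exact (h5 _ hγ0).symm.trans h4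

/-- The differential of an orbit map of a free action is injective. -/
theorem mfderiv_act_injective (hG : LieGroup SG.I ∞ G) (hs : ρ.IsSmooth SP SG)
    (hf : ρ.IsFree) (p : P) (v : SG.E)
    (hv : (mfderiv SG.I SP.I (fun g => ρ.act p g) (1 : G) : SG.E →L[ℝ] SP.E) v = 0) :
    v = 0 := by
  -- The orbit map is `g ↦ p g⁻¹` composed with the inversion, whose differential is injective
  -- because it is an involution.
  set i : G → G := fun g => g⁻¹ with hi
  have his : ContMDiff SG.I SG.I ∞ i := contMDiff_inv SG.I ∞
  have hid : ∀ g, HasMFDerivAt SG.I SG.I i g (mfderiv SG.I SG.I i g) := fun g =>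
    ((his g).mdifferentiableAt (by simp)).hasMFDerivAt
  have hks : ContMDiff SG.I SP.I ∞ fun g => ρ.act p g⁻¹ := (hs.const_act p).comp his
  have hcongr : ∀ a b : G, a = b → ∀ u : SG.E,
      (mfderiv SG.I SP.I (fun g => ρ.act p g⁻¹) a : SG.E →L[ℝ] SP.E) u = 0 →
      (mfderiv SG.I SP.I (fun g => ρ.act p g⁻¹) b : SG.E →L[ℝ] SP.E) u = 0 := by
    rintro a _ rfl u h
    exact h
  have h1 : (mfderiv SG.I SG.I i (1 : G) : SG.E →L[ℝ] SG.E) v = 0 := by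
    refine mfderiv_act_inv_injective hG hs hf p _ (hcongr (i 1) 1 inv_one _ ?_)
    have h2 := HasMFDerivAt.comp (1 : G)
      ((hks (i 1)).mdifferentiableAt (by simp)).hasMFDerivAt (hid 1)
    have h3 : (fun g => ρ.act p g⁻¹) ∘ i = fun g => ρ.act p g := by
      funext g
      simp [hi]
    rw [h3] at h2
    exact (DFunLike.congr_fun h2.mfderiv v).symm.trans hv
  have h2 := HasMFDerivAt.comp (1 : G) (hid (i 1)) (hid 1)
  have h3 : i ∘ i = id := by
    funext g
    simp [hi]
  rw [h3] at h2
  have h4 := DFunLike.congr_fun (hasMFDerivAt_unique (hasMFDerivAt_id (1 : G)) h2) v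
  refine h4.trans ?_
  have h5 : ∀ (L : SG.E →L[ℝ] SG.E) (u : SG.E), u = 0 → L u = 0 := fun L u hu => by
    rw [hu, map_zero]
  exact h5 (mfderiv SG.I SG.I i (i 1)) _ h1

end Derivative

end RightAction

/-! ### Slices of principal actions -/

namespace RightAction

section Proper

variable {G P : Type*} [Group G] [TopologicalSpace G] [TopologicalSpace P] {ρ : RightAction G P}

/-- For a proper action, the elements carrying a point near `x` to a point near `y` are close to
those carrying `x` to `y`. -/
theorem IsProper.eventually_mem [T2Space P] [LocallyCompactSpace P] (hp : ρ.IsProper)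
    (hc : Continuous fun z : P × G => ρ.act z.1 z.2) {x y : P} {W : Set G} (hW : IsOpen W)
    (h : ∀ g, ρ.act x g = y → g ∈ W) :
    ∀ᶠ z : P × P in 𝓝 (x, y), ∀ g, ρ.act z.1 g = z.2 → g ∈ W := by
  obtain ⟨K₁, hK₁, hx⟩ := exists_compact_mem_nhds x
  obtain ⟨K₂, hK₂, hy⟩ := exists_compact_mem_nhds y
  have hC := hp (K₁ ∪ K₂) (hK₁.union hK₂)
  set C := closure {g : G | ∃ x ∈ K₁ ∪ K₂, ρ.act x g ∈ K₁ ∪ K₂} with hCdef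
  -- On the compact set `C \ W` the open condition `x g ≠ y` persists for all nearby pairs
  -- simultaneously. Elements outside `C` cannot relate points of the compact neighbourhoods.
  have h1 : ∀ᶠ z : P × P in 𝓝 (x, y), ∀ g ∈ C \ W, ρ.act z.1 g ≠ z.2 := by
    refine (hC.diff hW).eventually_forall_of_forall_eventually fun g hg => ?_
    have h2 : ρ.act x g ≠ y := fun h3 => hg.2 (h g h3)
    have h3 : Continuous fun w : (P × P) × G => ρ.act w.1.1 w.2 :=
      hc.comp (continuous_fst.fst.prodMk continuous_snd)
    have h4 : IsOpen {w : (P × P) × G | ρ.act w.1.1 w.2 ≠ w.1.2} :=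
      isOpen_ne_fun h3 continuous_fst.snd
    exact h4.mem_nhds h2
  have h5 : ∀ᶠ z : P × P in 𝓝 (x, y), z.1 ∈ K₁ ∧ z.2 ∈ K₂ := prod_mem_nhds hx hy
  filter_upwards [h1, h5] with z hz hzK g hg
  by_contra hgW
  refine hz g ⟨subset_closure ⟨z.1, Or.inl hzK.1, ?_⟩, hgW⟩ hg
  rw [hg]
  exact Or.inr hzK.2

/-- The orbit relation of a proper action is closed. -/
theorem IsProper.isClosed_orbitRel [T2Space P] [LocallyCompactSpace P] (hp : ρ.IsProper)
    (hc : Continuous fun z : P × G => ρ.act z.1 z.2) :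
    IsClosed {z : P × P | ∃ g, ρ.act z.1 g = z.2} := by
  rw [← isOpen_compl_iff, isOpen_iff_mem_nhds]
  rintro ⟨x, y⟩ hxy
  have h1 := hp.eventually_mem hc (x := x) (y := y) isOpen_empty (fun g hg => hxy ⟨g, hg⟩)
  filter_upwards [h1] with z hz
  rintro ⟨g, hg⟩
  exact hz g hg

end Proper

/-- A quotient map whose fibres are the orbits of a continuous action is open. -/
theorem isOpenQuotientMap_of_orbits {G P Q : Type*} [Group G] [TopologicalSpace P]
    [TopologicalSpace Q] {ρ : RightAction G P}
    (hc : ∀ g, Continuous fun x => ρ.act x g) {π : P → Q} (hπ : IsQuotientMap π)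
    (hfib : ∀ x y, π x = π y ↔ ∃ g, ρ.act x g = y) : IsOpenQuotientMap π := by
  refine ⟨hπ.surjective, hπ.continuous, fun U hU => ?_⟩
  rw [← hπ.isOpen_preimage]
  have : π ⁻¹' (π '' U) = ⋃ g, (fun x => ρ.act x g) ⁻¹' U := by
    ext y
    simp only [mem_preimage, mem_image, mem_iUnion]
    constructor
    · rintro ⟨x, hx, hxy⟩
      obtain ⟨g, hg⟩ := (hfib y x).1 hxy.symm
      exact ⟨g, by rwa [hg]⟩
    · rintro ⟨g, hg⟩
      exact ⟨_, hg, ((hfib y _).2 ⟨g, rfl⟩).symm⟩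
  rw [this]
  exact isOpen_iUnion fun g => hU.preimage (hc g)

section Slice

variable {G P : Type*} [Group G] [TopologicalSpace G] [TopologicalSpace P]

/-- A local trivialization of a principal action near a point `p`: a chart of `P` with values in
`F × E_G`, the first component of which separates orbits, together with the component `γ` in
the group of the points of its domain. -/
structure PrincipalSlice (SP : ManifoldStr P) (SG : ManifoldStr G) (ρ : RightAction G P)
    (F : Type) [NormedAddCommGroup F] [NormedSpace ℝ F] (p : P) where
  κ : OpenPartialHomeomorph P (F × SG.E)
  V : Set F
  W : Set SG.E
  c : SG.E
  γ : P → G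
  mem_source : p ∈ κ.source
  isOpen_V : IsOpen V
  target_eq : κ.target = V ×ˢ W
  mem_W : c ∈ W
  smooth : ContMDiffOn SP.I 𝓘(ℝ, F × SG.E) ∞ κ κ.source
  smooth_symm : ContMDiffOn 𝓘(ℝ, F × SG.E) SP.I ∞ κ.symm κ.target
  smooth_γ : ContMDiffOn SP.I SG.I ∞ γ κ.source
  act_γ : ∀ x ∈ κ.source, ρ.act (κ.symm ((κ x).1, c)) (γ x) = x
  fst_eq : ∀ x ∈ κ.source, ∀ y ∈ κ.source, ∀ g, ρ.act x g = y → (κ x).1 = (κ y).1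

/-- A linear map onto a complement of the range of an injective linear map. -/
theorem _root_.ContinuousLinearMap.exists_equiv_of_injective {E E' F : Type*}
    [NormedAddCommGroup E] [NormedSpace ℝ E] [FiniteDimensional ℝ E] [NormedAddCommGroup E']
    [NormedSpace ℝ E'] [FiniteDimensional ℝ E'] [NormedAddCommGroup F] [NormedSpace ℝ F]
    [FiniteDimensional ℝ F] (D : E →L[ℝ] E') (hD : Function.Injective D)
    (hF : Module.finrank ℝ F + Module.finrank ℝ E = Module.finrank ℝ E') :
    ∃ (j : F →L[ℝ] E') (e : (F × E) ≃L[ℝ] E'), ∀ z, e z = j z.1 + D z.2 := by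
  obtain ⟨q, hq⟩ := Submodule.exists_isCompl (LinearMap.range (D : E →ₗ[ℝ] E'))
  have h1 := Submodule.finrank_add_eq_of_isCompl hq
  rw [LinearMap.finrank_range_of_inj hD] at h1
  have h2 : Module.finrank ℝ F = Module.finrank ℝ q := by omega
  obtain ⟨ι⟩ := FiniteDimensional.nonempty_linearEquiv_of_finrank_eq h2
  let j : F →ₗ[ℝ] E' := q.subtype ∘ₗ ι.toLinearMap
  let L : F × E →ₗ[ℝ] E' := j.coprod (D : E →ₗ[ℝ] E')
  have hL : Function.Injective L := by
    rw [← LinearMap.ker_eq_bot, LinearMap.ker_eq_bot']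
    rintro ⟨s, v⟩ hsv
    have h3 : (ι s : E') + D v = 0 := hsv
    have h4 : (ι s : E') ∈ LinearMap.range (D : E →ₗ[ℝ] E') :=
      ⟨-v, by
        change D (-v) = _
        rw [map_neg]
        exact (eq_neg_of_add_eq_zero_left h3).symm⟩
    have h5 : (ι s : E') = 0 := Submodule.disjoint_def.1 hq.disjoint _ h4 (ι s).2
    rw [h5, zero_add] at h3
    have h6 : v = 0 := hD (h3.trans (map_zero D).symm)
    have h7 : s = 0 := by simpa using h5
    rw [h6, h7]
    rfl
  refine ⟨LinearMap.toContinuousLinearMap j, (L.linearEquivOfInjective hL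
    (by rw [Module.finrank_prod, hF])).toContinuousLinearEquiv, fun z => rfl⟩

theorem finrank_le_of_principal {SP : ManifoldStr P} {SG : ManifoldStr G} {ρ : RightAction G P}
    (hρ : ρ.IsPrincipal SP SG) (p : P) :
    Module.finrank ℝ SG.E ≤ Module.finrank ℝ SP.E := by
  let D : SG.E →L[ℝ] SP.E := mfderiv SG.I SP.I (fun g => ρ.act p g) (1 : G)
  refine LinearMap.finrank_le_finrank_of_injective (f := (D : SG.E →ₗ[ℝ] SP.E)) ?_
  rw [← LinearMap.ker_eq_bot, LinearMap.ker_eq_bot']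
  exact fun v hv => mfderiv_act_injective hρ.lieGroup hρ.smooth hρ.free p v hv

/-- The model space of the orbit space of a principal action. -/
abbrev SliceModel (SP : ManifoldStr P) (SG : ManifoldStr G) : Type :=
  Fin (Module.finrank ℝ SP.E - Module.finrank ℝ SG.E) → ℝ

/-- Choose a slice through `p` transverse to its orbit. By the inverse function theorem `(s, w) ↦
ς(s) φ⁻¹(w)` is a local diffeomorphism, since orbit maps have injective differentials. Freeness and
properness force an element relating two slice points near `p` to be close to `1`, and local
injectivity then shows that the points coincide. -/
theorem exists_principalSlice {SP : ManifoldStr P} {SG : ManifoldStr G} {ρ : RightAction G P}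
    (hρ : ρ.IsPrincipal SP SG) (p : P) :
    Nonempty (PrincipalSlice SP SG ρ (SliceModel SP SG) p) := by
  have hG := hρ.lieGroup
  have hs := hρ.smooth
  have := SP.t2Space
  have := SP.locallyCompactSpace
  have hcont := hs.continuous
  have hcE : CompleteSpace SG.E := FiniteDimensional.complete ℝ _
  set φ := chartAt SG.E (1 : G) with hφ
  set ψ := chartAt SP.E (ρ.act p 1) with hψ
  have hφm : φ ∈ IsManifold.maximalAtlas SG.I ∞ G := IsManifold.chart_mem_maximalAtlas (1 : G)
  have hψm : ψ ∈ IsManifold.maximalAtlas SP.I ∞ P := IsManifold.chart_mem_maximalAtlas _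
  have hφ1 : (1 : G) ∈ φ.source := mem_chart_source _ _
  have hψp : p ∈ ψ.source := by
    rw [hψ, ρ.act_one]
    exact mem_chart_source _ _
  set c := φ 1 with hc
  have hφc : φ.symm c = 1 := φ.left_inv hφ1
  have hct : c ∈ φ.target := φ.map_source hφ1
  -- the orbit map in charts
  set f₁ : SG.E → SP.E := fun y => ψ (ρ.act p (φ.symm y)) with hf₁
  have hf₁s : ContDiffAt ℝ ∞ f₁ c := by
    rw [← contMDiffAt_iff_contDiffAt]
    have h1 : ContMDiffAt SP.I 𝓘(ℝ, SP.E) ∞ ψ (ρ.act p (φ.symm c)) :=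
      contMDiffAt_of_mem_maximalAtlas hψm (by rwa [hφc, ρ.act_one])
    exact h1.comp c ((hs.const_act p _).comp c (contMDiffAt_symm_of_mem_maximalAtlas hφm hct))
  have hd₁ : HasFDerivAt f₁ (fderiv ℝ f₁ c) c :=
    (hf₁s.differentiableAt (by simp)).hasFDerivAt
  set D := fderiv ℝ f₁ c with hDdef
  have hD : Function.Injective D := by
    rw [injective_iff_map_eq_zero]
    intro v hv
    refine mfderiv_act_injective hG hs hρ.free p v ?_
    have h1 := ((hs.const_act p 1).mdifferentiableAt (by simp)).mfderiv
    simp only [mfld_simps, fderivWithin_univ] at h1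
    exact (DFunLike.congr_fun h1 v).trans hv
  have hdim : Module.finrank ℝ (SliceModel SP SG) + Module.finrank ℝ SG.E =
      Module.finrank ℝ SP.E := by
    have := finrank_le_of_principal hρ p
    rw [Module.finrank_fin_fun]
    omega
  obtain ⟨j, ε, hε⟩ := D.exists_equiv_of_injective (F := SliceModel SP SG) hD hdim
  -- the slice through `p`
  set ς : SliceModel SP SG → P := fun s => ψ.symm (ψ p + j s) with hς
  set V₀ : Set (SliceModel SP SG) := (fun s => ψ p + j s) ⁻¹' ψ.target with hV₀
  have hjc : Continuous fun s => ψ p + j s := by fun_prop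
  have hV₀o : IsOpen V₀ := ψ.open_target.preimage hjc
  have hς0 : ς 0 = p := by simp [hς, ψ.left_inv hψp]
  have h0V₀ : (0 : SliceModel SP SG) ∈ V₀ := by
    simpa [hV₀] using ψ.map_source hψp
  have hςs : ContMDiffOn 𝓘(ℝ, SliceModel SP SG) SP.I ∞ ς V₀ := by
    refine (contMDiffOn_symm_of_mem_maximalAtlas hψm).comp ?_ fun s hs => hs
    exact (contMDiff_iff_contDiff.2 (by fun_prop)).contMDiffOn
  set a : SliceModel SP SG × SG.E → P := fun z => ρ.act (ς z.1) (φ.symm z.2) with ha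
  have has : ContMDiffOn 𝓘(ℝ, SliceModel SP SG × SG.E) SP.I ∞ a (V₀ ×ˢ φ.target) := by
    have h1 : ContMDiffOn 𝓘(ℝ, SliceModel SP SG × SG.E) SP.I ∞
        (fun z : SliceModel SP SG × SG.E => ς z.1) (V₀ ×ˢ φ.target) :=
      hςs.comp contDiff_fst.contMDiff.contMDiffOn fun z hz => hz.1
    have h2 : ContMDiffOn 𝓘(ℝ, SliceModel SP SG × SG.E) SG.I ∞
        (fun z : SliceModel SP SG × SG.E => φ.symm z.2) (V₀ ×ˢ φ.target) :=
      (contMDiffOn_symm_of_mem_maximalAtlas hφm).comp contDiff_snd.contMDiff.contMDiffOn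
        fun z hz => hz.2
    exact ContMDiff.comp_contMDiffOn (g := fun x : P × G => ρ.act x.1 x.2) hs (h1.prodMk h2)
  set U : Set (SliceModel SP SG × SG.E) := (V₀ ×ˢ φ.target) ∩ a ⁻¹' ψ.source with hU
  have hUo : IsOpen U := has.continuousOn.isOpen_inter_preimage (hV₀o.prod φ.open_target)
    ψ.open_source
  have ha0 : a (0, c) = p := by simp only [ha, hς0, hφc, ρ.act_one]
  have h0U : ((0 : SliceModel SP SG), c) ∈ U := ⟨⟨h0V₀, hct⟩, by
    simpa only [mem_preimage, ha0] using hψp⟩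
  set Ψ : SliceModel SP SG × SG.E → SP.E := fun z => ψ (a z) with hΨ
  have hΨs : ContDiffOn ℝ ∞ Ψ U := by
    rw [← contMDiffOn_iff_contDiffOn]
    exact (contMDiffOn_of_mem_maximalAtlas hψm).comp (has.mono inter_subset_left)
      fun z hz => hz.2
  have hΨd : HasFDerivAt Ψ (ε : (SliceModel SP SG × SG.E) →L[ℝ] SP.E) (0, c) := by
    have h1 : HasFDerivAt Ψ (fderiv ℝ Ψ (0, c)) (0, c) :=
      ((hΨs.contDiffAt (hUo.mem_nhds h0U)).differentiableAt (by simp)).hasFDerivAt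
    set D' := fderiv ℝ Ψ (0, c) with hD'
    have h2 : D'.comp (ContinuousLinearMap.inl ℝ _ SG.E) = j := by
      have h3 : HasFDerivAt (fun s : SliceModel SP SG => Ψ (s, c))
          (D'.comp (ContinuousLinearMap.inl ℝ _ SG.E)) 0 :=
        HasFDerivAt.comp (g := Ψ) (f := fun s : SliceModel SP SG => (s, c)) 0 h1
          (hasFDerivAt_prodMk_left 0 c)
      refine h3.unique ((j.hasFDerivAt.const_add (ψ p)).congr_of_eventuallyEq ?_)
      filter_upwards [hV₀o.mem_nhds h0V₀] with s hs
      simp only [hΨ, ha, hς, hφc, ρ.act_one, ψ.right_inv hs]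
    have h2' : D'.comp (ContinuousLinearMap.inr ℝ (SliceModel SP SG) SG.E) = D := by
      have h3 : HasFDerivAt (fun y : SG.E => Ψ (0, y))
          (D'.comp (ContinuousLinearMap.inr ℝ (SliceModel SP SG) SG.E)) c :=
        HasFDerivAt.comp (g := Ψ) (f := fun y : SG.E => ((0 : SliceModel SP SG), y)) c h1
          (hasFDerivAt_prodMk_right 0 c)
      refine h3.unique (hd₁.congr_of_eventuallyEq (Eventually.of_forall fun y => ?_))
      simp only [hΨ, ha, hς0, hf₁]
    have h4 : (ε : (SliceModel SP SG × SG.E) →L[ℝ] SP.E) = D' := by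
      refine ContinuousLinearMap.ext fun z => ?_
      have h5 : D' (z.1, 0) = j z.1 := DFunLike.congr_fun h2 z.1
      have h6 : D' (0, z.2) = D z.2 := DFunLike.congr_fun h2' z.2
      have h7 : z = (z.1, 0) + (0, z.2) := by simp
      rw [ContinuousLinearEquiv.coe_coe, hε, ← h5, ← h6, ← map_add, ← h7]
    rw [h4]
    exact h1
  obtain ⟨e, he0, heU, hef, hes⟩ := hΨs.exists_openPartialHomeomorph hUo h0U ε hΨd
  -- shrink to a product neighbourhood on which orbits are separated
  obtain ⟨V₁, W, hV₁o, h0V₁, hWo, hcW, hVW⟩ := mem_nhds_prod_iff'.1 (e.open_source.mem_nhds he0)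
  have hWG : IsOpen (φ.source ∩ φ ⁻¹' W) := φ.isOpen_inter_preimage hWo
  -- Only `g = 1` carries `p` to `p`, so by properness the elements relating points near `p` lie in
  -- the chart domain over `W`.
  have hev := hρ.proper.eventually_mem hcont (x := p) (y := p) hWG (fun g hg => by
    rw [hρ.free p g hg]
    exact ⟨hφ1, hcW⟩)
  have hςc : ContinuousAt ς 0 := (hςs.contMDiffAt (hV₀o.mem_nhds h0V₀)).continuousAt
  have hςc2 : ContinuousAt (fun z : SliceModel SP SG × SliceModel SP SG => (ς z.1, ς z.2))
      (0, 0) :=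
    (ContinuousAt.comp (g := ς) (f := Prod.fst) hςc continuousAt_fst).prodMk
      (ContinuousAt.comp (g := ς) (f := Prod.snd) hςc continuousAt_snd)
  have hev2 : ∀ᶠ z : SliceModel SP SG × SliceModel SP SG in 𝓝 (0, 0),
      ∀ g, ρ.act (ς z.1) g = ς z.2 → g ∈ φ.source ∩ φ ⁻¹' W := by
    have h1 := hςc2.tendsto
    simp only [hς0] at h1
    exact h1.eventually hev
  obtain ⟨V₂, V₃, hV₂o, h0V₂, hV₃o, h0V₃, hV₂₃⟩ := mem_nhds_prod_iff'.1 hev2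
  set V : Set (SliceModel SP SG) := V₁ ∩ (V₂ ∩ V₃) with hV
  have hVo : IsOpen V := hV₁o.inter (hV₂o.inter hV₃o)
  have h0V : (0 : SliceModel SP SG) ∈ V := ⟨h0V₁, h0V₂, h0V₃⟩
  have hVWe : V ×ˢ W ⊆ e.source := fun z hz => hVW ⟨hz.1.1, hz.2⟩
  -- Both `(s, φ g)` and `(s', c)` lie in the domain of the injective map `e` and have the same
  -- image.
  have hsep : ∀ s ∈ V, ∀ s' ∈ V, ∀ g, ρ.act (ς s) g = ς s' → s = s' := by
    intro s hs s' hs' g hg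
    have hg' : g ∈ φ.source ∩ φ ⁻¹' W := @hV₂₃ (s, s') ⟨hs.2.1, hs'.2.2⟩ g hg
    have h1 : e (s, φ g) = e (s', c) := by
      rw [hef, hef]
      simp only [hΨ, ha, φ.left_inv hg'.1, hg, hφc, ρ.act_one]
    exact congrArg Prod.fst (e.injOn (hVWe (show (s, φ g) ∈ V ×ˢ W from ⟨hs, hg'.2⟩))
      (hVWe (show (s', c) ∈ V ×ˢ W from ⟨hs', hcW⟩)) h1)
  set e' := e.restrOpen (V ×ˢ W) (hVo.prod hWo) with he'
  have he's : e'.source = V ×ˢ W := by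
    rw [he', OpenPartialHomeomorph.restrOpen_source, inter_eq_right.2 hVWe]
  have he'f : ∀ z, e' z = Ψ z := hef
  set κ : OpenPartialHomeomorph P (SliceModel SP SG × SG.E) := ψ.trans e'.symm with hκ
  have hκt : κ.target = V ×ˢ W := by
    rw [hκ, OpenPartialHomeomorph.trans_target, OpenPartialHomeomorph.symm_target, he's,
      OpenPartialHomeomorph.symm_symm]
    refine inter_eq_left.2 fun z hz => ?_
    rw [mem_preimage, he'f]
    exact ψ.map_source (heU (hVWe hz)).2
  have hκsymm : ∀ z ∈ V ×ˢ W, κ.symm z = a z := by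
    intro z hz
    change ψ.symm (e' z) = a z
    rw [he'f]
    exact ψ.left_inv (heU (hVWe hz)).2
  have hκm : ∀ x ∈ κ.source, κ x ∈ V ×ˢ W := fun x hx => hκt ▸ κ.map_source hx
  have hκa : ∀ x ∈ κ.source, ρ.act (ς (κ x).1) (φ.symm (κ x).2) = x := fun x hx => by
    have h1 := hκsymm _ (hκm x hx)
    rw [κ.left_inv hx] at h1
    exact h1.symm
  have hκς : ∀ s ∈ V, κ.symm (s, c) = ς s := fun s hs => by
    rw [hκsymm _ ⟨hs, hcW⟩]
    simp only [ha, hφc, ρ.act_one]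
  have hκs : ContMDiffOn SP.I 𝓘(ℝ, SliceModel SP SG × SG.E) ∞ κ κ.source := by
    have h1 : ContMDiffOn 𝓘(ℝ, SP.E) 𝓘(ℝ, SliceModel SP SG × SG.E) ∞ e'.symm e'.target := by
      rw [contMDiffOn_iff_contDiffOn]
      refine hes.mono fun z hz => ?_
      have := e'.map_target hz
      rw [← e'.right_inv hz]
      exact e.map_source this.1
    exact h1.comp ((contMDiffOn_of_mem_maximalAtlas hψm).mono fun x hx => hx.1)
      fun x hx => hx.2
  refine ⟨⟨κ, V, W, c, fun x => φ.symm (κ x).2, ?_, hVo, hκt, hcW, hκs, ?_, ?_, ?_, ?_⟩⟩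
  · have h1 := κ.map_target (x := (0, c)) (by rw [hκt]; exact ⟨h0V, hcW⟩)
    rwa [hκsymm _ ⟨h0V, hcW⟩, ha0] at h1
  · rw [hκt]
    exact (has.mono fun z hz => (heU (hVWe hz)).1).congr hκsymm
  · exact (contMDiffOn_symm_of_mem_maximalAtlas hφm).comp
      (contDiff_snd.contMDiff.comp_contMDiffOn hκs)
      fun x hx => (heU (hVWe (hκm x hx))).1.2
  · intro x hx
    rw [hκς _ (hκm x hx).1]
    exact hκa x hx
  · intro x hx y hy g hg
    -- If `x = ς(s) a`, `y = ς(s') b` and `x g = y`, then `a g b⁻¹` carries `ς(s)` to `ς(s')`.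
    refine hsep _ (hκm x hx).1 _ (hκm y hy).1
      (φ.symm (κ x).2 * g * (φ.symm (κ y).2)⁻¹) ?_
    rw [ρ.act_mul, ρ.act_mul, hκa x hx, hg]
    nth_rewrite 1 [← hκa y hy]
    rw [← ρ.act_mul, mul_inv_cancel, ρ.act_one]

end Slice

end RightAction

/-! ### The orbit space of a principal action -/

namespace RightAction

section Orbits

variable {G P Q : Type*} [Group G] [TopologicalSpace G] [TopologicalSpace P]
  {SP : ManifoldStr P} {SG : ManifoldStr G} {ρ : RightAction G P} {F : Type}
  [NormedAddCommGroup F] [NormedSpace ℝ F] {p : P} {π : P → Q}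

namespace PrincipalSlice

variable (K : PrincipalSlice SP SG ρ F p)

theorem fst_mem {x : P} (hx : x ∈ K.κ.source) : (K.κ x).1 ∈ K.V := by
  have := K.κ.map_source hx
  rw [K.target_eq] at this
  exact this.1

theorem snd_mem {x : P} (hx : x ∈ K.κ.source) : (K.κ x).2 ∈ K.W := by
  have := K.κ.map_source hx
  rw [K.target_eq] at this
  exact this.2

theorem mk_mem_target {s : F} {w : SG.E} (hs : s ∈ K.V) (hw : w ∈ K.W) :
    (s, w) ∈ K.κ.target := by
  rw [K.target_eq]
  exact ⟨hs, hw⟩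

theorem invFunOn_spec {q : Q} (hq : q ∈ π '' K.κ.source) :
    @Function.invFunOn _ _ ⟨p⟩ π K.κ.source q ∈ K.κ.source ∧
      π (@Function.invFunOn _ _ ⟨p⟩ π K.κ.source q) = q :=
  haveI : Nonempty P := ⟨p⟩
  ⟨Function.invFunOn_mem hq, Function.invFunOn_eq hq⟩

/-- The first slice coordinate is constant on orbits, so the arbitrary choice of a preimage does not
affect the chart. -/
theorem fst_invFunOn (hfib : ∀ x y, π x = π y ↔ ∃ g, ρ.act x g = y) {x : P}
    (hx : x ∈ K.κ.source) :
    (K.κ (@Function.invFunOn _ _ ⟨p⟩ π K.κ.source (π x))).1 = (K.κ x).1 := by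
  have h := K.invFunOn_spec (π := π) (mem_image_of_mem π hx)
  obtain ⟨g, hg⟩ := (hfib _ _).1 h.2
  exact K.fst_eq _ h.1 _ hx g hg

/-- The chart of the orbit space induced by a slice. -/
noncomputable def orbitChart [TopologicalSpace Q] (hπ : IsOpenQuotientMap π)
    (hfib : ∀ x y, π x = π y ↔ ∃ g, ρ.act x g = y) : OpenPartialHomeomorph Q F where
  toFun q := (K.κ (@Function.invFunOn _ _ ⟨p⟩ π K.κ.source q)).1
  invFun s := π (K.κ.symm (s, K.c))
  source := π '' K.κ.source
  target := K.V
  map_source' := fun q hq => K.fst_mem (K.invFunOn_spec hq).1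
  map_target' := fun s hs =>
    mem_image_of_mem _ (K.κ.map_target (K.mk_mem_target hs K.mem_W))
  left_inv' := by
    rintro _ ⟨x, hx, rfl⟩
    rw [K.fst_invFunOn hfib hx]
    exact (hfib _ _).2 ⟨_, K.act_γ x hx⟩
  right_inv' := fun s hs => by
    have h := K.mk_mem_target hs K.mem_W
    rw [K.fst_invFunOn hfib (K.κ.map_target h), K.κ.right_inv h]
  open_source := hπ.isOpenMap _ K.κ.open_source
  open_target := K.isOpen_V
  continuousOn_toFun := by
    rintro _ ⟨x, hx, rfl⟩
    refine ContinuousAt.continuousWithinAt (hπ.continuousAt_comp_iff.1 ?_)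
    have h1 : ContinuousAt (fun x => (K.κ x).1) x := (K.κ.continuousAt hx).fst
    refine h1.congr ?_
    filter_upwards [K.κ.open_source.mem_nhds hx] with y hy
    exact (K.fst_invFunOn hfib hy).symm
  continuousOn_invFun :=
    hπ.continuous.comp_continuousOn (K.κ.continuousOn_symm.comp (by fun_prop)
      fun s hs => K.mk_mem_target hs K.mem_W)

variable [TopologicalSpace Q] (hπ : IsOpenQuotientMap π) (hfib : ∀ x y, π x = π y ↔ ∃ g, ρ.act x g = y)

theorem orbitChart_apply {x : P} (hx : x ∈ K.κ.source) :
    K.orbitChart hπ hfib (π x) = (K.κ x).1 :=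
  K.fst_invFunOn hfib hx

theorem mem_orbitChart_source {x : P} (hx : x ∈ K.κ.source) :
    π x ∈ (K.orbitChart hπ hfib).source :=
  mem_image_of_mem π hx

/-- The point `x` may lie outside the domain of the slice, but a translate of it lies inside, and
`π` is invariant under translation. -/
theorem contMDiffAt_orbitChart_comp (hs : ρ.IsSmooth SP SG) {x : P}
    (hx : π x ∈ (K.orbitChart hπ hfib).source) :
    ContMDiffAt SP.I 𝓘(ℝ, F) ∞ (fun z => K.orbitChart hπ hfib (π z)) x := by
  obtain ⟨y, hy, hxy⟩ := hx
  obtain ⟨g, hg⟩ := (hfib _ _).1 hxy.symm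
  have hgs := hs.act_const g
  have hgx : ρ.act x g ∈ K.κ.source := by rwa [hg]
  have h1 : ContMDiffAt SP.I 𝓘(ℝ, F × SG.E) ∞ (fun z => K.κ (ρ.act z g)) x :=
    ContMDiffAt.comp (g := K.κ) (f := fun z => ρ.act z g) x
      (K.smooth.contMDiffAt (K.κ.open_source.mem_nhds hgx)) (hgs x)
  have h2 : ContMDiffAt SP.I 𝓘(ℝ, F) ∞ (fun z => (K.κ (ρ.act z g)).1) x :=
    ContMDiffAt.comp (g := Prod.fst) (f := fun z => K.κ (ρ.act z g)) x
      contDiff_fst.contMDiff.contMDiffAt h1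
  refine h2.congr_of_eventuallyEq ?_
  filter_upwards [(hgs x).continuousAt (K.κ.open_source.mem_nhds hgx)] with z hz
  rw [← K.orbitChart_apply hπ hfib hz]
  exact congrArg _ ((hfib _ _).2 ⟨g, rfl⟩)

/-- The inverse chart is `π` after the smooth map `s ↦ K.κ.symm (s, K.c)` into `P`, so the
transition map is a chart composed with `π`, read along that map. -/
theorem contDiffOn_orbitChart_trans (hs : ρ.IsSmooth SP SG) {p' : P}
    (K' : PrincipalSlice SP SG ρ F p') :
    ContDiffOn ℝ ∞ (fun z => K'.orbitChart hπ hfib ((K.orbitChart hπ hfib).symm z))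
      ((K.orbitChart hπ hfib).target ∩
        (K.orbitChart hπ hfib).symm ⁻¹' (K'.orbitChart hπ hfib).source) := by
  intro s hsm
  have hsV : s ∈ K.V := hsm.1
  rw [← contMDiffWithinAt_iff_contDiffWithinAt]
  have ht := K.mk_mem_target hsV K.mem_W
  have h1 : ContMDiffAt 𝓘(ℝ, F × SG.E) SP.I ∞ K.κ.symm (s, K.c) :=
    K.smooth_symm.contMDiffAt (K.κ.open_target.mem_nhds ht)
  have h2 : ContMDiffAt 𝓘(ℝ, F) SP.I ∞ (fun s => K.κ.symm (s, K.c)) s :=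
    ContMDiffAt.comp (g := K.κ.symm) (f := fun s => (s, K.c)) s h1
      (contMDiffAt_iff_contDiffAt.2 (by fun_prop))
  exact (ContMDiffAt.comp (g := fun z => K'.orbitChart hπ hfib (π z))
    (f := fun s => K.κ.symm (s, K.c)) s
    (K'.contMDiffAt_orbitChart_comp hπ hfib hs hsm.2) h2).contMDiffWithinAt

end PrincipalSlice

/-- A topological quotient by a principal action is a manifold, and the projection onto it is a
submersion. -/
theorem IsPrincipal.exists_isSubmersion [TopologicalSpace Q] (hρ : ρ.IsPrincipal SP SG)
    (hπ : IsQuotientMap π)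
    (hfib : ∀ x y, π x = π y ↔ ∃ g, ρ.act x g = y) :
    ∃ SQ : ManifoldStr Q, Manifold.IsSubmersion SP.I SQ.I ∞ π := by
  have hs := hρ.smooth
  have ho : IsOpenQuotientMap π :=
    isOpenQuotientMap_of_orbits (fun g => (hs.act_const g).continuous) hπ hfib
  have := SP.t2Space
  have := SP.secondCountable
  have := SP.locallyCompactSpace
  have ht2 : T2Space Q := by
    rw [t2Space_iff_of_isOpenQuotientMap ho]
    convert hρ.proper.isClosed_orbitRel hs.continuous using 1
    ext z
    exact hfib _ _
  have hsc : SecondCountableTopology Q := hπ.secondCountableTopology ho.isOpenMap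
  choose r hr using hπ.surjective
  let K : ∀ q, PrincipalSlice SP SG ρ (SliceModel SP SG) (r q) := fun q =>
    (exists_principalSlice hρ (r q)).some
  let e : Q → OpenPartialHomeomorph Q (SliceModel SP SG) := fun q => (K q).orbitChart ho hfib
  have he : ∀ q, q ∈ (e q).source := fun q => by
    have := (K q).mem_orbitChart_source ho hfib (K q).mem_source
    rwa [hr] at this
  let SQ : ManifoldStr Q := ManifoldStr.ofCharts (SliceModel SP SG) e he
    (fun x y => (K x).contDiffOn_orbitChart_trans ho hfib hs (K y)) ht2 hsc
  refine ⟨SQ, isSubmersion_of_sections ?_ ?_⟩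
  · intro x
    rw [contMDiffAt_iff_target]
    refine ⟨ho.continuous.continuousAt, ?_⟩
    exact (K (π x)).contMDiffAt_orbitChart_comp ho hfib hs (he (π x))
  · intro x
    set q := π x with hq
    obtain ⟨g, hg⟩ := (hfib _ _).1 ((hr q).trans hq)
    have hm := (K q).mem_source
    have heq : e q q = ((K q).κ (r q)).1 := by
      have := (K q).orbitChart_apply ho hfib hm
      rwa [hr] at this
    have hes : ContMDiffAt SQ.I 𝓘(ℝ, SliceModel SP SG) ∞ (e q) q :=
      contMDiffAt_of_mem_maximalAtlas (I := SQ.I) (e := e q)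
        (IsManifold.chart_mem_maximalAtlas (I := SQ.I) q) (he q)
    have h1 : ContMDiffAt SQ.I 𝓘(ℝ, SliceModel SP SG × SG.E) ∞
        (fun y => (e q y, ((K q).κ (r q)).2)) q := by
      refine ContMDiffAt.comp
        (g := fun s : SliceModel SP SG => (s, ((K q).κ (r q)).2)) (f := e q) q ?_ hes
      exact contMDiffAt_iff_contDiffAt.2 (by fun_prop)
    have hpt : (e q q, ((K q).κ (r q)).2) = (K q).κ (r q) := by rw [heq]
    have h2 : ContMDiffAt 𝓘(ℝ, SliceModel SP SG × SG.E) SP.I ∞ (K q).κ.symm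
        (e q q, ((K q).κ (r q)).2) := by
      rw [hpt]
      exact (K q).smooth_symm.contMDiffAt
        ((K q).κ.open_target.mem_nhds ((K q).κ.map_source hm))
    -- The section runs through the representative `r q` at constant group coordinate and is then
    -- translated by the `g` that carries `r q` to `x`.
    refine ⟨fun y => ρ.act ((K q).κ.symm (e q y, ((K q).κ (r q)).2)) g, ?_, ?_, ?_⟩
    · exact (hs.act_const g _).comp q (h2.comp q h1)
    · simp only [hpt, (K q).κ.left_inv hm, hg]
    · filter_upwards [(e q).open_source.mem_nhds (he q)] with y hy
      rw [← (hfib _ _).2 ⟨g, rfl⟩]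
      have hyV : e q y ∈ (K q).V := (e q).map_source hy
      have ht := (K q).mk_mem_target hyV ((K q).snd_mem hm)
      have hz := (K q).κ.map_target ht
      refine (e q).injOn ((K q).mem_orbitChart_source ho hfib hz) hy ?_
      refine ((K q).orbitChart_apply ho hfib hz).trans ?_
      rw [(K q).κ.right_inv ht]

/-- The element of the group which relates two points of the same orbit depends smoothly on
the points. -/
theorem IsPrincipal.exists_smooth_div (hρ : ρ.IsPrincipal SP SG) (p : P) :
    ∃ (U : Set P) (γ : P → G), IsOpen U ∧ p ∈ U ∧ ContMDiffOn SP.I SG.I ∞ γ U ∧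
      ∀ x ∈ U, ∀ y ∈ U, ∀ g, ρ.act x g = y → g = (γ x)⁻¹ * γ y := by
  obtain ⟨K⟩ := exists_principalSlice hρ p
  refine ⟨K.κ.source, K.γ, K.κ.open_source, K.mem_source, K.smooth_γ, fun x hx y hy g hg => ?_⟩
  -- Points of one orbit have the same base point in the slice, so `γ x * g` and `γ y` carry this
  -- base point to the same `y`.
  have h1 : ρ.act (K.κ.symm ((K.κ x).1, K.c)) (K.γ x * g) =
      ρ.act (K.κ.symm ((K.κ x).1, K.c)) (K.γ y) := by
    rw [ρ.act_mul, K.act_γ x hx, hg, K.fst_eq x hx y hy g hg, K.act_γ y hy]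
  have h2 : K.γ x * g * (K.γ y)⁻¹ = 1 := hρ.free _ _ (by
    rw [ρ.act_mul, h1, ← ρ.act_mul, mul_inv_cancel, ρ.act_one])
  rw [mul_inv_eq_one] at h2
  rw [← h2, inv_mul_cancel_left]

end Orbits

end RightAction

/-! ### The gauge groupoid of a principal action -/

theorem ManifoldStr.isSubmersion_prod {X Y Z : Type*} [TopologicalSpace X] [TopologicalSpace Y]
    [TopologicalSpace Z] {S : ManifoldStr X} {T : ManifoldStr Y} {R : ManifoldStr Z}
    {f : X × Y → Z} (hf : Manifold.IsSubmersion (S.prod T).I R.I ∞ f) :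
    Manifold.IsSubmersion (S.I.prod T.I) R.I ∞ f := by
  rw [ManifoldStr.prod_I] at hf
  exact hf

namespace RightAction

section Gauge

variable {G P : Type*} [Group G] {ρ : RightAction G P}

theorem IsFree.diag (hf : ρ.IsFree) : ρ.diag.IsFree := fun x g h =>
  hf x.1 g (congrArg Prod.fst h)

theorem proj_surjective (ρ : RightAction G P) : Function.Surjective ρ.proj :=
  Quotient.mk_surjective

theorem isQuotientMap_proj [TopologicalSpace P] (ρ : RightAction G P) : IsQuotientMap ρ.proj :=
  isQuotientMap_quotient_mk'

variable [TopologicalSpace G] [TopologicalSpace P]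

theorem IsProper.diag (hp : ρ.IsProper) : ρ.diag.IsProper := fun K hK => by
  refine (hp _ (hK.image continuous_fst)).of_isClosed_subset isClosed_closure
    (closure_mono ?_)
  rintro g ⟨x, hx, hg⟩
  exact ⟨x.1, mem_image_of_mem _ hx, mem_image_of_mem Prod.fst hg⟩

variable {SP : ManifoldStr P} {SG : ManifoldStr G}

theorem IsSmooth.diag (hs : ρ.IsSmooth SP SG) : ρ.diag.IsSmooth (SP.prod SP) SG := by
  have h1 : ContMDiff ((SP.I.prod SP.I).prod SG.I) (SP.I.prod SP.I) ∞
      fun x : (P × P) × G => ρ.diag.act x.1 x.2 :=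
    (ContMDiff.comp (g := fun x : P × G => ρ.act x.1 x.2)
      (f := fun x : (P × P) × G => (x.1.1, x.2)) hs
      ((contMDiff_fst.comp contMDiff_fst).prodMk contMDiff_snd)).prodMk
    (ContMDiff.comp (g := fun x : P × G => ρ.act x.1 x.2)
      (f := fun x : (P × P) × G => (x.1.2, x.2)) hs
      ((contMDiff_snd.comp contMDiff_fst).prodMk contMDiff_snd))
  unfold IsSmooth
  rw [ManifoldStr.prod_I]
  exact h1

theorem IsPrincipal.diag (hρ : ρ.IsPrincipal SP SG) : ρ.diag.IsPrincipal (SP.prod SP) SG :=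
  ⟨hρ.lieGroup, hρ.smooth.diag, hρ.free.diag, hρ.proper.diag⟩

theorem IsPrincipal.exists_orbits (hρ : ρ.IsPrincipal SP SG) :
    ∃ (SM : ManifoldStr ρ.Orbits) (SΓ : ManifoldStr ρ.diag.Orbits),
      Manifold.IsSubmersion SP.I SM.I ∞ ρ.proj ∧
      Manifold.IsSubmersion (SP.I.prod SP.I) SΓ.I ∞ ρ.diag.proj := by
  obtain ⟨SM, hM⟩ := hρ.exists_isSubmersion ρ.isQuotientMap_proj fun _ _ => ρ.proj_eq_iff
  obtain ⟨SΓ, hΓ⟩ := hρ.diag.exists_isSubmersion ρ.diag.isQuotientMap_proj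
    fun _ _ => ρ.diag.proj_eq_iff
  exact ⟨SM, SΓ, hM, ManifoldStr.isSubmersion_prod hΓ⟩

variable {SM : ManifoldStr ρ.Orbits} {SΓ : ManifoldStr ρ.diag.Orbits}

/-- The gauge groupoid of a principal action is a Lie groupoid. -/
theorem IsPrincipal.isLieGroupoid (hρ : ρ.IsPrincipal SP SG)
    (hM : Manifold.IsSubmersion SP.I SM.I ∞ ρ.proj)
    (hΓ : Manifold.IsSubmersion (SP.I.prod SP.I) SΓ.I ∞ ρ.diag.proj) :
    IsLieGroupoid SΓ SM (ρ.gaugeGroupoid hρ.free) := by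
  have hG := hρ.lieGroup
  have hMs : ContMDiff SP.I SM.I ∞ ρ.proj := hM.contMDiff
  have hΓs : ContMDiff (SP.I.prod SP.I) SΓ.I ∞ ρ.diag.proj := hΓ.contMDiff
  refine ⟨?_, ?_, ?_, ?_, ?_⟩
  · refine isSubmersion_of_sections ?_ ?_
    · exact hΓ.contMDiff_of_comp ρ.diag.proj_surjective (hMs.comp contMDiff_snd)
    · intro a
      obtain ⟨p, q, rfl⟩ := ρ.exists_pair a
      obtain ⟨s, hs, hsx, hev⟩ := (hM.isSubmersionAt q).exists_section
      -- A section of the source map through `⟨p, q⟩` is obtained by moving only `q`.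
      refine ⟨fun y => ρ.diag.proj (p, s y), ?_, ?_, hev⟩
      · exact (hΓs _).comp _ (contMDiffAt_const.prodMk hs)
      · change ρ.diag.proj (p, s (ρ.proj q)) = _
        rw [hsx]
        rfl
  · refine isSubmersion_of_sections ?_ ?_
    · exact hΓ.contMDiff_of_comp ρ.diag.proj_surjective (hMs.comp contMDiff_fst)
    · intro a
      obtain ⟨p, q, rfl⟩ := ρ.exists_pair a
      obtain ⟨s, hs, hsx, hev⟩ := (hM.isSubmersionAt p).exists_section
      refine ⟨fun y => ρ.diag.proj (s y, q), ?_, ?_, hev⟩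
      · exact (hΓs _).comp _ (hs.prodMk contMDiffAt_const)
      · change ρ.diag.proj (s (ρ.proj p), q) = _
        rw [hsx]
        rfl
  · exact hM.contMDiff_of_comp ρ.proj_surjective
      (hΓs.comp (contMDiff_id.prodMk contMDiff_id))
  · exact hΓ.contMDiff_of_comp ρ.diag.proj_surjective
      (hΓs.comp (contMDiff_snd.prodMk contMDiff_fst))
  · classical
    refine ⟨fun x => if h : ρ.gaugeSrc x.1 = ρ.gaugeTgt x.2 then ρ.gaugeMul x.1 x.2 h else x.1,
      fun a b h => dif_pos h, ?_⟩
    rintro ⟨a₀, b₀⟩ hab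
    obtain ⟨p, q, r, rfl, rfl⟩ := exists_pair_pair a₀ b₀ hab
    -- Lift the two arrows smoothly to `(p', q')` and `(q'', r')`. When they are composable,
    -- `γ(q')⁻¹ γ(q'')` carries `q'` to `q''`, and the product is `⟨p' γ(q')⁻¹ γ(q''), r'⟩`. This
    -- formula is smooth near the given pair, whether or not the arrows are composable.
    obtain ⟨s, hs, hs0, hsev⟩ := (hΓ.isSubmersionAt (p, q)).exists_section
    obtain ⟨t, ht, ht0, htev⟩ := (hΓ.isSubmersionAt (q, r)).exists_section
    obtain ⟨U, γ, hU, hqU, hγ, hdiv⟩ := hρ.exists_smooth_div q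
    change ContMDiffAt SΓ.I (SP.I.prod SP.I) ∞ s (ρ.pair p q) at hs
    change ContMDiffAt SΓ.I (SP.I.prod SP.I) ∞ t (ρ.pair q r) at ht
    change s (ρ.pair p q) = _ at hs0
    change t (ρ.pair q r) = _ at ht0
    have hs' : ContMDiffAt (SΓ.I.prod SΓ.I) (SP.I.prod SP.I) ∞
        (fun x : ρ.diag.Orbits × ρ.diag.Orbits => s x.1) (ρ.pair p q, ρ.pair q r) :=
      ContMDiffAt.comp (g := s) (f := Prod.fst) _ hs contMDiffAt_fst
    have ht' : ContMDiffAt (SΓ.I.prod SΓ.I) (SP.I.prod SP.I) ∞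
        (fun x : ρ.diag.Orbits × ρ.diag.Orbits => t x.2) (ρ.pair p q, ρ.pair q r) :=
      ContMDiffAt.comp (g := t) (f := Prod.snd) _ ht contMDiffAt_snd
    have hγq : ContMDiffAt SP.I SG.I ∞ γ q := hγ.contMDiffAt (hU.mem_nhds hqU)
    have h1 : ContMDiffAt (SΓ.I.prod SΓ.I) SG.I ∞
        (fun x : ρ.diag.Orbits × ρ.diag.Orbits => γ (s x.1).2) (ρ.pair p q, ρ.pair q r) :=
      ContMDiffAt.comp (g := γ) (f := fun x : ρ.diag.Orbits × ρ.diag.Orbits => (s x.1).2) _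
        (by simpa only [hs0] using hγq) (contMDiffAt_snd.comp _ hs')
    have h2 : ContMDiffAt (SΓ.I.prod SΓ.I) SG.I ∞
        (fun x : ρ.diag.Orbits × ρ.diag.Orbits => γ (t x.2).1) (ρ.pair p q, ρ.pair q r) :=
      ContMDiffAt.comp (g := γ) (f := fun x : ρ.diag.Orbits × ρ.diag.Orbits => (t x.2).1) _
        (by simpa only [ht0] using hγq) (contMDiffAt_fst.comp _ ht')
    have h3 : ContMDiffAt (SΓ.I.prod SΓ.I) SP.I ∞
        (fun x : ρ.diag.Orbits × ρ.diag.Orbits =>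
          ρ.act (s x.1).1 ((γ (s x.1).2)⁻¹ * γ (t x.2).1)) (ρ.pair p q, ρ.pair q r) :=
      ContMDiffAt.comp (g := fun x : P × G => ρ.act x.1 x.2)
        (f := fun x : ρ.diag.Orbits × ρ.diag.Orbits =>
          ((s x.1).1, (γ (s x.1).2)⁻¹ * γ (t x.2).1)) _ (hρ.smooth _)
        ((contMDiffAt_fst.comp _ hs').prodMk (h1.inv.mul h2))
    have h4 : ContMDiffAt (SΓ.I.prod SΓ.I) SΓ.I ∞
        (fun x : ρ.diag.Orbits × ρ.diag.Orbits => ρ.diag.proj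
          (ρ.act (s x.1).1 ((γ (s x.1).2)⁻¹ * γ (t x.2).1), (t x.2).2))
        (ρ.pair p q, ρ.pair q r) :=
      ContMDiffAt.comp (g := ρ.diag.proj) (f := fun x : ρ.diag.Orbits × ρ.diag.Orbits =>
        (ρ.act (s x.1).1 ((γ (s x.1).2)⁻¹ * γ (t x.2).1), (t x.2).2)) _ (hΓs _)
        (h3.prodMk (contMDiffAt_snd.comp _ ht'))
    have e1 : ∀ᶠ x : ρ.diag.Orbits × ρ.diag.Orbits in 𝓝 (ρ.pair p q, ρ.pair q r),
        ρ.diag.proj (s x.1) = x.1 :=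
      Tendsto.eventually (p := fun a => ρ.diag.proj (s a) = a) continuousAt_fst hsev
    have e2 : ∀ᶠ x : ρ.diag.Orbits × ρ.diag.Orbits in 𝓝 (ρ.pair p q, ρ.pair q r),
        ρ.diag.proj (t x.2) = x.2 :=
      Tendsto.eventually (p := fun a => ρ.diag.proj (t a) = a) continuousAt_snd htev
    have e3 : ∀ᶠ x : ρ.diag.Orbits × ρ.diag.Orbits in 𝓝 (ρ.pair p q, ρ.pair q r),
        (s x.1).2 ∈ U :=
      hs'.continuousAt.snd (by simpa only [hs0] using hU.mem_nhds hqU)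
    have e4 : ∀ᶠ x : ρ.diag.Orbits × ρ.diag.Orbits in 𝓝 (ρ.pair p q, ρ.pair q r),
        (t x.2).1 ∈ U :=
      ht'.continuousAt.fst (by simpa only [ht0] using hU.mem_nhds hqU)
    have key : ∀ x : ρ.diag.Orbits × ρ.diag.Orbits, ρ.diag.proj (s x.1) = x.1 →
        ρ.diag.proj (t x.2) = x.2 → (s x.1).2 ∈ U → (t x.2).1 ∈ U →
        ∀ h : ρ.gaugeSrc x.1 = ρ.gaugeTgt x.2, ρ.gaugeMul x.1 x.2 h = ρ.diag.proj
          (ρ.act (s x.1).1 ((γ (s x.1).2)⁻¹ * γ (t x.2).1), (t x.2).2) := by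
      rintro ⟨a, b⟩ ha hb haU hbU h
      change ρ.diag.proj (s a) = a at ha
      change ρ.diag.proj (t b) = b at hb
      change (s a).2 ∈ U at haU
      change (t b).1 ∈ U at hbU
      change ρ.gaugeSrc a = ρ.gaugeTgt b at h
      change ρ.gaugeMul a b h = ρ.pair (ρ.act (s a).1 ((γ (s a).2)⁻¹ * γ (t b).1)) (t b).2
      have hb' : ρ.pair (t b).1 (t b).2 = b := hb
      have h5 := h
      rw [← ha, ← hb] at h5
      obtain ⟨g, hg⟩ := ρ.proj_eq_iff.1 (show ρ.proj (s a).2 = ρ.proj (t b).1 from h5)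
      rw [← hdiv _ haU _ hbU g hg]
      have ha' : ρ.pair (ρ.act (s a).1 g) (t b).1 = a := by
        refine Eq.trans ?_ ha
        exact (ρ.pair_eq_iff.2 ⟨g, rfl, hg⟩).symm
      have h6 := gaugeMul_pair hρ.free (ρ.act (s a).1 g) (t b).1 (t b).2 rfl
      rw [← h6]
      congr 1
      · exact ha'.symm
      · exact hb'.symm
    refine h4.contMDiffWithinAt.congr_of_eventuallyEq_of_mem ?_ hab
    filter_upwards [e1.filter_mono nhdsWithin_le_nhds, e2.filter_mono nhdsWithin_le_nhds,
      e3.filter_mono nhdsWithin_le_nhds, e4.filter_mono nhdsWithin_le_nhds,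
      self_mem_nhdsWithin] with x x1 x2 x3 x4 x5
    exact (dif_pos x5).trans (key x x1 x2 x3 x4 x5)

end Gauge

end RightAction

/-! ### Quotients of Lie groups -/

/-- Compact sets lift along open quotient maps of locally compact spaces. -/
theorem IsOpenQuotientMap.exists_isCompact_subset_image {X Y : Type*} [TopologicalSpace X]
    [TopologicalSpace Y] [WeaklyLocallyCompactSpace X] {f : X → Y} (hf : IsOpenQuotientMap f)
    {C : Set Y} (hC : IsCompact C) : ∃ D : Set X, IsCompact D ∧ C ⊆ f '' D := by
  refine hC.induction_on (p := fun C => ∃ D : Set X, IsCompact D ∧ C ⊆ f '' D)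
    ⟨∅, isCompact_empty, empty_subset _⟩ ?_ ?_ ?_
  · rintro s t hst ⟨D, hD, htD⟩
    exact ⟨D, hD, hst.trans htD⟩
  · rintro s t ⟨D, hD, hsD⟩ ⟨D', hD', htD'⟩
    refine ⟨D ∪ D', hD.union hD', ?_⟩
    rw [image_union]
    exact union_subset_union hsD htD'
  · intro y _
    obtain ⟨x, rfl⟩ := hf.surjective y
    obtain ⟨D, hD, hxD⟩ := exists_compact_mem_nhds x
    exact ⟨f '' D, mem_nhdsWithin_of_mem_nhds (hf.isOpenMap.image_mem_nhds hxD), D, hD, Subset.rfl⟩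

namespace RightAction

theorem act_act_inv {G X : Type*} [Group G] (ρ : RightAction G X) (g : G) (x : X) :
    ρ.act (ρ.act x g) g⁻¹ = x := by
  rw [← ρ.act_mul, mul_inv_cancel, ρ.act_one]

theorem act_inv_act {G X : Type*} [Group G] (ρ : RightAction G X) (g : G) (x : X) :
    ρ.act (ρ.act x g⁻¹) g = x := by
  rw [← ρ.act_mul, inv_mul_cancel, ρ.act_one]

/-! ### Restriction of principal actions to closed subgroups -/

section Restrict

variable {G P : Type*} [Group G] [TopologicalSpace G] [TopologicalSpace P]
  {SP : ManifoldStr P} {SG : ManifoldStr G} {ρ : RightAction G P}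

theorem IsSmooth.restrict (hs : ρ.IsSmooth SP SG) (H : Subgroup G) {SH : ManifoldStr H}
    (hH : ContMDiff SH.I SG.I ∞ (Subtype.val : H → G)) : (ρ.restrict H).IsSmooth SP SH :=
  ContMDiff.comp (g := fun x : P × G => ρ.act x.1 x.2)
    (f := fun x : P × H => (x.1, (x.2 : G))) hs
    (contMDiff_fst.prodMk (hH.comp contMDiff_snd))

/-- The restriction of a principal action to an embedded closed subgroup is principal. -/
theorem IsPrincipal.restrict (hρ : ρ.IsPrincipal SP SG) {H : Subgroup G}
    (hc : IsClosed (H : Set G)) {SH : ManifoldStr H}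
    (hH : Manifold.IsSmoothEmbedding SH.I SG.I ∞ (Subtype.val : H → G)) :
    (ρ.restrict H).IsPrincipal SP SH where
  lieGroup := lieGroup_of_isSmoothEmbedding SG hρ.lieGroup H SH hH
  smooth := hρ.smooth.restrict H hH.contMDiff
  free x h hx := Subtype.ext (hρ.free x h hx)
  proper C hC := by
    have h1 := hc.isClosedEmbedding_subtypeVal.isCompact_preimage (hρ.proper C hC)
    refine h1.of_isClosed_subset isClosed_closure ?_
    refine closure_minimal ?_ (isClosed_closure.preimage continuous_subtype_val)
    rintro h ⟨x, hx, hxh⟩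
    exact subset_closure ⟨x, hx, hxh⟩

end Restrict

section LieQuotient

variable {G : Type*} [Group G]

/-- The action of a group on itself by right translations. -/
def rightMul (G : Type*) [Group G] : RightAction G G where
  act x g := x * g
  act_one := mul_one
  act_mul x g h := (mul_assoc x g h).symm

variable [TopologicalSpace G]

/-- Restricted to a closed subgroup, this action has the coset space as its orbit space, which makes
the quotient theorem applicable. Properness holds as `g = x⁻¹ (x g)` lies in the compact set `K⁻¹
K`. -/
theorem isPrincipal_rightMul (SG : ManifoldStr G) (hG : LieGroup SG.I ∞ G) :
    (rightMul G).IsPrincipal SG SG where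
  lieGroup := hG
  smooth := contMDiff_mul SG.I ∞
  free x g hg := mul_eq_left.1 hg
  proper K hK := by
    have := topologicalGroup_of_lieGroup (G := G) SG.I ∞
    have := SG.t2Space
    have hc : IsCompact ((fun z : G × G => z.1⁻¹ * z.2) '' (K ×ˢ K)) :=
      (hK.prod hK).image (by fun_prop)
    refine hc.closure_of_subset ?_
    rintro g ⟨x, hx, hg⟩
    exact ⟨(x, x * g), ⟨hx, hg⟩, inv_mul_cancel_left x g⟩

/-- The quotient of a Lie group by a closed normal subgroup is a Lie group. -/
theorem exists_lieGroup_quotient (SG : ManifoldStr G) (hG : LieGroup SG.I ∞ G) (N : Subgroup G)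
    [N.Normal] (hN : IsClosed (N : Set G)) :
    ∃ SQ : ManifoldStr (G ⧸ N),
      Manifold.IsSubmersion SG.I SQ.I ∞ (QuotientGroup.mk : G → G ⧸ N) ∧
      LieGroup SQ.I ∞ (G ⧸ N) := by
  obtain ⟨SN, hSN⟩ := exists_isSmoothEmbedding_subgroup SG hG N hN
  have hp := (isPrincipal_rightMul SG hG).restrict hN hSN
  obtain ⟨SQ, hQ⟩ := hp.exists_isSubmersion (π := (QuotientGroup.mk : G → G ⧸ N))
    isQuotientMap_quotient_mk' (fun x y => by
      rw [QuotientGroup.eq]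
      constructor
      · exact fun h => ⟨⟨_, h⟩, mul_inv_cancel_left x y⟩
      · rintro ⟨g, rfl⟩
        change x⁻¹ * (x * g) ∈ N
        rw [inv_mul_cancel_left]
        exact g.2)
  refine ⟨SQ, hQ, ?_⟩
  have hsurj : Function.Surjective (QuotientGroup.mk : G → G ⧸ N) := QuotientGroup.mk_surjective
  -- The group operations of `G` descend along the projection and its square, which are surjective
  -- submersions.
  have hmul : ContMDiff (SQ.I.prod SQ.I) SQ.I ∞ fun z : (G ⧸ N) × (G ⧸ N) => z.1 * z.2 :=
    (hQ.prodMap hQ).contMDiff_of_comp (hsurj.prodMap hsurj)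
      (hQ.contMDiff.comp (contMDiff_mul SG.I ∞))
  have hinv : ContMDiff SQ.I SQ.I ∞ fun z : G ⧸ N => z⁻¹ :=
    hQ.contMDiff_of_comp hsurj (hQ.contMDiff.comp (contMDiff_inv SG.I ∞))
  exact { contMDiff_mul := hmul, contMDiff_inv := hinv }

variable {X : Type*} [TopologicalSpace X] {SX : ManifoldStr X} {SG : ManifoldStr G}
  {σ : RightAction G X}

theorem IsSmooth.isClosed_ker (hσ : σ.IsSmooth SX SG) : IsClosed (σ.ker : Set G) := by
  have := SX.t2Space
  have : (σ.ker : Set G) = ⋂ x, {g | σ.act x g = x} := by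
    ext g
    simp only [mem_iInter]
    rfl
  rw [this]
  exact isClosed_iInter fun x => isClosed_eq (hσ.const_act x).continuous continuous_const

theorem IsSmooth.quotientKer (hσ : σ.IsSmooth SX SG) {SQ : ManifoldStr (G ⧸ σ.ker)}
    (hQ : Manifold.IsSubmersion SG.I SQ.I ∞ (QuotientGroup.mk : G → G ⧸ σ.ker)) :
    σ.quotientKer.IsSmooth SX SQ :=
  ((Manifold.IsSubmersion.id (I := SX.I) (M := X)).prodMap hQ).contMDiff_of_comp
    (Function.surjective_id.prodMap QuotientGroup.mk_surjective) hσ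

end LieQuotient

/-! ### Actions on orbit spaces -/

section OrbitsAction

variable {G P : Type*} [Group G]

/-- The action of a group on the orbit space of a normal subgroup. -/
def orbitsAction (ρ : RightAction G P) (N : Subgroup G) [N.Normal] :
    RightAction G (ρ.restrict N).Orbits where
  act a k := Quotient.liftOn a (fun x => (ρ.restrict N).proj (ρ.act x k)) fun x y h => by
    obtain ⟨g, rfl⟩ := h
    -- Normality enters here: `(x g) k = (x k) (k⁻¹ g k)`.
    refine (ρ.restrict N).proj_eq_iff.2 ⟨⟨k⁻¹ * g * k, ?_⟩, ?_⟩
    · have := Subgroup.Normal.conj_mem inferInstance (g : G) g.2 k⁻¹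
      rwa [inv_inv] at this
    · change ρ.act (ρ.act x k) (k⁻¹ * g * k) = ρ.act (ρ.act x g) k
      rw [← ρ.act_mul, ← ρ.act_mul, mul_assoc, mul_inv_cancel_left]
  act_one a := by
    induction a using Quotient.inductionOn with
    | h x => exact congrArg (ρ.restrict N).proj (ρ.act_one x)
  act_mul a g h := by
    induction a using Quotient.inductionOn with
    | h x => exact congrArg (ρ.restrict N).proj (ρ.act_mul x g h)

variable [TopologicalSpace G] [TopologicalSpace P] {SP : ManifoldStr P} {SG : ManifoldStr G}
  {ρ : RightAction G P} {N : Subgroup G} [N.Normal]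

theorem IsSmooth.orbitsAction (hs : ρ.IsSmooth SP SG) {SM : ManifoldStr (ρ.restrict N).Orbits}
    (hM : Manifold.IsSubmersion SP.I SM.I ∞ (ρ.restrict N).proj) :
    (ρ.orbitsAction N).IsSmooth SM SG :=
  (hM.prodMap (Manifold.IsSubmersion.id (I := SG.I) (M := G))).contMDiff_of_comp
    ((ρ.restrict N).proj_surjective.prodMap Function.surjective_id)
    (hM.contMDiff.comp hs)

variable {SM : ManifoldStr (ρ.restrict N).Orbits} {SΓ : ManifoldStr (ρ.restrict N).diag.Orbits}

theorem IsSmooth.gaugeAction (hs : ρ.IsSmooth SP SG)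
    (hΓ : Manifold.IsSubmersion (SP.I.prod SP.I) SΓ.I ∞ (ρ.restrict N).diag.proj) :
    (ρ.diag.orbitsAction N).IsSmooth SΓ SG := by
  refine IsSmooth.orbitsAction (SP := SP.prod SP) hs.diag (N := N) (SM := SΓ) ?_
  rw [ManifoldStr.prod_I]
  exact hΓ

theorem isLieGroupoidHom_gaugeAction (hs : ρ.IsSmooth SP SG) (hf : (ρ.restrict N).IsFree)
    (hM : Manifold.IsSubmersion SP.I SM.I ∞ (ρ.restrict N).proj)
    (hΓ : Manifold.IsSubmersion (SP.I.prod SP.I) SΓ.I ∞ (ρ.restrict N).diag.proj) (k : G) :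
    IsLieGroupoidHom SΓ SM ((ρ.restrict N).gaugeGroupoid hf) SΓ SM
      ((ρ.restrict N).gaugeGroupoid hf) (fun a => (ρ.diag.orbitsAction N).act a k)
      (fun x => (ρ.orbitsAction N).act x k) where
  smooth := IsSmooth.act_const (hs.gaugeAction hΓ) k
  smooth_base := (hs.orbitsAction hM).act_const k
  src_map a := by obtain ⟨p, q, rfl⟩ := (ρ.restrict N).exists_pair a; rfl
  tgt_map a := by obtain ⟨p, q, rfl⟩ := (ρ.restrict N).exists_pair a; rfl
  mul_map a b h := by
    obtain ⟨p, q, r, rfl, rfl⟩ := exists_pair_pair a b h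
    have h1 : ((ρ.restrict N).gaugeGroupoid hf).mul ((ρ.restrict N).pair p q)
        ((ρ.restrict N).pair q r) h = (ρ.restrict N).pair p r := gaugeMul_pair hf p q r h
    rw [h1]
    exact (gaugeMul_pair hf (ρ.act p k) (ρ.act q k) (ρ.act r k) rfl).symm

end OrbitsAction

/-! ### Double principal groups acting on principal bundles -/

section Double

variable {G P : Type*} [Group G] {ρ : RightAction G P} {N H : Subgroup G}

theorem isInducedOnGauge_orbitsAction [N.Normal] :
    IsInducedOnGauge (ρ.restrict N) (ρ.restrict H) ((ρ.diag.orbitsAction N).restrict H) :=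
  fun _ _ _ => rfl

/-- A fixed arrow `⟨p, q⟩` yields `g ∈ N` with `p k g = p`, whence `k = g⁻¹` by freeness of the
whole action. A single fixed arrow suffices, so stabilizers are no larger than the kernel. -/
theorem mem_of_act_pair_eq (hf : ρ.IsFree)
    {σ : RightAction H (ρ.restrict N).diag.Orbits}
    (hσ : IsInducedOnGauge (ρ.restrict N) (ρ.restrict H) σ) {a : (ρ.restrict N).diag.Orbits}
    {k : H} (h : σ.act a k = a) : (k : G) ∈ N := by
  obtain ⟨p, q, rfl⟩ := (ρ.restrict N).exists_pair a
  rw [hσ] at h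
  obtain ⟨g, hg, -⟩ := (ρ.restrict N).pair_eq_iff.1 h
  have h1 : (k : G) * g = 1 := hf p _ (by rw [ρ.act_mul]; exact hg)
  rw [eq_inv_of_mul_eq_one_left h1]
  exact N.inv_mem g.2

theorem mem_ker_of_mem {σ : RightAction H (ρ.restrict N).diag.Orbits}
    (hσ : IsInducedOnGauge (ρ.restrict N) (ρ.restrict H) σ) {k : H} (h : (k : G) ∈ N) :
    k ∈ σ.ker := by
  intro a
  obtain ⟨p, q, rfl⟩ := (ρ.restrict N).exists_pair a
  rw [hσ]
  exact ((ρ.restrict N).pair_eq_iff.2 ⟨⟨k, h⟩, rfl, rfl⟩).symm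

/-- A point of `P` provides an arrow to test on; over the empty set the kernel would be all of `H`.
-/
theorem ker_eq_subgroupOf [Nonempty P] (hf : ρ.IsFree)
    {σ : RightAction H (ρ.restrict N).diag.Orbits}
    (hσ : IsInducedOnGauge (ρ.restrict N) (ρ.restrict H) σ) : σ.ker = N.subgroupOf H := by
  ext k
  rw [Subgroup.mem_subgroupOf]
  refine ⟨fun h => ?_, mem_ker_of_mem hσ⟩
  obtain ⟨p⟩ := ‹Nonempty P›
  exact mem_of_act_pair_eq hf hσ (h ((ρ.restrict N).pair p p))

theorem isFree_quotientKer (hf : ρ.IsFree) {σ : RightAction H (ρ.restrict N).diag.Orbits}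
    (hσ : IsInducedOnGauge (ρ.restrict N) (ρ.restrict H) σ) : σ.quotientKer.IsFree := by
  intro a c h
  obtain ⟨k, rfl⟩ := QuotientGroup.mk_surjective c
  exact (QuotientGroup.eq_one_iff k).2 (mem_ker_of_mem hσ (mem_of_act_pair_eq hf hσ h))

variable [TopologicalSpace G]

/-- If `N` is a closed normal subgroup of a Lie group `G` and `H` is a closed subgroup with
`N H = G`, then every compact subset of `G` is contained in `D N` for a compact subset `D`
of `H`. -/
theorem exists_isCompact_cover_of_sup_eq_top (SG : ManifoldStr G) (hG : LieGroup SG.I ∞ G)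
    [N.Normal] (hN : IsClosed (N : Set G)) (hH : IsClosed (H : Set G)) (hsup : N ⊔ H = ⊤)
    {L : Set G} (hL : IsCompact L) :
    ∃ D : Set H, IsCompact D ∧ ∀ g ∈ L, ∃ d ∈ D, (d : G)⁻¹ * g ∈ N := by
  have := topologicalGroup_of_lieGroup (G := G) SG.I ∞
  have := SG.locallyCompactSpace
  have := SG.secondCountable
  have : SigmaCompactSpace H := hH.isClosedEmbedding_subtypeVal.sigmaCompactSpace
  have : LocallyCompactSpace H := hH.isClosedEmbedding_subtypeVal.locallyCompactSpace
  let f : H →* G ⧸ N := (QuotientGroup.mk' N).comp H.subtype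
  have hfs : Function.Surjective f := by
    intro c
    obtain ⟨g, rfl⟩ := QuotientGroup.mk_surjective c
    have hg : g ∈ N ⊔ H := by rw [hsup]; trivial
    obtain ⟨n, hn, k, hk, rfl⟩ := Subgroup.mem_sup_of_normal_left.1 hg
    refine ⟨⟨k, hk⟩, ?_⟩
    change (QuotientGroup.mk k : G ⧸ N) = QuotientGroup.mk (n * k)
    rw [QuotientGroup.mk_mul, (QuotientGroup.eq_one_iff n).2 hn, one_mul]
  have hfc : Continuous f := QuotientGroup.continuous_mk.comp continuous_subtype_val
  -- Open mapping theorem for topological groups: `H` is σ-compact, and `G ⧸ N` is locally compact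
  -- and Hausdorff, hence Baire.
  have hfo : IsOpenMap f := f.isOpenMap_of_sigmaCompact hfs hfc
  obtain ⟨D, hD, hLD⟩ := IsOpenQuotientMap.exists_isCompact_subset_image ⟨hfs, hfc, hfo⟩
    (hL.image (QuotientGroup.continuous_mk (N := N)))
  refine ⟨D, hD, fun g hg => ?_⟩
  obtain ⟨d, hd, hdg⟩ := hLD (mem_image_of_mem _ hg)
  exact ⟨d, hd, QuotientGroup.eq.1 hdg⟩

variable [TopologicalSpace P] {SP : ManifoldStr P} {SG : ManifoldStr G}

/-- If `k` returns an arrow of `C` to `C`, then for some `g ∈ N` the product `k g` lies in a compact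
set furnished by properness of the `G`-action. That set is covered by `D N` with `D ⊆ H` compact, so
`k` agrees with an element of `D` modulo `N ∩ H`, which acts trivially. -/
theorem isProper_quotientKer (hρ : ρ.IsPrincipal SP SG) [N.Normal]
    (hN : IsClosed (N : Set G)) (hH : IsClosed (H : Set G)) (hsup : N ⊔ H = ⊤)
    {σ : RightAction H (ρ.restrict N).diag.Orbits}
    (hσ : IsInducedOnGauge (ρ.restrict N) (ρ.restrict H) σ) [T2Space (H ⧸ σ.ker)] :
    σ.quotientKer.IsProper := by
  intro C hC
  have := SP.locallyCompactSpace
  have ho : IsOpenQuotientMap (ρ.restrict N).diag.proj :=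
    isOpenQuotientMap_of_orbits (ρ := (ρ.restrict N).diag)
      (fun g => ((hρ.smooth.act_const g).continuous.comp continuous_fst).prodMk
        ((hρ.smooth.act_const g).continuous.comp continuous_snd))
      (ρ.restrict N).diag.isQuotientMap_proj fun _ _ => (ρ.restrict N).diag.proj_eq_iff
  obtain ⟨C', hC', hCC'⟩ := ho.exists_isCompact_subset_image hC
  obtain ⟨D, hD, hLD⟩ := exists_isCompact_cover_of_sup_eq_top SG hρ.lieGroup hN hH hsup
    (hρ.proper.diag C' hC')
  refine (hD.image (QuotientGroup.continuous_mk (N := σ.ker))).closure_of_subset ?_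
  rintro c ⟨a, ha, hac⟩
  obtain ⟨k, rfl⟩ := QuotientGroup.mk_surjective c
  obtain ⟨x, hx, rfl⟩ := hCC' ha
  obtain ⟨y, hy, hxy⟩ := hCC' hac
  have h1 : (ρ.restrict N).diag.proj y =
      (ρ.restrict N).pair (ρ.act x.1 k) (ρ.act x.2 k) := hxy.trans (hσ x.1 x.2 k)
  obtain ⟨g, hg⟩ := (ρ.restrict N).diag.proj_eq_iff.1 h1.symm
  have hkg : ρ.diag.act x ((k : G) * g) = y := by
    rw [ρ.diag.act_mul]
    exact hg
  obtain ⟨d, hd, hdk⟩ := hLD ((k : G) * g) (subset_closure ⟨x, hx, by rwa [hkg]⟩)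
  refine ⟨d, hd, QuotientGroup.eq.2 (mem_ker_of_mem hσ ?_)⟩
  -- Both `d⁻¹ (k g)` and `g⁻¹` lie in `N`, hence so does their product `d⁻¹ k`.
  have h2 : ((d⁻¹ * k : H) : G) = (d : G)⁻¹ * ((k : G) * g) * (g : G)⁻¹ := by
    simp [mul_assoc]
  rw [h2]
  exact N.mul_mem hdk (N.inv_mem g.2)

/-- If a closed normal subgroup `N` and a closed subgroup `H` generate `G`, then for each principal
action of `G` the action of `H` is principal relative to that of `N`. -/
theorem IsPrincipal.isRelPrincipal_restrict (hρ : ρ.IsPrincipal SP SG) [N.Normal]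
    (hN : IsClosed (N : Set G)) (hH : IsClosed (H : Set G)) (hsup : N ⊔ H = ⊤)
    {SN : ManifoldStr N} {SH : ManifoldStr H}
    (hSN : Manifold.IsSmoothEmbedding SN.I SG.I ∞ (Subtype.val : N → G))
    (hSH : Manifold.IsSmoothEmbedding SH.I SG.I ∞ (Subtype.val : H → G))
    (hf : (ρ.restrict N).IsFree) :
    IsRelPrincipal SP SH (ρ.restrict N) hf (ρ.restrict H) := by
  have hNp := hρ.restrict hN hSN
  obtain ⟨SM, SΓ, hM, hΓ⟩ := hNp.exists_orbits
  let σ : RightAction H (ρ.restrict N).diag.Orbits := (ρ.diag.orbitsAction N).restrict H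
  have hσ : IsInducedOnGauge (ρ.restrict N) (ρ.restrict H) σ := isInducedOnGauge_orbitsAction
  have hσs : σ.IsSmooth SΓ SH :=
    IsSmooth.restrict (hρ.smooth.gaugeAction hΓ) H hSH.contMDiff
  refine ⟨SM, SΓ, hM, hΓ, hNp.isLieGroupoid hM hΓ, σ, hσ, ⟨hσs, fun k => ?_⟩, ?_⟩
  · exact ⟨_, _, _, isLieGroupoidHom_gaugeAction hρ.smooth hf hM hΓ k,
      isLieGroupoidHom_gaugeAction hρ.smooth hf hM hΓ (k : G)⁻¹,
      (ρ.diag.orbitsAction N).act_act_inv k, (ρ.diag.orbitsAction N).act_inv_act k,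
      (ρ.orbitsAction N).act_act_inv k, (ρ.orbitsAction N).act_inv_act k⟩
  · have hHG := lieGroup_of_isSmoothEmbedding SG hρ.lieGroup H SH hSH
    obtain ⟨SQ, hQ, hQG⟩ := exists_lieGroup_quotient SH hHG σ.ker hσs.isClosed_ker
    have := SQ.t2Space
    exact ⟨SQ, hQ, hQG, hσs.quotientKer hQ, isFree_quotientKer hρ.free hσ,
      isProper_quotientKer hρ hN hH hsup hσ⟩

end Double

end RightAction
-- The theorem on double principal groups
theorem mainTheorem2 {Ĝ P : Type*} [Group Ĝ] [TopologicalSpace Ĝ] [TopologicalSpace P]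
    (SĜ : ManifoldStr Ĝ) (SP : ManifoldStr P) (G G' : Subgroup Ĝ)
    (hG : IsDoublePrincipalGroup SĜ G G')
    (r : RightAction Ĝ P) (hr : r.IsPrincipal SP SĜ) :
    ∃ (SG : ManifoldStr G) (SG' : ManifoldStr G'),
      Manifold.IsSmoothEmbedding SG.I SĜ.I ∞ (Subtype.val : G → Ĝ) ∧
      Manifold.IsSmoothEmbedding SG'.I SĜ.I ∞ (Subtype.val : G' → Ĝ) ∧
      IsDoublePrincipalBundle SP SG SG' (r.restrict G) (r.restrict G') ∧
      (Nonempty P →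
        (∀ σ', IsInducedOnGauge (r.restrict G) (r.restrict G') σ' →
          σ'.ker = (G ⊓ G').subgroupOf G') ∧
        (∀ σ, IsInducedOnGauge (r.restrict G') (r.restrict G) σ →
          σ.ker = (G ⊓ G').subgroupOf G)) := by
  have hN := hG.normal₁
  have hN' := hG.normal₂
  have hsup : G ⊔ G' = ⊤ := by
    rw [Subgroup.sup_eq_closure, hG.generates]
  obtain ⟨SG, hSG⟩ := exists_isSmoothEmbedding_subgroup SĜ hG.lieGroup G hG.isClosed₁
  obtain ⟨SG', hSG'⟩ := exists_isSmoothEmbedding_subgroup SĜ hG.lieGroup G' hG.isClosed₂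
  have hp := hr.restrict hG.isClosed₁ hSG
  have hp' := hr.restrict hG.isClosed₂ hSG'
  refine ⟨SG, SG', hSG, hSG', ⟨hp, hp', ?_, ?_⟩, fun hne => ⟨fun σ hσ => ?_, fun σ hσ => ?_⟩⟩
  · exact hr.isRelPrincipal_restrict hG.isClosed₁ hG.isClosed₂ hsup hSG hSG' hp.free
  -- The hypotheses are symmetric in the two subgroups, so the same result applies with the roles
  -- exchanged.
  · exact hr.isRelPrincipal_restrict hG.isClosed₂ hG.isClosed₁ (sup_comm G G' ▸ hsup) hSG' hSG
      hp'.free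
  · rw [RightAction.ker_eq_subgroupOf hr.free hσ, Subgroup.inf_subgroupOf_right]
  · rw [RightAction.ker_eq_subgroupOf hr.free hσ, Subgroup.inf_subgroupOf_left]
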